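/- **Theorem (Solution to the Dirichlet BVP).** Let $\tau\in\mathbb C$ with $b=\operatorname{Im}\tau>0$, let $\Lambda=\mathbb Z+\mathbb Z\tau$ and $\mathbb T_\tau=\mathbb C/\Lambda$, and let $M\ge 1$. Let $D_1,\dots,D_M\subset\mathbb C$ be bounded, open, simply connected sets whose boundaries are $C^2$ (each $\partial D_j$ is a regular simple closed $C^2$ curve), and suppose that their closures embed in $\mathbb T_\tau$ and are pairwise disjoint there. Put $\Omega=\mathbb T_\tau\setminus\bigcup_{j}\overline{D_j}$, so that $\partial\Omega=\bigcup_j\partial D_j$, and let $\nu$ be the unit normal on $\partial\Omega$ pointing into the holes $D_j$. Functions on subsets of $\mathbb T_\tau$ are identified with $\Lambda$-periodic functions on their preimages in $\mathbb C$, and $C(\partial\Omega)$ is the space of continuous real functions on $\partial\Omega$. Let $$G(z)=-\frac1{2\pi}\log|\vartheta_1(z)|+\frac1{2b}(\operatorname{Im}z)^2,\qquad \vartheta_1(z)=-i\sum_{n\in\mathbb Z}(-1)^n q^{(n+1/2)^2}e^{(2n+1)\pi i z},\quad q=e^{\pi i\tau},$$ and for $\varphi\in C(\partial\Omega)$ let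 $$\mathcal D[\varphi](z)=\int_{\partial\Omega}\partial_{\nu_\xi}G(z-\xi)\,\varphi(\xi)\,|d\xi|\quad(z\in\Omega),\qquad K[\varphi](z_0)=\mathrm{p.v.}\!\int_{\partial\Omega}\partial_{\nu_\xi}G(z_0-\xi)\,\varphi(\xi)\,|d\xi|\quad(z_0\in\partial\Omega),$$ where p.v. denotes the Cauchy principal value. The principal values exist and $K$ maps $C(\partial\Omega)$ to $C(\partial\Omega)$. Let $g\in C(\partial\Omega)$ and fix points $\beta_j\in D_j$. Then there exist a unique $\varphi\in C(\partial\Omega)$ and unique $A_1,\dots,A_M\in\mathbb R$ such that $$-\tfrac12\varphi(z_0)+K[\varphi](z_0)+\sum_{j=1}^M A_j\,G(z_0-\beta_j)=g(z_0)\quad\text{for all } z_0\in\partial\Omega,$$ $$\int_{\partial D_j}\varphi\,|dz|=0\quad(j=1,\dots,M-1),\qquad \sum_{j=1}^M A_j=0.$$ For these $\varphi$ and $A_j$, the function $$u(z)=\mathcal D[\varphi](z)+\sum_{j=1}^M A_j\,G(z-\beta_j),\qquad z\in\Omega,$$ is the unique solution of the Dirichlet problem: $u$ is well defined on $\Omega\subset\mathbb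 T_\tau$, $\Delta u=0$ in $\Omega$, and $u(z)\to g(z_0)$ as $\Omega\ni z\to z_0$, for each $z_0\in\partial\Omega$. Moreover, $A_j$ is the flux of $u$ across $\partial D_j$, for each $j$, in the following sense: for all sufficiently small $h>0$, the curve $\{z-h\nu(z): z\in\partial D_j\}$ lies in $\Omega$, and the integral over it, with respect to its arc length, of the derivative of $u$ in the direction of its unit normal $\nu(z)$ at the point $z-h\nu(z)$ is $A_j$; and if $\nabla u$ extends continuously from $\Omega$ to $\partial D_j$, then $\int_{\partial D_j}\partial_\nu u\,|dz|=A_j$. -/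

import Mathlib

open Set Filter Topology MeasureTheory

noncomputable section

namespace DoublyPeriodic

/-! ### The lattice, the torus and its Green's function -/

/-- The lattice `ℤ + ℤ τ`. -/
def lattice (τ : ℂ) : AddSubgroup ℂ := AddSubgroup.closure {1, τ}

/-- The flat torus `ℂ / (ℤ + ℤ τ)`. -/
abbrev Torus (τ : ℂ) : Type := ℂ ⧸ lattice τ

/-- The projection `ℂ → ℂ / (ℤ + ℤ τ)`. -/
def proj (τ : ℂ) (z : ℂ) : Torus τ := QuotientAddGroup.mk z

/-- The Jacobi theta function
`ϑ₁(z) = -i ∑_{n ∈ ℤ} (-1)^n q^{(n + 1/2)²} e^{(2n+1) π i z}` with nome `q = e^{π i τ}`. -/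
def theta₁ (τ z : ℂ) : ℂ :=
  -Complex.I * ∑' n : ℤ, (-1 : ℂ) ^ n *
    Complex.exp (Real.pi * Complex.I * τ * ((n : ℂ) + 1 / 2) ^ 2) *
    Complex.exp ((2 * (n : ℂ) + 1) * Real.pi * Complex.I * z)

/-- The Green's function of the torus, as a doubly-periodic function on `ℂ`. -/
def green (τ z : ℂ) : ℝ :=
  -(1 / (2 * Real.pi)) * Real.log ‖theta₁ τ z‖ + 1 / (2 * τ.im) * z.im ^ 2

/-! ### Holes with `C²` boundary -/

/-- The unit normal on the right-hand side of a regular plane curve `γ`. -/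
def rightNormal (γ : ℝ → ℂ) (t : ℝ) : ℂ := -Complex.I * (deriv γ t / (‖deriv γ t‖ : ℂ))

/-- A bounded, simply connected open set in the plane with `C²` boundary. The boundary is given
with a regular simple closed `C²` parametrization, of period `1`, which runs through it clockwise,
so that the right-hand normal points into the hole (and the exterior lies on the left). -/
structure C2Hole where
  carrier : Set ℂ
  curve : ℝ → ℂ
  isOpen_carrier : IsOpen carrier
  isBounded_carrier : Bornology.IsBounded carrier
  isSimplyConnected_carrier : IsSimplyConnected carrier
  contDiff_curve : ContDiff ℝ 2 curve
  periodic_curve : Function.Periodic curve 1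
  injOn_curve : InjOn curve (Ico (0 : ℝ) 1)
  deriv_curve_ne_zero : ∀ t, deriv curve t ≠ 0
  range_curve : range curve = frontier carrier
  normal_inward : ∀ t, ∀ᶠ s : ℝ in 𝓝[>] 0, curve t + (s : ℂ) * rightNormal curve t ∈ carrier

namespace C2Hole

variable (D : C2Hole)

/-- The unit normal at the boundary point `D.curve t`, pointing into the hole. -/
def normal (t : ℝ) : ℂ := rightNormal D.curve t

/-- The integral over `∂D` with respect to arc length; the integrand is given as a function of the
parameter. -/
def arcIntegral (f : ℝ → ℝ) : ℝ := ∫ t in (0 : ℝ)..1, f t * ‖deriv D.curve t‖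

/-- The curve parallel to `∂D` at distance `h` outside of the hole. -/
def parallelCurve (h : ℝ) (t : ℝ) : ℂ := D.curve t - (h : ℂ) * D.normal t

/-- The flux of `u` across the curve parallel to `∂D` at distance `h`, in the direction of the
hole: the integral of the normal derivative with respect to the arc length of the parallel curve
(whose unit normal at the parameter `t` is again `D.normal t`, for small `h`). -/
def parallelFlux (u : ℂ → ℝ) (h : ℝ) : ℝ :=
  ∫ t in (0 : ℝ)..1,
    fderiv ℝ u (D.parallelCurve h t) (D.normal t) * ‖deriv (D.parallelCurve h) t‖

end C2Hole

/-- A torus `ℂ / (ℤ + ℤ τ)` with `M` holes `D_j ⊆ ℂ` whose closures are embedded in the torus and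
are disjoint there. -/
structure HoledTorus (τ : ℂ) (M : ℕ) where
  hole : Fin M → C2Hole
  injOn_proj : ∀ j, InjOn (proj τ) (closure (hole j).carrier)
  disjoint_closure : Pairwise fun i j =>
    Disjoint (proj τ '' closure (hole i).carrier) (proj τ '' closure (hole j).carrier)

namespace HoledTorus

variable {τ : ℂ} {M : ℕ} (X : HoledTorus τ M)

/-- The domain `Ω`, that is, the torus without the closed holes. -/
def domain : Set (Torus τ) := (⋃ j, proj τ '' closure (X.hole j).carrier)ᶜ

/-- The doubly-periodic subset of `ℂ` that covers `Ω`. Functions on `Ω` are treated as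
doubly-periodic functions on this set. -/
def cover : Set ℂ := proj τ ⁻¹' X.domain

/-- The boundary `∂Ω = ⋃ j, ∂D_j`; each of its points has exactly one representative in this
subset of `ℂ`. -/
def boundary : Set ℂ := ⋃ j, frontier (X.hole j).carrier

theorem curve_mem_boundary (j : Fin M) (t : ℝ) : (X.hole j).curve t ∈ X.boundary :=
  mem_iUnion.2 ⟨j, (X.hole j).range_curve ▸ mem_range_self t⟩

/-- The point of `∂D_j ⊆ ∂Ω` with parameter `t`. -/
def boundaryPoint (j : Fin M) (t : ℝ) : X.boundary :=
  ⟨(X.hole j).curve t, X.curve_mem_boundary j t⟩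

/-- The kernel `∂_{ν_ξ} G(z - ξ)` at the point `ξ ∈ ∂D_j` with parameter `t`. -/
def kernel (z : ℂ) (j : Fin M) (t : ℝ) : ℝ :=
  fderiv ℝ (fun ξ : ℂ => green τ (z - ξ)) ((X.hole j).curve t) ((X.hole j).normal t)

/-- The double-layer potential `𝓓[φ](z) = ∫_{∂Ω} ∂_{ν_ξ} G(z - ξ) φ(ξ) |dξ|`. -/
def doubleLayer (φ : C(X.boundary, ℝ)) (z : ℂ) : ℝ :=
  ∑ j, (X.hole j).arcIntegral fun t => X.kernel z j t * φ (X.boundaryPoint j t)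

open Classical in
/-- The integral `∫ ∂_{ν_ξ} G(z - ξ) φ(ξ) |dξ|` over the points `ξ ∈ ∂Ω` with `|z - ξ| > ε`. -/
def truncatedDoubleLayer (φ : C(X.boundary, ℝ)) (ε : ℝ) (z : ℂ) : ℝ :=
  ∑ j, (X.hole j).arcIntegral fun t =>
    if ε < ‖z - (X.hole j).curve t‖ then X.kernel z j t * φ (X.boundaryPoint j t) else 0

/-- `K[φ] = ψ`: at each point `z₀ ∈ ∂Ω` the Cauchy principal value
`p.v. ∫_{∂Ω} ∂_{ν_ξ} G(z₀ - ξ) φ(ξ) |dξ|` exists and is `ψ(z₀)`. -/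
def BoundaryDoubleLayerEq (φ ψ : C(X.boundary, ℝ)) : Prop :=
  ∀ z₀ : X.boundary,
    Tendsto (fun ε => X.truncatedDoubleLayer φ ε z₀) (𝓝[>] 0) (𝓝 (ψ z₀))

/-- The system for the density `φ` and the coefficients `A`:
`-φ/2 + K[φ] + ∑ A_j G(· - β_j) = g` on `∂Ω`, with `∫_{∂D_j} φ |dz| = 0` for each `j` except the
last one, and with `∑ A_j = 0`. -/
structure SolvesSystem (β : Fin M → ℂ) (g φ : C(X.boundary, ℝ)) (A : Fin M → ℝ) : Prop where
  integral_eq : ∃ ψ : C(X.boundary, ℝ), X.BoundaryDoubleLayerEq φ ψ ∧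
    ∀ z₀ : X.boundary,
      -(1 / 2) * φ z₀ + ψ z₀ + ∑ j, A j * green τ ((z₀ : ℂ) - β j) = g z₀
  mean_zero : ∀ j : Fin M, (j : ℕ) + 1 < M →
    (X.hole j).arcIntegral (fun t => φ (X.boundaryPoint j t)) = 0
  sum_zero : ∑ j, A j = 0

/-- The function `𝓓[φ] + ∑ A_j G(· - β_j)`. -/
def representation (β : Fin M → ℂ) (φ : C(X.boundary, ℝ)) (A : Fin M → ℝ) (z : ℂ) : ℝ :=
  X.doubleLayer φ z + ∑ j, A j * green τ (z - β j)

/-- `u` is a solution on the torus of `Δ u = 0` in `Ω` and `u = g` on `∂Ω`, where the boundary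
values are limits from `Ω`. -/
structure IsDirichletSolution (g : C(X.boundary, ℝ)) (u : ℂ → ℝ) : Prop where
  periodic : ∀ z ∈ X.cover, ∀ l ∈ lattice τ, u (z + l) = u z
  harmonic : InnerProductSpace.HarmonicOnNhd u X.cover
  boundary_value : ∀ z₀ : X.boundary, Tendsto u (𝓝[X.cover] (z₀ : ℂ)) (𝓝 (g z₀))

/-- `a` is the flux of `u` across `∂D_j`. As `∂_ν u` need not exist on `∂Ω` when the boundary values
are only continuous, the flux is taken across the parallel curves in `Ω` that are close enough to
`∂D_j`. Where the gradient of `u` extends continuously to `∂D_j`, we also ask that `a` is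
`∫_{∂D_j} ∂_ν u |dz|`. -/
structure HasFlux (u : ℂ → ℝ) (j : Fin M) (a : ℝ) : Prop where
  parallel : ∀ᶠ h in 𝓝[>] (0 : ℝ),
    (∀ t, (X.hole j).parallelCurve h t ∈ X.cover) ∧ (X.hole j).parallelFlux u h = a
  classical : ∀ L : ℝ → ℂ →L[ℝ] ℝ,
    (∀ t, Tendsto (fderiv ℝ u) (𝓝[X.cover] ((X.hole j).curve t)) (𝓝 (L t))) →
      (X.hole j).arcIntegral (fun t => L t ((X.hole j).normal t)) = a

end HoledTorus

end DoublyPeriodic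

end

open Set Filter Topology MeasureTheory

noncomputable section

namespace DoublyPeriodic

/-! The representation turns the boundary value problem into a Fredholm equation of the second kind,
and the theorem follows once the homogeneous system is shown to have only the zero solution.

Everything rests on the zeros of ϑ₁ being simple and being exactly the lattice. This is obtained by
comparing ϑ₁ with an infinite product that has the same multipliers: the quotient is an entire
doubly periodic function, hence constant by Liouville (`exists_theta₁_eq_mul_thetaProd`). So G is
smooth off the lattice, doubly periodic there, and has a logarithmic singularity.

Off the boundary the double-layer potential is the real part of a holomorphic function F,
`complexPotential`. Near ∂D_j this F is a Cauchy integral plus a continuous term. The difference of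
the two one-sided values of the Cauchy integral gives the jump φ of F (`tendsto_cauchy_sub`). For a
C² curve the kernel that governs the sum of the two sides is bounded (`exists_abs_im_add_le`). Hence
the principal value is an ordinary integral, and 𝓓[φ] tends to K[φ] - φ/2 from Ω. Since ∑ A_j = 0,
the constant Laplacians of the terms G(· - β_j) cancel, so a solution of the system gives a solution
of the Dirichlet problem, unique by the maximum principle.

The flux of the representation is read off from argument integrals: F is a single-valued primitive
and contributes nothing, the winding number of the clockwise curve around β_j contributes A_j, and
the non-holomorphic terms cancel by ∑ A_j = 0.

K is compact by Arzelà–Ascoli, so the system has the form (T - 1)(φ, A) = (2g, 0) with T compact,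
and injectivity implies bijectivity. For g = 0 the function u vanishes in Ω, so its fluxes A_j
vanish, and then 𝓓[φ] = 0 in Ω. Then F is locally constant in Ω. Its jump is real, so Im F has
constant boundary values inside each hole; hence F is constant there and φ is a constant c_j on ∂D_j
(`exists_density_eq_const`). The mean conditions kill every c_j but the last. The potential of a
constant density on the last curve is, in Ω, minus that constant times the area of the hole divided
by b. This is not zero, because the Laplacian of G has a constant background term, so the last
constant vanishes too. -/

/-! ### Functional equations of the first theta function -/

open Complex in
theorem neg_cexp (x : ℂ) : -exp x = exp (x - Real.pi * I) := by
  rw [exp_sub, exp_pi_mul_I, div_neg, div_one]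

open Complex in
theorem theta₁_eq_jacobiTheta₂ (τ z : ℂ) :
    theta₁ τ z = -I * exp (Real.pi * I * τ / 4 + Real.pi * I * z) *
      jacobiTheta₂ (z + τ / 2 + 1 / 2) τ := by
  rw [theta₁, jacobiTheta₂, ← tsum_mul_left, ← tsum_mul_left]
  refine tsum_congr fun n => ?_
  have h1 : (-1 : ℂ) ^ n = exp (Real.pi * I * n) := by
    rw [mul_comm, exp_int_mul, exp_pi_mul_I]
  rw [h1, jacobiTheta₂_term, ← exp_add, ← exp_add, mul_assoc (-I), ← exp_add]
  congr 2
  ring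

theorem differentiable_theta₁ {τ : ℂ} (hτ : 0 < τ.im) : Differentiable ℂ (theta₁ τ) := by
  intro z
  have h : theta₁ τ = fun z => -Complex.I * Complex.exp (Real.pi * Complex.I * τ / 4 +
      Real.pi * Complex.I * z) * jacobiTheta₂ (z + τ / 2 + 1 / 2) τ :=
    funext (theta₁_eq_jacobiTheta₂ τ)
  rw [h]
  refine DifferentiableAt.mul (by fun_prop) ?_
  exact (differentiableAt_jacobiTheta₂_fst (z + τ / 2 + 1 / 2) hτ).comp
    (f := fun z => z + τ / 2 + 1 / 2) z (by fun_prop)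

open Complex in
theorem theta₁_add_one (τ z : ℂ) : theta₁ τ (z + 1) = -theta₁ τ z := by
  rw [theta₁_eq_jacobiTheta₂, theta₁_eq_jacobiTheta₂,
    show z + 1 + τ / 2 + 1 / 2 = z + τ / 2 + 1 / 2 + 1 by ring, jacobiTheta₂_add_left,
    show Real.pi * I * τ / 4 + Real.pi * I * (z + 1) =
      (Real.pi * I * τ / 4 + Real.pi * I * z) + Real.pi * I by ring, exp_add _ (Real.pi * I),
    exp_pi_mul_I]
  ring

open Complex in
theorem theta₁_add_tau (τ z : ℂ) :
    theta₁ τ (z + τ) = -exp (-(Real.pi * I * (τ + 2 * z))) * theta₁ τ z := by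
  rw [theta₁_eq_jacobiTheta₂, theta₁_eq_jacobiTheta₂,
    show z + τ + τ / 2 + 1 / 2 = z + τ / 2 + 1 / 2 + τ by ring, jacobiTheta₂_add_left']
  have h : exp (Real.pi * I * τ / 4 + Real.pi * I * (z + τ)) *
      exp (-Real.pi * I * (τ + 2 * (z + τ / 2 + 1 / 2))) =
      -exp (-(Real.pi * I * (τ + 2 * z))) * exp (Real.pi * I * τ / 4 + Real.pi * I * z) := by
    rw [neg_cexp, ← exp_add, ← exp_add]
    congr 1
    ring
  linear_combination (-I * jacobiTheta₂ (z + τ / 2 + 1 / 2) τ) * h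

open Complex in
theorem theta₁_neg (τ z : ℂ) : theta₁ τ (-z) = -theta₁ τ z := by
  rw [theta₁_eq_jacobiTheta₂, theta₁_eq_jacobiTheta₂,
    show z + τ / 2 + 1 / 2 = -(-z - τ / 2 + 1 / 2) + 1 by ring, jacobiTheta₂_add_left,
    jacobiTheta₂_neg_left, show -z + τ / 2 + 1 / 2 = (-z - τ / 2 + 1 / 2) + τ by ring,
    jacobiTheta₂_add_left']
  have h : exp (Real.pi * I * τ / 4 + Real.pi * I * -z) *
      exp (-Real.pi * I * (τ + 2 * (-z - τ / 2 + 1 / 2))) =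
      -exp (Real.pi * I * τ / 4 + Real.pi * I * z) := by
    rw [neg_cexp, ← exp_add]
    congr 1
    ring
  linear_combination (-I * jacobiTheta₂ (-z - τ / 2 + 1 / 2) τ) * h

theorem theta₁_zero (τ : ℂ) : theta₁ τ 0 = 0 := by
  have h := theta₁_neg τ 0
  rw [neg_zero] at h
  exact self_eq_neg.1 h

/-! ### The lattice and its closed fundamental cell -/

theorem mem_lattice_iff {τ z : ℂ} : z ∈ lattice τ ↔ ∃ m n : ℤ, z = m + n * τ := by
  rw [lattice, AddSubgroup.mem_closure_pair]
  simp [eq_comm]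

theorem one_mem_lattice (τ : ℂ) : (1 : ℂ) ∈ lattice τ := AddSubgroup.subset_closure (by simp)

theorem tau_mem_lattice (τ : ℂ) : τ ∈ lattice τ := AddSubgroup.subset_closure (by simp)

/-- The target is an arbitrary type, so that predicates such as `f z = 0` are covered as well; these
are periodic even when `f` is only quasi-periodic. -/
theorem map_add_lattice {τ : ℂ} {α : Type*} {f : ℂ → α} (h1 : ∀ z, f (z + 1) = f z)
    (h2 : ∀ z, f (z + τ) = f z) {l : ℂ} (hl : l ∈ lattice τ) (z : ℂ) : f (z + l) = f z := by
  induction hl using AddSubgroup.closure_induction generalizing z with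
  | mem x hx => rcases hx with rfl | rfl <;> simp [h1, h2]
  | zero => simp
  | add x y _ _ hx hy => rw [← add_assoc, hy, hx]
  | neg x _ hx => rw [← hx (z + -x), neg_add_cancel_right]

theorem exists_add_lattice_eq {τ : ℂ} (hτ : 0 < τ.im) (z : ℂ) :
    ∃ l ∈ lattice τ, ∃ x ∈ Icc (0 : ℝ) 1, ∃ y ∈ Icc (0 : ℝ) 1, z + l = x + y * τ := by
  set y := z.im / τ.im
  set x := z.re - y * τ.re
  have hz : z = x + y * τ := by
    apply Complex.ext <;> simp [x, y, hτ.ne']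
  refine ⟨-⌊x⌋ + -⌊y⌋ * τ, mem_lattice_iff.2 ⟨-⌊x⌋, -⌊y⌋, by simp⟩, Int.fract x,
    ⟨Int.fract_nonneg x, (Int.fract_lt_one x).le⟩, Int.fract y,
    ⟨Int.fract_nonneg y, (Int.fract_lt_one y).le⟩, ?_⟩
  rw [hz]
  simp only [Int.fract]
  push_cast
  ring

theorem isCompact_cell (τ : ℂ) :
    IsCompact ((fun p : ℝ × ℝ => (p.1 + p.2 * τ : ℂ)) '' (Icc 0 1 ×ˢ Icc 0 1)) :=
  (isCompact_Icc.prod isCompact_Icc).image (by fun_prop)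

/-! ### An infinite product with visible zeros -/

/-- The `q`-Pochhammer product `∏ (1 - q ^ n w)`. -/
def qProd (q w : ℂ) : ℂ := ∏' n : ℕ, (1 - q ^ n * w)

theorem summable_qProd {q : ℂ} (hq : ‖q‖ < 1) (w : ℂ) : Summable fun n : ℕ => ‖-(q ^ n * w)‖ := by
  simpa using (summable_geometric_of_lt_one (norm_nonneg _) hq).mul_right ‖w‖

theorem differentiable_qProd {q : ℂ} (hq : ‖q‖ < 1) : Differentiable ℂ (qProd q) := by
  have h : MultipliableLocallyUniformlyOn (fun (n : ℕ) w => 1 + -(q ^ n * w)) univ := by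
    refine ⟨fun w => ∏' n : ℕ, (1 + -(q ^ n * w)), ?_⟩
    apply hasProdLocallyUniformlyOn_of_forall_compact isOpen_univ
    intro K _ hcK
    obtain ⟨R, hR⟩ := hcK.isBounded.exists_norm_le
    refine ((summable_geometric_of_lt_one (norm_nonneg _) hq).mul_right
      R).hasProdUniformlyOn_nat_one_add hcK (.of_forall fun n x hx ↦ ?_) (fun _ ↦ by fun_prop)
    simpa using mul_le_mul_of_nonneg_left (hR x hx) (by positivity)
  have h2 := h.hasProdLocallyUniformlyOn.differentiableOn
    (.of_forall fun _ ↦ by simpa [Finset.prod_fn] using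
      DifferentiableOn.finsetProd (fun _ _ ↦ by fun_prop)) isOpen_univ
  rw [← differentiableOn_univ]
  simpa only [← sub_eq_add_neg] using! h2

theorem multipliable_qProd {q : ℂ} (hq : ‖q‖ < 1) (w : ℂ) :
    Multipliable fun n : ℕ => 1 - q ^ n * w := by
  simp only [sub_eq_add_neg]
  exact multipliable_one_add_of_summable (summable_qProd hq w)

theorem qProd_eq_mul {q : ℂ} (hq : ‖q‖ < 1) (w : ℂ) :
    qProd q w = (1 - w) * qProd q (q * w) := by
  have h : ∀ n : ℕ, 1 - q ^ (n + 1) * w = 1 - q ^ n * (q * w) := fun n => by ring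
  have h' : Multipliable fun n : ℕ => 1 - q ^ (n + 1) * w :=
    (multipliable_qProd hq (q * w)).congr fun n => (h n).symm
  have h2 := tprod_eq_zero_mul' (f := fun n : ℕ => 1 - q ^ n * w) h'
  rw [qProd, h2, qProd, pow_zero, one_mul, tprod_congr h]

theorem qProd_ne_zero {q : ℂ} (hq : ‖q‖ < 1) {w : ℂ} (hw : ∀ n : ℕ, q ^ n * w ≠ 1) :
    qProd q w ≠ 0 := by
  have := tprod_one_add_ne_zero_of_summable (f := fun n : ℕ => -(q ^ n * w))
    (fun n => by simpa [← sub_eq_add_neg, sub_eq_zero] using (hw n).symm) (summable_qProd hq w)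
  simpa only [← sub_eq_add_neg] using! this

open Complex in
/-- The product `e^{-π i z} ∏ (1 - Q ^ n e^{2 π i z}) ∏ (1 - Q ^ {n + 1} e^{- 2 π i z})` with
`Q = e^{2 π i τ}`, a multiple of the first theta function. -/
def thetaProd (τ z : ℂ) : ℂ :=
  exp (-(Real.pi * I * z)) * (qProd (exp (2 * Real.pi * I * τ)) (exp (2 * Real.pi * I * z)) *
    qProd (exp (2 * Real.pi * I * τ)) (exp (2 * Real.pi * I * (τ - z))))

open Complex in
theorem norm_exp_two_pi_I_mul_lt_one {τ : ℂ} (hτ : 0 < τ.im) :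
    ‖exp (2 * Real.pi * I * τ)‖ < 1 := by
  simp [norm_exp]; positivity

theorem differentiable_thetaProd {τ : ℂ} (hτ : 0 < τ.im) : Differentiable ℂ (thetaProd τ) := by
  have h := differentiable_qProd (norm_exp_two_pi_I_mul_lt_one hτ)
  unfold thetaProd
  refine Differentiable.mul (by fun_prop) (.mul ?_ ?_)
  · exact h.comp (by fun_prop)
  · exact h.comp (f := fun z => Complex.exp (2 * Real.pi * Complex.I * (τ - z))) (by fun_prop)

open Complex in
theorem thetaProd_add_one (τ z : ℂ) : thetaProd τ (z + 1) = -thetaProd τ z := by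
  have h1 : exp (2 * Real.pi * I * (z + 1)) = exp (2 * Real.pi * I * z) := by
    rw [mul_add, exp_add, mul_one, exp_two_pi_mul_I, mul_one]
  have h2 : exp (2 * Real.pi * I * (τ - (z + 1))) = exp (2 * Real.pi * I * (τ - z)) := by
    rw [show 2 * Real.pi * I * (τ - (z + 1)) = 2 * Real.pi * I * (τ - z) - 2 * Real.pi * I by ring,
      exp_sub, exp_two_pi_mul_I, div_one]
  have h3 : exp (-(Real.pi * I * (z + 1))) = -exp (-(Real.pi * I * z)) := by
    rw [neg_cexp]
    congr 1
    ring
  rw [thetaProd, h1, h2, h3, thetaProd]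
  ring

open Complex in
-- With w = e^{2πiz}, the shift by τ removes the leading factor 1 - w from the first product and
-- adds the factor 1 - w⁻¹ to the second. The ratio of these factors, with the change of the
-- exponential prefactor, is the multiplier.
theorem thetaProd_add_tau {τ : ℂ} (hτ : 0 < τ.im) (z : ℂ) :
    thetaProd τ (z + τ) = -exp (-(Real.pi * I * (τ + 2 * z))) * thetaProd τ z := by
  have hq := norm_exp_two_pi_I_mul_lt_one hτ
  rw [thetaProd, thetaProd, qProd_eq_mul hq (exp (2 * Real.pi * I * z)), ← exp_add,
    qProd_eq_mul hq (exp (2 * Real.pi * I * (τ - (z + τ)))), ← exp_add,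
    show 2 * Real.pi * I * (z + τ) = 2 * Real.pi * I * τ + 2 * Real.pi * I * z by ring,
    show 2 * Real.pi * I * τ + 2 * Real.pi * I * (τ - (z + τ)) = 2 * Real.pi * I * (τ - z) by ring,
    show 2 * Real.pi * I * (τ - (z + τ)) = -(2 * Real.pi * I * z) by ring]
  have h : exp (-(Real.pi * I * (z + τ))) * (1 - exp (-(2 * Real.pi * I * z))) =
      -exp (-(Real.pi * I * (τ + 2 * z))) * (exp (-(Real.pi * I * z)) *
        (1 - exp (2 * Real.pi * I * z))) := by
    rw [mul_sub, mul_sub, mul_sub, ← exp_add, ← exp_add, mul_one, mul_one, neg_mul, neg_mul,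
      ← exp_add, ← exp_add, show -(Real.pi * I * (τ + 2 * z)) + (-(Real.pi * I * z) +
        2 * Real.pi * I * z) = -(Real.pi * I * (z + τ)) by ring,
      show -(Real.pi * I * (z + τ)) + -(2 * Real.pi * I * z) =
        -(Real.pi * I * (τ + 2 * z)) + -(Real.pi * I * z) by ring]
    ring
  linear_combination (qProd (exp (2 * Real.pi * I * τ)) (exp (2 * Real.pi * I * τ +
    2 * Real.pi * I * z)) * qProd (exp (2 * Real.pi * I * τ)) (exp (2 * Real.pi * I * (τ - z)))) * h

open Complex in
theorem mem_lattice_of_exp_eq_one {τ z : ℂ} {n : ℤ}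
    (h : exp (2 * Real.pi * I * (n * τ + z)) = 1) : z ∈ lattice τ := by
  obtain ⟨m, hm⟩ := exp_eq_one_iff.1 h
  have h2 : (2 * Real.pi * I : ℂ) ≠ 0 := two_pi_I_ne_zero
  refine mem_lattice_iff.2 ⟨m, -n, ?_⟩
  push_cast
  apply mul_left_cancel₀ h2
  linear_combination hm

open Complex in
theorem thetaProd_ne_zero {τ z : ℂ} (hτ : 0 < τ.im) (hz : z ∉ lattice τ) : thetaProd τ z ≠ 0 := by
  have hq := norm_exp_two_pi_I_mul_lt_one hτ
  refine mul_ne_zero (exp_ne_zero _) (mul_ne_zero (qProd_ne_zero hq fun n hn => hz ?_)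
    (qProd_ne_zero hq fun n hn => hz ?_))
  · rw [← exp_nat_mul, ← exp_add] at hn
    refine mem_lattice_of_exp_eq_one (n := n) ?_
    rw [← hn]; congr 1; push_cast; ring
  · rw [← exp_nat_mul, ← exp_add] at hn
    rw [← neg_mem_iff]
    refine mem_lattice_of_exp_eq_one (n := n + 1) ?_
    rw [← hn]; congr 1; push_cast; ring

open Complex in
theorem thetaProd_zero {τ : ℂ} (hτ : 0 < τ.im) : thetaProd τ 0 = 0 := by
  rw [thetaProd, qProd_eq_mul (norm_exp_two_pi_I_mul_lt_one hτ)]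
  simp

open Complex in
-- Only the factor 1 - e^{2πiz} vanishes at the origin, and it does so simply.
theorem deriv_thetaProd_ne_zero {τ : ℂ} (hτ : 0 < τ.im) : deriv (thetaProd τ) 0 ≠ 0 := by
  have hq := norm_exp_two_pi_I_mul_lt_one hτ
  have hA := differentiable_qProd hq
  set Q := exp (2 * Real.pi * I * τ) with hQ
  set B : ℂ → ℂ := fun z => exp (-(Real.pi * I * z)) * (qProd Q (Q * exp (2 * Real.pi * I * z)) *
    qProd Q (exp (2 * Real.pi * I * (τ - z)))) with hB
  have hdB : Differentiable ℂ B := by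
    refine Differentiable.mul (by fun_prop) (.mul ?_ ?_)
    · exact hA.comp (f := fun z => Q * Complex.exp (2 * Real.pi * Complex.I * z)) (by fun_prop)
    · exact hA.comp (f := fun z => Complex.exp (2 * Real.pi * Complex.I * (τ - z))) (by fun_prop)
  have h : thetaProd τ = fun z => (1 - exp (2 * Real.pi * I * z)) * B z := by
    funext z
    rw [thetaProd, qProd_eq_mul hq (exp (2 * Real.pi * I * z)), hB]
    ring
  have h1 : HasDerivAt (fun z : ℂ => 1 - exp (2 * Real.pi * I * z)) (-(2 * Real.pi * I)) 0 := by
    have := (((hasDerivAt_id (0 : ℂ)).const_mul (2 * Real.pi * I)).cexp).const_sub 1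
    simpa using! this
  have h2 := h1.mul (hdB 0).hasDerivAt
  rw [h]
  rw [show (fun z => (1 - exp (2 * Real.pi * I * z)) * B z) =
    (fun z : ℂ => 1 - exp (2 * Real.pi * I * z)) * B from rfl, h2.deriv]
  have hQn : ∀ n : ℕ, Q ^ n * Q ≠ 1 := by
    intro n hn
    have : ‖Q ^ n * Q‖ < 1 := by
      rw [← pow_succ, norm_pow]
      exact pow_lt_one₀ (norm_nonneg _) hq (by simp)
    simp [hn] at this
  have hB0 : B 0 ≠ 0 := by
    simp only [hB, mul_zero, neg_zero, exp_zero, mul_one, one_mul, sub_zero, ← hQ]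
    exact mul_ne_zero (qProd_ne_zero hq hQn) (qProd_ne_zero hq hQn)
  simpa using hB0

/-! ### Comparison of ϑ₁ with the product, and the zeros of ϑ₁ -/

theorem map_add_lattice_eq_zero_iff {τ : ℂ} {f : ℂ → ℂ} {e : ℂ → ℂ} (he : ∀ z, e z ≠ 0)
    (h1 : ∀ z, f (z + 1) = -f z) (h2 : ∀ z, f (z + τ) = e z * f z) {l : ℂ}
    (hl : l ∈ lattice τ) (z : ℂ) : f (z + l) = 0 ↔ f z = 0 := by
  have := map_add_lattice (f := fun z => f z = 0) (τ := τ) (by simp [h1]) (by simp [h2, he]) hl z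
  simpa using this

theorem thetaProd_eq_zero_iff {τ z : ℂ} (hτ : 0 < τ.im) : thetaProd τ z = 0 ↔ z ∈ lattice τ := by
  refine ⟨fun h => by_contra fun hz => thetaProd_ne_zero hτ hz h, fun h => ?_⟩
  rw [← zero_add z, map_add_lattice_eq_zero_iff (e := fun z =>
    -Complex.exp (-(Real.pi * Complex.I * (τ + 2 * z)))) (by simp) (thetaProd_add_one τ)
    (thetaProd_add_tau hτ) h, thetaProd_zero hτ]

theorem isBounded_range_of_periodic {τ : ℂ} (hτ : 0 < τ.im) {f : ℂ → ℂ} (hf : Continuous f)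
    (h1 : ∀ z, f (z + 1) = f z) (h2 : ∀ z, f (z + τ) = f z) : Bornology.IsBounded (range f) := by
  refine ((isCompact_cell τ).image hf).isBounded.subset ?_
  rintro _ ⟨z, rfl⟩
  obtain ⟨l, hl, x, hx, y, hy, h⟩ := exists_add_lattice_eq hτ z
  exact ⟨z + l, ⟨(x, y), ⟨hx, hy⟩, h.symm⟩, map_add_lattice h1 h2 hl z⟩

/-- Both functions have the same multipliers, so their quotient is doubly periodic. The product has
simple zeros, at lattice points only, and ϑ₁ vanishes at the origin, so the quotient extends to an
entire function. It is bounded on a cell, hence constant. -/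
theorem exists_theta₁_eq_mul_thetaProd {τ : ℂ} (hτ : 0 < τ.im) :
    ∃ c : ℂ, ∀ z, theta₁ τ z = c * thetaProd τ z := by
  classical
  set r₀ := deriv (theta₁ τ) 0 / deriv (thetaProd τ) 0
  -- `r₀` is the removable value at the origin; by periodicity it is the right value at all lattice
  -- points.
  set R : ℂ → ℂ := fun z => if thetaProd τ z = 0 then r₀ else theta₁ τ z / thetaProd τ z with hR
  have hdP := differentiable_thetaProd hτ
  have hdT := differentiable_theta₁ hτ
  have hR1 : ∀ z, R (z + 1) = R z := fun z => by
    simp only [hR, thetaProd_add_one, theta₁_add_one, neg_eq_zero, neg_div_neg_eq]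
  have hR2 : ∀ z, R (z + τ) = R z := fun z => by
    have h : -Complex.exp (-(Real.pi * Complex.I * (τ + 2 * z))) ≠ 0 := by simp
    simp only [hR, thetaProd_add_tau hτ, theta₁_add_tau, mul_eq_zero, h, false_or,
      mul_div_mul_left _ _ h]
  have h0 : DifferentiableAt ℂ R 0 := by
    have hdT' : DifferentiableAt ℂ (dslope (theta₁ τ) 0) 0 :=
      ((Complex.differentiableOn_dslope univ_mem).2 hdT.differentiableOn).differentiableAt univ_mem
    have hdP' : DifferentiableAt ℂ (dslope (thetaProd τ) 0) 0 :=
      ((Complex.differentiableOn_dslope univ_mem).2 hdP.differentiableOn).differentiableAt univ_mem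
    have hne : dslope (thetaProd τ) 0 0 ≠ 0 := by
      rw [dslope_same]; exact deriv_thetaProd_ne_zero hτ
    refine (hdT'.div hdP' hne).congr_of_eventuallyEq ?_
    filter_upwards [hdP'.continuousAt.eventually_ne hne] with z hz
    simp only [hR, Pi.div_apply]
    by_cases hz0 : z = 0
    · simp [hz0, thetaProd_zero hτ, r₀]
    · rw [dslope_of_ne _ hz0, slope_def_field, sub_zero, thetaProd_zero hτ, sub_zero] at hz
      rw [dslope_of_ne _ hz0, dslope_of_ne _ hz0, slope_def_field, slope_def_field, sub_zero,
        theta₁_zero, thetaProd_zero hτ, sub_zero, sub_zero, div_div_div_cancel_right₀ hz0, if_neg]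
      exact fun h => hz (by rw [h, zero_div])
  have hd : Differentiable ℂ R := by
    intro z
    by_cases hz : thetaProd τ z = 0
    · have hper : R = fun w => R (w - z) := funext fun w => by
        have := map_add_lattice hR1 hR2 ((thetaProd_eq_zero_iff hτ).1 hz) (w - z)
        rw [← this, sub_add_cancel]
      rw [hper]
      have : DifferentiableAt ℂ R (z - z) := by rwa [sub_self]
      exact this.comp (f := fun w => w - z) z (by fun_prop)
    · refine ((hdT z).div (hdP z) hz).congr_of_eventuallyEq ?_
      filter_upwards [(hdP z).continuousAt.eventually_ne hz] with w hw
      simp only [hR, if_neg hw, Pi.div_apply]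
  have hb := isBounded_range_of_periodic hτ hd.continuous hR1 hR2
  refine ⟨r₀, fun z => ?_⟩
  have hz := hd.apply_eq_apply_of_bounded hb z 0
  have hR0 : R 0 = r₀ := by simp [hR, thetaProd_zero hτ]
  by_cases h : thetaProd τ z = 0
  · rw [h, mul_zero, ← zero_add z, map_add_lattice_eq_zero_iff (e := fun z =>
      -Complex.exp (-(Real.pi * Complex.I * (τ + 2 * z)))) (by simp) (theta₁_add_one τ)
      (theta₁_add_tau τ) ((thetaProd_eq_zero_iff hτ).1 h), theta₁_zero]
  · rw [← hR0, ← hz]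
    simp only [hR, if_neg h, div_mul_cancel₀ _ h]

open Complex in
-- Only the zeroth Fourier mode survives integration over a period. This shows that ϑ₁ does not
-- vanish identically, so the constant in the comparison with the product is not zero.
theorem integral_jacobiTheta₂ {τ : ℂ} (hτ : 0 < τ.im) :
    ∫ x in (0 : ℝ)..1, jacobiTheta₂ x τ = 1 := by
  have hsum : Summable fun n : ℤ => ‖ContinuousMap.restrict
      (⟨uIcc (0 : ℝ) 1, isCompact_uIcc⟩ : TopologicalSpace.Compacts ℝ)
      (⟨fun x : ℝ => jacobiTheta₂_term n x τ, by unfold jacobiTheta₂_term; fun_prop⟩ :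
        C(ℝ, ℂ))‖ := by
    refine Summable.of_nonneg_of_le (fun _ => norm_nonneg _) (fun n => ?_)
      ((summable_jacobiTheta₂_term_iff 0 τ).2 hτ).norm
    rw [ContinuousMap.norm_le _ (norm_nonneg _)]
    intro x
    simp [norm_jacobiTheta₂_term]
  have h := intervalIntegral.hasSum_intervalIntegral_of_summable_norm hsum
  have h0 : ∀ n : ℤ, n ≠ 0 → ∫ x in (0 : ℝ)..1, jacobiTheta₂_term n x τ = 0 := by
    intro n hn
    have hc : (2 * Real.pi * I * n : ℂ) ≠ 0 :=
      mul_ne_zero two_pi_I_ne_zero (Int.cast_ne_zero.2 hn)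
    simp only [jacobiTheta₂_term, exp_add]
    rw [intervalIntegral.integral_mul_const, integral_exp_mul_complex hc]
    simp [mul_comm (2 * Real.pi * I) (n : ℂ), exp_int_mul_two_pi_mul_I]
  have h1 : HasSum (fun n : ℤ => ∫ x in (0 : ℝ)..1, jacobiTheta₂_term n x τ) 1 := by
    convert! hasSum_single (0 : ℤ) h0 using 1
    simp [jacobiTheta₂_term]
  exact h.unique h1

theorem theta₁_ne_zero_fun {τ : ℂ} (hτ : 0 < τ.im) : ∃ z, theta₁ τ z ≠ 0 := by
  by_contra! h
  have h2 : ∀ z, jacobiTheta₂ z τ = 0 := fun z => by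
    have := h (z - τ / 2 - 1 / 2)
    rw [theta₁_eq_jacobiTheta₂, show z - τ / 2 - 1 / 2 + τ / 2 + 1 / 2 = z by ring] at this
    simpa using this
  simpa [h2] using integral_jacobiTheta₂ hτ

theorem theta₁_eq_zero_iff {τ z : ℂ} (hτ : 0 < τ.im) : theta₁ τ z = 0 ↔ z ∈ lattice τ := by
  obtain ⟨c, hc⟩ := exists_theta₁_eq_mul_thetaProd hτ
  obtain ⟨w, hw⟩ := theta₁_ne_zero_fun hτ
  have hc0 : c ≠ 0 := by rintro rfl; simp [hc] at hw
  rw [hc, mul_eq_zero, or_iff_right hc0, thetaProd_eq_zero_iff hτ]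

theorem deriv_theta₁_zero_ne_zero {τ : ℂ} (hτ : 0 < τ.im) : deriv (theta₁ τ) 0 ≠ 0 := by
  obtain ⟨c, hc⟩ := exists_theta₁_eq_mul_thetaProd hτ
  obtain ⟨w, hw⟩ := theta₁_ne_zero_fun hτ
  have hc0 : c ≠ 0 := by rintro rfl; simp [hc] at hw
  rw [funext hc, deriv_const_mul _ (differentiable_thetaProd hτ 0)]
  exact mul_ne_zero hc0 (deriv_thetaProd_ne_zero hτ)

/-! ### The gradient of the Green's function -/

theorem isOpen_compl_lattice {τ : ℂ} (hτ : 0 < τ.im) : IsOpen (lattice τ : Set ℂ)ᶜ := by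
  have : (lattice τ : Set ℂ)ᶜ = {z | theta₁ τ z ≠ 0} := by
    ext z
    simp [theta₁_eq_zero_iff hτ]
  rw [this]
  exact isOpen_ne_fun (differentiable_theta₁ hτ).continuous continuous_const

theorem green_add_lattice {τ : ℂ} (hτ : 0 < τ.im) {z l : ℂ} (hz : z ∉ lattice τ)
    (hl : l ∈ lattice τ) : green τ (z + l) = green τ z := by
  classical
  have key : ∀ w ∈ ({1, τ} : Set ℂ), ∀ z, z ∉ lattice τ → green τ (z + w) = green τ z := by
    intro w hw z hz
    have hz' : ‖theta₁ τ z‖ ≠ 0 := by simpa [theta₁_eq_zero_iff hτ] using hz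
    rcases hw with rfl | rfl
    · simp [green, theta₁_add_one]
    · rw [green, theta₁_add_tau, norm_mul, norm_neg, Complex.norm_exp, Real.log_mul
        (Real.exp_ne_zero _) hz', Real.log_exp, green]
      have : (-(Real.pi * Complex.I * (w + 2 * z))).re = Real.pi * (w.im + 2 * z.im) := by
        simp
      rw [this, Complex.add_im]
      field_simp
      ring
  -- On the lattice `Real.log 0 = 0` leaves the quadratic term alone, which is not periodic.
  -- Replacing these values by 0 makes the function periodic everywhere, as `map_add_lattice`
  -- requires.
  have h := map_add_lattice (τ := τ) (f := fun z => if z ∈ lattice τ then 0 else green τ z)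
    (fun z => ?_) (fun z => ?_) hl z
  · simpa [hz, add_mem_cancel_right hl] using h
  · by_cases h : z ∈ lattice τ
    · simp [h, add_mem_cancel_right (one_mem_lattice τ)]
    · simp [h, add_mem_cancel_right (one_mem_lattice τ), key 1 (by simp) z h]
  · by_cases h : z ∈ lattice τ
    · simp [h, add_mem_cancel_right (tau_mem_lattice τ)]
    · simp [h, add_mem_cancel_right (tau_mem_lattice τ), key τ (by simp) z h]

/-- The complex number `g` with `dG(v) = Re (g v)`. -/
def greenGrad (τ w : ℂ) : ℂ :=
  -(1 / (2 * Real.pi)) * logDeriv (theta₁ τ) w - Complex.I * (w.im / τ.im : ℝ)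

/-- The real linear form `v ↦ Re (a v)`. -/
def reMul (a : ℂ) : ℂ →L[ℝ] ℝ :=
  Complex.reCLM.comp ((ContinuousLinearMap.mul ℂ ℂ a).restrictScalars ℝ)

@[simp] theorem reMul_apply (a v : ℂ) : reMul a v = (a * v).re := rfl

theorem _root_.HasDerivAt.hasFDerivAt_re {f : ℂ → ℂ} {f' z : ℂ} (h : HasDerivAt f f' z) :
    HasFDerivAt (fun z => (f z).re) (reMul f') z := by
  have := Complex.reCLM.hasFDerivAt.comp z (h.hasFDerivAt.restrictScalars ℝ)
  convert! this using 1
  ext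
  simp [mul_comm]

theorem hasFDerivAt_log_norm {f : ℂ → ℂ} {f' z : ℂ} (h : HasDerivAt f f' z) (hz : f z ≠ 0) :
    HasFDerivAt (fun z => Real.log ‖f z‖) (reMul (f' / f z)) z := by
  -- Division by `f z` moves the argument to 1, where the principal branch is holomorphic.
  have h1 : HasDerivAt (fun w => Complex.log (f w / f z)) (f' / f z) z := by
    have := (h.div_const (f z)).clog (by simp [hz])
    simpa [hz] using! this
  have h2 := h1.hasFDerivAt_re.add_const (Real.log ‖f z‖)
  refine h2.congr_of_eventuallyEq ?_
  filter_upwards [h.continuousAt.eventually_ne hz] with w hw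
  rw [Complex.log_re, norm_div, Real.log_div (by simpa using hw) (by simpa using hz)]
  ring

theorem hasFDerivAt_green {τ w : ℂ} (hτ : 0 < τ.im) (hw : w ∉ lattice τ) :
    HasFDerivAt (green τ) (reMul (greenGrad τ w)) w := by
  have h1 := (hasFDerivAt_log_norm (differentiable_theta₁ hτ w).hasDerivAt
    (mt (theta₁_eq_zero_iff hτ).1 hw)).const_mul (-(1 / (2 * Real.pi)))
  have h2 := ((Complex.imCLM.hasFDerivAt (x := w)).pow 2).const_mul (1 / (2 * τ.im))
  convert! h1.add h2 using 1
  ext v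
  simp [greenGrad, logDeriv]
  field_simp
  ring

theorem rightNormal_mul_norm {γ : ℝ → ℂ} {t : ℝ} (h : deriv γ t ≠ 0) :
    rightNormal γ t * ‖deriv γ t‖ = -Complex.I * deriv γ t := by
  have : (‖deriv γ t‖ : ℂ) ≠ 0 := by simpa using h
  rw [rightNormal]
  field_simp

/-- The speed cancels the normalisation of the normal, as ν|γ'| = -iγ'. This removes absolute values
and makes the kernel accessible to complex integration. -/
theorem HoledTorus.kernel_mul_norm_deriv {τ : ℂ} {M : ℕ} (X : HoledTorus τ M) (hτ : 0 < τ.im)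
    {z : ℂ} {j : Fin M} {t : ℝ} (h : z - (X.hole j).curve t ∉ lattice τ) :
    X.kernel z j t * ‖deriv (X.hole j).curve t‖ =
      -(greenGrad τ (z - (X.hole j).curve t) * deriv (X.hole j).curve t).im := by
  have h1 : HasFDerivAt (fun ξ => green τ (z - ξ))
      (-(reMul (greenGrad τ (z - (X.hole j).curve t)))) ((X.hole j).curve t) := by
    have := (hasFDerivAt_green hτ h).comp ((X.hole j).curve t)
      ((hasFDerivAt_id (𝕜 := ℝ) ((X.hole j).curve t)).const_sub z)
    convert! this using 1
    ext
    simp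
  have h2 := rightNormal_mul_norm ((X.hole j).deriv_curve_ne_zero t)
  rw [kernel, h1.fderiv, neg_apply, reMul_apply, C2Hole.normal, neg_mul,
    ← Complex.re_mul_ofReal, mul_assoc, h2]
  congr 1
  rw [show ∀ a b : ℂ, a * (-Complex.I * b) = -(Complex.I * (a * b)) by intros; ring]
  rw [Complex.neg_re, Complex.I_mul_re, neg_neg]

/-! ### The regular part of the theta function at the origin -/

/-- The entire function `ϑ₁(z) / z`. -/
def thetaQuot (τ : ℂ) : ℂ → ℂ := dslope (theta₁ τ) 0

theorem differentiable_thetaQuot {τ : ℂ} (hτ : 0 < τ.im) : Differentiable ℂ (thetaQuot τ) := by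
  rw [← differentiableOn_univ]
  exact (Complex.differentiableOn_dslope univ_mem).2 (differentiable_theta₁ hτ).differentiableOn

theorem theta₁_eq_mul_thetaQuot (τ z : ℂ) : theta₁ τ z = z * thetaQuot τ z := by
  have := sub_smul_dslope (theta₁ τ) 0 z
  rw [theta₁_zero, sub_zero, sub_zero, smul_eq_mul] at this
  exact this.symm

theorem thetaQuot_ne_zero {τ z : ℂ} (hτ : 0 < τ.im) (hz : z ∈ lattice τ → z = 0) :
    thetaQuot τ z ≠ 0 := by
  by_cases h : z = 0
  · rw [h, thetaQuot, dslope_same]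
    exact deriv_theta₁_zero_ne_zero hτ
  · intro h0
    refine h (hz ((theta₁_eq_zero_iff hτ).1 ?_))
    rw [theta₁_eq_mul_thetaQuot, h0, mul_zero]

theorem logDeriv_theta₁ {τ z : ℂ} (hτ : 0 < τ.im) (hz : z ∉ lattice τ) :
    logDeriv (theta₁ τ) z = 1 / z + logDeriv (thetaQuot τ) z := by
  have h0 : z ≠ 0 := by rintro rfl; exact hz (zero_mem _)
  rw [funext (theta₁_eq_mul_thetaQuot τ), logDeriv_mul (f := fun z => z) z h0
    (thetaQuot_ne_zero hτ fun h => absurd h hz) differentiableAt_fun_id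
    (differentiable_thetaQuot hτ z)]
  simp [logDeriv]

theorem continuousAt_logDeriv {f : ℂ → ℂ} (hf : Differentiable ℂ f) {z : ℂ} (hz : f z ≠ 0) :
    ContinuousAt (logDeriv f) z :=
  ((hf.contDiff (n := 2)).continuous_deriv (by norm_num)).continuousAt.div
    hf.continuous.continuousAt hz

theorem continuousAt_greenGrad {τ z : ℂ} (hτ : 0 < τ.im) (hz : z ∉ lattice τ) :
    ContinuousAt (greenGrad τ) z := by
  have := continuousAt_logDeriv (differentiable_theta₁ hτ) (mt (theta₁_eq_zero_iff hτ).1 hz)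
  unfold greenGrad
  fun_prop

/-! ### Closed curves of class `C²` -/

theorem _root_.Function.Periodic.add_intCast {α : Type*} {f : ℝ → α} (h : Function.Periodic f 1)
    (t : ℝ) (n : ℤ) : f (t + n) = f t := by
  simpa using h.int_mul n t

namespace C2Hole

variable (D : C2Hole)

theorem continuous_curve : Continuous D.curve := D.contDiff_curve.continuous

theorem differentiable_curve : Differentiable ℝ D.curve :=
  D.contDiff_curve.differentiable (by norm_num)

theorem contDiff_deriv_curve : ContDiff ℝ 1 (deriv D.curve) :=
  (contDiff_succ_iff_deriv (n := 1)).1 (by simpa using! D.contDiff_curve) |>.2.2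

theorem continuous_deriv_curve : Continuous (deriv D.curve) := D.contDiff_deriv_curve.continuous

theorem hasDerivAt_curve (t : ℝ) : HasDerivAt D.curve (deriv D.curve t) t :=
  (D.differentiable_curve t).hasDerivAt

theorem periodic_deriv_curve : Function.Periodic (deriv D.curve) 1 := fun t => by
  rw [← deriv_comp_add_const]
  congr 1
  funext s
  exact D.periodic_curve s

theorem periodic_normal : Function.Periodic D.normal 1 := fun t => by
  simp only [normal, rightNormal, D.periodic_deriv_curve t]

theorem norm_normal (t : ℝ) : ‖D.normal t‖ = 1 := by
  simp [normal, rightNormal, D.deriv_curve_ne_zero t]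

theorem norm_deriv_curve_pos (t : ℝ) : 0 < ‖deriv D.curve t‖ :=
  norm_pos_iff.2 (D.deriv_curve_ne_zero t)

theorem deriv_curve_eq (t : ℝ) :
    deriv D.curve t = Complex.I * ‖deriv D.curve t‖ * D.normal t := by
  have h : (‖deriv D.curve t‖ : ℂ) ≠ 0 := by simpa using D.deriv_curve_ne_zero t
  rw [normal, rightNormal]
  field_simp
  linear_combination (deriv D.curve t) * Complex.I_sq

theorem curve_eq_curve_iff {s t : ℝ} : D.curve s = D.curve t ↔ ∃ n : ℤ, s = t + n := by
  constructor
  · intro h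
    have hf : ∀ s, D.curve (Int.fract s) = D.curve s := fun s => by
      rw [← D.periodic_curve.add_intCast (Int.fract s) ⌊s⌋, Int.fract_add_floor]
    have := D.injOn_curve ⟨Int.fract_nonneg s, Int.fract_lt_one s⟩
      ⟨Int.fract_nonneg t, Int.fract_lt_one t⟩ (by rw [hf, hf, h])
    refine ⟨⌊s⌋ - ⌊t⌋, ?_⟩
    simp only [Int.fract] at this
    push_cast
    linarith
  · rintro ⟨n, rfl⟩
    exact D.periodic_curve.add_intCast t n

theorem eq_of_curve_eq {s t : ℝ} (h : D.curve s = D.curve t) (hst : |s - t| < 1) : s = t := by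
  obtain ⟨n, hn⟩ := D.curve_eq_curve_iff.1 h
  have : |(n : ℝ)| < 1 := by rwa [hn, add_sub_cancel_left] at hst
  have h0 : n = 0 := by
    rw [← Int.cast_abs] at this
    exact Int.abs_lt_one_iff.1 (by exact_mod_cast this)
  rw [hn, h0, Int.cast_zero, add_zero]

theorem exists_shift (s : ℝ) : ∃ n : ℤ, s + n ∈ Icc (0 : ℝ) 1 :=
  ⟨-⌊s⌋, by
    have h1 := Int.fract_nonneg s
    have h2 := (Int.fract_lt_one s).le
    simp only [Int.fract] at h1 h2
    push_cast
    constructor <;> linarith⟩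

theorem _root_.Function.Periodic.exists_norm_le {f : ℝ → ℂ} (hp : Function.Periodic f 1)
    (hf : Continuous f) : ∃ C, 0 < C ∧ ∀ t, ‖f t‖ ≤ C := by
  obtain ⟨C, hC⟩ := (isCompact_Icc (a := (0 : ℝ)) (b := 1)).exists_bound_of_continuousOn
    hf.continuousOn
  refine ⟨max C 1, by positivity, fun t => ?_⟩
  obtain ⟨n, hn⟩ := exists_shift t
  rw [← hp.add_intCast t n]
  exact (hC _ hn).trans (le_max_left _ _)

theorem exists_norm_deriv_le : ∃ C, 0 < C ∧ ∀ t, ‖deriv D.curve t‖ ≤ C :=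
  D.periodic_deriv_curve.exists_norm_le D.continuous_deriv_curve

theorem exists_le_norm_deriv : ∃ m, 0 < m ∧ ∀ t, m ≤ ‖deriv D.curve t‖ := by
  obtain ⟨m, hm, h⟩ := (isCompact_Icc (a := (0 : ℝ)) (b := 1)).exists_forall_le'
    (f := fun t => ‖deriv D.curve t‖) D.continuous_deriv_curve.norm.continuousOn
    fun t _ => D.norm_deriv_curve_pos t
  refine ⟨m, hm, fun t => ?_⟩
  obtain ⟨n, hn⟩ := exists_shift t
  rw [← D.periodic_deriv_curve.add_intCast t n]
  exact h _ hn

theorem exists_lipschitz_deriv :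
    ∃ C, 0 < C ∧ ∀ s t, ‖deriv D.curve t - deriv D.curve s‖ ≤ C * |t - s| := by
  have hd : Differentiable ℝ (deriv D.curve) := D.contDiff_deriv_curve.differentiable (by norm_num)
  have hp : Function.Periodic (deriv (deriv D.curve)) 1 := fun t => by
    rw [← deriv_comp_add_const]
    congr 1
    funext s
    exact D.periodic_deriv_curve s
  obtain ⟨C, hC, h⟩ := hp.exists_norm_le (D.contDiff_deriv_curve.continuous_deriv le_rfl)
  refine ⟨C, hC, fun s t => ?_⟩
  have := convex_univ.norm_image_sub_le_of_norm_deriv_le (f := deriv D.curve) (x := s) (y := t)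
    (fun x _ => hd x) (fun x _ => h x) (mem_univ _) (mem_univ _)
  simpa using this

theorem exists_taylor :
    ∃ C, 0 < C ∧ ∀ s t,
      ‖D.curve t - D.curve s - (t - s : ℝ) * deriv D.curve s‖ ≤ C * |t - s| ^ 2 := by
  obtain ⟨C, hC, h⟩ := D.exists_lipschitz_deriv
  refine ⟨C, hC, fun s t => ?_⟩
  have hd : ∀ x, HasDerivAt (fun x : ℝ => D.curve x - (x : ℂ) * deriv D.curve s)
      (deriv D.curve x - deriv D.curve s) x := fun x => by
    simpa using! (D.hasDerivAt_curve x).sub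
      ((Complex.ofRealCLM.hasDerivAt (x := x)).mul_const (deriv D.curve s))
  have := (convex_uIcc s t).norm_image_sub_le_of_norm_hasDerivWithin_le
    (f := fun x : ℝ => D.curve x - (x : ℂ) * deriv D.curve s)
    (f' := fun x => deriv D.curve x - deriv D.curve s) (C := C * |t - s|)
    (fun x _ => (hd x).hasDerivWithinAt)
    (fun x hx => (h s x).trans (mul_le_mul_of_nonneg_left (abs_sub_left_of_mem_uIcc hx) hC.le))
    left_mem_uIcc right_mem_uIcc
  rw [Real.norm_eq_abs] at this
  convert! this using 1
  · congr 1
    push_cast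
    ring
  · ring

/-- The tangent is i|γ'|ν, so the two terms are orthogonal and the norm dominates each of them,
hence their mean. This is the straight-line model for `exists_le_norm_sub`. -/
theorem le_norm_mul_deriv_sub (s x h : ℝ) :
    (‖deriv D.curve s‖ * |x| + |h|) / 2 ≤ ‖(x : ℂ) * deriv D.curve s - h * D.normal s‖ := by
  have e : (x : ℂ) * deriv D.curve s - h * D.normal s =
      ((-h : ℝ) + (x * ‖deriv D.curve s‖ : ℝ) * Complex.I) * D.normal s := by
    conv_lhs => rw [D.deriv_curve_eq s]
    push_cast
    ring
  rw [e, norm_mul, D.norm_normal, mul_one]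
  set w : ℂ := (-h : ℝ) + (x * ‖deriv D.curve s‖ : ℝ) * Complex.I
  have hre := Complex.abs_re_le_norm w
  have him := Complex.abs_im_le_norm w
  have e1 : w.re = -h := by simp [w]
  have e2 : w.im = x * ‖deriv D.curve s‖ := by simp [w]
  rw [e1, abs_neg] at hre
  rw [e2, abs_mul, abs_norm] at him
  linarith

/-- The points `γ(s) + h ν(s)` keep away from the curve. -/
theorem exists_le_norm_sub :
    ∃ c h₀ : ℝ, 0 < c ∧ 0 < h₀ ∧ ∀ s t h, |t - s| ≤ 3 / 4 → |h| ≤ h₀ →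
      c * (|t - s| + |h|) ≤ ‖D.curve t - (D.curve s + h * D.normal s)‖ := by
  obtain ⟨C, hC, hT⟩ := D.exists_taylor
  obtain ⟨m, hm, hmd⟩ := D.exists_le_norm_deriv
  -- For |t - s| < δ the Taylor remainder C|t - s|² is at most (m/4)|t - s|, half of the tangential
  -- part of the lower bound for the tangent line.
  set δ := m / (4 * C) with hδ
  have hδ0 : 0 < δ := by positivity
  -- Parameters whose distance lies between δ and 3/4 differ modulo the period, so injectivity and
  -- compactness give a uniform gap. The bound 3/4, rather than half a period, lets the base point
  -- move by 1/4 later.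
  have hK : IsCompact {p : ℝ × ℝ | p.1 ∈ Icc (0 : ℝ) 1 ∧ δ ≤ |p.2| ∧ p.2 ∈ Icc (-(3 / 4) : ℝ) (3 / 4)} := by
    refine (isCompact_Icc.prod (isCompact_Icc (a := (-(3 / 4) : ℝ)) (b := 3 / 4))).of_isClosed_subset
      ?_ (fun p hp => ⟨hp.1, hp.2.2⟩)
    refine (isClosed_Icc.preimage continuous_fst).inter
      ((isClosed_le continuous_const continuous_snd.abs).inter
        (isClosed_Icc.preimage continuous_snd))
  obtain ⟨m₂, hm₂, hfar⟩ := hK.exists_forall_le' (a := 0)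
    (f := fun p => ‖D.curve (p.1 + p.2) - D.curve p.1‖)
    (by
      have := D.continuous_curve
      fun_prop)
    (fun p hp => by
      rw [norm_pos_iff, sub_ne_zero]
      intro h
      have h1 : |p.1 + p.2 - p.1| < 1 := by
        rw [add_sub_cancel_left]
        exact (abs_le.2 hp.2.2).trans_lt (by norm_num)
      have := D.eq_of_curve_eq h h1
      have h2 : p.2 = 0 := by linarith
      have := hp.2.1
      rw [h2, abs_zero] at this
      linarith)
  have hfar' : ∀ s t, δ ≤ |t - s| → |t - s| ≤ 3 / 4 → m₂ ≤ ‖D.curve t - D.curve s‖ := by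
    intro s t h1 h2
    obtain ⟨n, hn⟩ := exists_shift s
    have := hfar (s + n, t - s) ⟨hn, h1, abs_le.1 h2⟩
    have e1 : s + n + (t - s) = t + n := by ring
    simp only [e1] at this
    rwa [D.periodic_curve.add_intCast t n, D.periodic_curve.add_intCast s n] at this
  -- The last quotient serves the far range: |t - s| + |h| is at most 3/4 + m₂/2, while the distance
  -- is at least m₂ - |h| ≥ m₂/2.
  refine ⟨min (min (m / 4) (1 / 2)) (m₂ / 2 / (3 / 4 + m₂ / 2)), m₂ / 2, by positivity,
    by positivity, fun s t h hst hh => ?_⟩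
  rcases le_or_gt δ |t - s| with hcase | hcase
  · have h1 : ‖D.curve t - D.curve s‖ - |h| ≤ ‖D.curve t - (D.curve s + h * D.normal s)‖ := by
      have := norm_sub_norm_le (D.curve t - D.curve s) (h * D.normal s)
      rw [norm_mul, D.norm_normal, mul_one, Complex.norm_real, Real.norm_eq_abs] at this
      rwa [← sub_sub]
    have h2 := hfar' s t hcase hst
    calc _ ≤ m₂ / 2 / (3 / 4 + m₂ / 2) * (3 / 4 + m₂ / 2) :=
          mul_le_mul (min_le_right _ _) (add_le_add hst hh) (by positivity) (by positivity)
      _ = m₂ / 2 := by field_simp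
      _ ≤ _ := by linarith
  · have h1 : C * |t - s| ^ 2 ≤ m / 4 * |t - s| := by
      have : C * |t - s| ≤ m / 4 := by
        rw [hδ, lt_div_iff₀ (by positivity)] at hcase
        linarith
      nlinarith [abs_nonneg (t - s)]
    have h2 : (m * |t - s| + |h|) / 2 ≤ ‖(t - s : ℝ) * deriv D.curve s - h * D.normal s‖ := by
      have := mul_le_mul_of_nonneg_right (hmd s) (abs_nonneg (t - s))
      have := D.le_norm_mul_deriv_sub s (t - s) h
      linarith
    have h3 := norm_sub_norm_le ((t - s : ℝ) * deriv D.curve s - h * D.normal s)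
      (-(D.curve t - D.curve s - (t - s : ℝ) * deriv D.curve s))
    rw [norm_neg] at h3
    have e3 : (t - s : ℝ) * deriv D.curve s - h * D.normal s -
        -(D.curve t - D.curve s - (t - s : ℝ) * deriv D.curve s) =
        D.curve t - (D.curve s + h * D.normal s) := by ring
    rw [e3] at h3
    have h4 := hT s t
    calc _ ≤ min (m / 4) (1 / 2) * (|t - s| + |h|) :=
          mul_le_mul_of_nonneg_right (min_le_left _ _) (by positivity)
      _ = min (m / 4) (1 / 2) * |t - s| + min (m / 4) (1 / 2) * |h| := by ring
      _ ≤ m / 4 * |t - s| + 1 / 2 * |h| := add_le_add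
          (mul_le_mul_of_nonneg_right (min_le_left _ _) (abs_nonneg _))
          (mul_le_mul_of_nonneg_right (min_le_right _ _) (abs_nonneg _))
      _ ≤ _ := by linarith

end C2Hole

/-! ### The two sides of the boundary curve -/

namespace C2Hole

variable (D : C2Hole)

/-- Every point of the plane lies on the normal line through a nearest point of the curve. -/
theorem exists_eq_curve_add_normal (z : ℂ) :
    ∃ s h : ℝ, z = D.curve s + h * D.normal s ∧ ∀ t, |h| ≤ ‖z - D.curve t‖ := by
  obtain ⟨s, -, hs⟩ := (isCompact_Icc (a := (0 : ℝ)) (b := 1)).exists_isMinOn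
    ⟨0, by simp⟩ (f := fun t => ‖z - D.curve t‖ ^ 2)
    (by have := D.continuous_curve; fun_prop)
  have hmin : ∀ t, ‖z - D.curve s‖ ^ 2 ≤ ‖z - D.curve t‖ ^ 2 := fun t => by
    obtain ⟨n, hn⟩ := exists_shift t
    rw [← D.periodic_curve.add_intCast t n]
    exact hs hn
  have hd : HasDerivAt (fun t => ‖z - D.curve t‖ ^ 2)
      (2 * inner ℝ (z - D.curve s) (-deriv D.curve s)) s :=
    ((D.hasDerivAt_curve s).const_sub z).norm_sq
  -- At a nearest point the displacement is orthogonal to the tangent, hence a real multiple of the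
  -- normal.
  have h0 := IsLocalMin.hasDerivAt_eq_zero (Filter.Eventually.of_forall hmin) hd
  set w := z - D.curve s with hw
  set a := deriv D.curve s with ha
  have hre : w.re * a.re + w.im * a.im = 0 := by
    simp [Complex.inner] at h0
    linarith
  have hn : D.normal s * (‖a‖ : ℂ) = -Complex.I * a := rightNormal_mul_norm (D.deriv_curve_ne_zero s)
  have hne : (‖a‖ : ℂ) ≠ 0 := by simpa [ha] using D.deriv_curve_ne_zero s
  have hpos : 0 < ‖a‖ := D.norm_deriv_curve_pos s
  have hsq : a.re * a.re + a.im * a.im = ‖a‖ * ‖a‖ := by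
    rw [Complex.norm_mul_self_eq_normSq, Complex.normSq_apply]
  set h := (w.re * a.im - w.im * a.re) / ‖a‖ with hh
  have hwh : w = h * D.normal s := by
    apply mul_right_cancel₀ hne
    rw [mul_assoc, hn, hh]
    apply mul_right_cancel₀ hne
    push_cast
    field_simp
    apply Complex.ext
    · simp [pow_two, ← hsq]
      linear_combination a.re * hre
    · simp [pow_two, ← hsq]
      linear_combination a.im * hre
  refine ⟨s, h, by rw [← hwh, hw]; ring, fun t => ?_⟩
  have : |h| = ‖w‖ := by rw [hwh, norm_mul, D.norm_normal]; simp
  rw [this]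
  exact (pow_le_pow_iff_left₀ (norm_nonneg _) (norm_nonneg _) two_ne_zero).1 (hmin t)

theorem isCompact_closure : IsCompact (closure D.carrier) :=
  D.isBounded_carrier.isCompact_closure

theorem curve_mem_frontier (t : ℝ) : D.curve t ∈ frontier D.carrier :=
  D.range_curve ▸ mem_range_self t

theorem curve_mem_closure (t : ℝ) : D.curve t ∈ closure D.carrier :=
  frontier_subset_closure (D.curve_mem_frontier t)

theorem curve_notMem_carrier (t : ℝ) : D.curve t ∉ D.carrier := by
  have := D.curve_mem_frontier t
  rw [D.isOpen_carrier.frontier_eq] at this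
  exact this.2

theorem continuous_normal : Continuous D.normal := by
  have h := D.continuous_deriv_curve
  have h2 : ∀ t, (‖deriv D.curve t‖ : ℂ) ≠ 0 := by simpa using D.deriv_curve_ne_zero
  unfold normal rightNormal
  fun_prop (disch := assumption)

theorem subset_or_subset_of_forall_notMem_curve {S : Set ℂ} (hS : IsPreconnected S)
    (h : ∀ z ∈ S, ∀ t, z ≠ D.curve t) : S ⊆ D.carrier ∨ S ⊆ (closure D.carrier)ᶜ := by
  refine hS.subset_or_subset D.isOpen_carrier isClosed_closure.isOpen_compl
    (disjoint_compl_right_iff_subset.2 subset_closure) fun z hz => ?_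
  by_contra hz'
  rw [mem_union, not_or, mem_compl_iff, not_not] at hz'
  have : z ∈ frontier D.carrier := by
    rw [D.isOpen_carrier.frontier_eq]
    exact ⟨hz'.2, hz'.1⟩
  rw [← D.range_curve] at this
  obtain ⟨t, ht⟩ := this
  exact h z hz t ht.symm

theorem curve_add_ne_curve {h₀ c : ℝ} (hc : 0 < c)
    (hlow : ∀ s t h, |t - s| ≤ 3 / 4 → |h| ≤ h₀ →
      c * (|t - s| + |h|) ≤ ‖D.curve t - (D.curve s + h * D.normal s)‖) {h : ℝ} (hh : |h| ≤ h₀)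
    (hne : h ≠ 0) (s t : ℝ) : D.curve s + h * D.normal s ≠ D.curve t := by
  intro he
  -- An integer shift brings `t` within half a period of `s`, where the lower bound applies.
  have h1 : |(t - round (t - s) : ℝ) - s| ≤ 3 / 4 := by
    have := abs_sub_round (t - s)
    rw [show t - round (t - s) - s = t - s - round (t - s) by ring]
    linarith
  have h2 := hlow s _ h h1 hh
  have h3 := D.periodic_curve.add_intCast t (-round (t - s))
  rw [Int.cast_neg, ← sub_eq_add_neg] at h3
  rw [h3, he, sub_self, norm_zero] at h2
  have : 0 < |h| := abs_pos.2 hne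
  have : 0 < c * (|t - round (t - s) - s| + |h|) := by positivity
  linarith

/-- Each one-sided strip is connected and misses the curve, so it lies in the hole or in its
exterior. The inner strip contains points of the hole by `normal_inward`. If the outer strip were in
the hole as well, then the closure of the hole would contain a neighbourhood of each boundary point;
it would be open and closed, hence the whole plane, against boundedness. -/
theorem exists_collar : ∃ h₀ : ℝ, 0 < h₀ ∧ ∀ s h, 0 < h → h ≤ h₀ →
    D.curve s + h * D.normal s ∈ D.carrier ∧ D.curve s - h * D.normal s ∉ closure D.carrier := by
  obtain ⟨c, h₀, hc, hh₀, hlow⟩ := D.exists_le_norm_sub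
  have hcont : Continuous fun p : ℝ × ℝ => D.curve p.1 + p.2 * D.normal p.1 := by
    have := D.continuous_curve
    have := D.continuous_normal
    fun_prop
  have hconn : ∀ I : Set ℝ, IsPreconnected I →
      IsPreconnected ((fun p : ℝ × ℝ => D.curve p.1 + p.2 * D.normal p.1) '' (univ ×ˢ I)) :=
    fun I hI => (isPreconnected_univ.prod hI).image _ hcont.continuousOn
  have hin : (fun p : ℝ × ℝ => D.curve p.1 + p.2 * D.normal p.1) '' (univ ×ˢ Ioc 0 h₀) ⊆
      D.carrier := by
    refine (D.subset_or_subset_of_forall_notMem_curve (hconn _ isPreconnected_Ioc) ?_).resolve_right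
      fun hsub => ?_
    · rintro _ ⟨⟨s, h⟩, ⟨-, h1, h2⟩, rfl⟩ t
      exact D.curve_add_ne_curve hc hlow (abs_le.2 ⟨by linarith, h2⟩) h1.ne' s t
    · obtain ⟨h, h1, h2⟩ := ((D.normal_inward 0).and (Ioc_mem_nhdsGT hh₀)).exists
      exact hsub ⟨(0, h), ⟨mem_univ _, h2⟩, rfl⟩ (subset_closure h1)
  have hout : (fun p : ℝ × ℝ => D.curve p.1 + p.2 * D.normal p.1) '' (univ ×ˢ Ico (-h₀) 0) ⊆
      (closure D.carrier)ᶜ := by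
    refine (D.subset_or_subset_of_forall_notMem_curve (hconn _ isPreconnected_Ico) ?_).resolve_left
      fun hsub => ?_
    · rintro _ ⟨⟨s, h⟩, ⟨-, h1, h2⟩, rfl⟩ t
      exact D.curve_add_ne_curve hc hlow (abs_le.2 ⟨h1, by simp at h2; linarith⟩) h2.ne s t
    · have hopen : IsOpen (closure D.carrier) := by
        rw [Metric.isOpen_iff]
        intro z hz
        by_cases hzD : z ∈ D.carrier
        · obtain ⟨ε, hε, h⟩ := Metric.isOpen_iff.1 D.isOpen_carrier z hzD
          exact ⟨ε, hε, h.trans subset_closure⟩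
        have : z ∈ frontier D.carrier := by
          rw [D.isOpen_carrier.frontier_eq]
          exact ⟨hz, hzD⟩
        rw [← D.range_curve] at this
        obtain ⟨t, rfl⟩ := this
        refine ⟨h₀, hh₀, fun w hw => ?_⟩
        obtain ⟨s, h, rfl, hle⟩ := D.exists_eq_curve_add_normal w
        have hlt : |h| < h₀ := (hle t).trans_lt (by simpa [dist_eq_norm] using hw)
        rw [abs_lt] at hlt
        rcases lt_trichotomy h 0 with h1 | rfl | h1
        · exact subset_closure (hsub ⟨(s, h), ⟨mem_univ _, hlt.1.le, h1⟩, rfl⟩)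
        · simpa using D.curve_mem_closure s
        · exact subset_closure (hin ⟨(s, h), ⟨mem_univ _, h1, hlt.2.le⟩, rfl⟩)
      have huniv : closure D.carrier = univ :=
        IsClopen.eq_univ ⟨isClosed_closure, hopen⟩ ⟨_, D.curve_mem_closure 0⟩
      have := D.isCompact_closure
      rw [huniv] at this
      exact noncompact_univ ℂ this
  refine ⟨h₀, hh₀, fun s h h1 h2 => ⟨hin ⟨(s, h), ⟨mem_univ _, h1, h2⟩, rfl⟩, ?_⟩⟩
  have := hout ⟨(s, -h), ⟨mem_univ _, by linarith, by linarith⟩, rfl⟩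
  simpa [← sub_eq_add_neg] using this

end C2Hole

/-! ### The covering of the domain -/

namespace HoledTorus

open scoped Pointwise

variable {τ : ℂ} {M : ℕ} (X : HoledTorus τ M)

theorem proj_eq_proj_iff {z w : ℂ} : proj τ z = proj τ w ↔ w - z ∈ lattice τ := by
  rw [proj, proj, QuotientAddGroup.eq, neg_add_eq_sub]

theorem mem_cover_iff {z : ℂ} :
    z ∈ X.cover ↔ ∀ j, ∀ l ∈ lattice τ, z + l ∉ closure (X.hole j).carrier := by
  simp only [cover, domain, mem_preimage, mem_compl_iff, mem_iUnion, mem_image, not_exists, not_and]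
  refine forall_congr' fun j => ⟨fun h l hl hz => h _ hz ?_, fun h w hw he => ?_⟩
  · rw [proj_eq_proj_iff, show z - (z + l) = -l by ring, neg_mem_iff]
    exact hl
  · refine h (w - z) ?_ (by simpa using hw)
    rw [← neg_mem_iff, neg_sub]
    exact proj_eq_proj_iff.1 he

/-- An open neighbourhood of the closure of the hole `j`, which is disjoint from the other holes
and from the translates of this one. -/
def holeNhd (j : Fin M) : Set ℂ :=
  {z | ∀ i, ∀ l ∈ lattice τ, z + l ∈ closure (X.hole i).carrier → i = j ∧ l = 0}

theorem isClosed_lattice (hτ : 0 < τ.im) : IsClosed (lattice τ : Set ℂ) :=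
  isOpen_compl_iff.1 (isOpen_compl_lattice hτ)

/-- The nonzero lattice points are the zeros of the entire function ϑ₁(z)/z. -/
theorem isClosed_lattice_diff_zero (hτ : 0 < τ.im) : IsClosed ((lattice τ : Set ℂ) \ {0}) := by
  have : (lattice τ : Set ℂ) \ {0} = {z | thetaQuot τ z = 0} := by
    ext z
    refine ⟨fun ⟨h1, h2⟩ => ?_, fun h => ?_⟩
    · have := (theta₁_eq_zero_iff hτ).2 h1
      rw [theta₁_eq_mul_thetaQuot, mul_eq_zero] at this
      exact this.resolve_left h2
    · by_contra hz
      exact thetaQuot_ne_zero hτ (fun h1 => by_contra fun h2 => hz ⟨h1, h2⟩) h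
  rw [this]
  exact isClosed_eq (differentiable_thetaQuot hτ).continuous continuous_const

theorem isOpen_cover (hτ : 0 < τ.im) : IsOpen X.cover := by
  have : X.coverᶜ = ⋃ j, ((lattice τ : Set ℂ) + closure (X.hole j).carrier) := by
    ext z
    simp only [mem_compl_iff, mem_cover_iff, not_forall, not_not, mem_iUnion, Set.mem_add]
    refine exists_congr fun j => ⟨fun ⟨l, hl, h⟩ => ⟨-l, neg_mem hl, _, h, by ring⟩,
      fun ⟨l, hl, w, hw, h⟩ => ⟨-l, neg_mem hl, ?_⟩⟩
    rwa [← h, show l + w + -l = w by ring]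
  rw [← isClosed_compl_iff, this]
  exact isClosed_iUnion_of_finite fun j =>
    (isClosed_lattice hτ).add_right_of_isCompact (X.hole j).isCompact_closure

theorem isOpen_holeNhd (hτ : 0 < τ.im) (j : Fin M) : IsOpen (X.holeNhd j) := by
  classical
  have : (X.holeNhd j)ᶜ = ⋃ i, ((if i = j then (lattice τ : Set ℂ) \ {0} else lattice τ) +
      closure (X.hole i).carrier) := by
    ext z
    simp only [holeNhd, mem_compl_iff, mem_ofPred_eq, not_forall, mem_iUnion, Set.mem_add]
    refine exists_congr fun i => ⟨fun ⟨l, hl, h, hij⟩ => ⟨-l, ?_, _, h, by ring⟩,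
      fun ⟨l, hl, w, hw, h⟩ => ⟨-l, ?_, ?_, ?_⟩⟩
    · by_cases h1 : i = j
      · simpa [h1, hl] using hij
      · simpa [h1] using hl
    · by_cases h1 : i = j
      · simp only [h1, if_true] at hl
        exact neg_mem hl.1
      · simp only [h1, if_false] at hl
        exact neg_mem hl
    · rwa [← h, show l + w + -l = w by ring]
    · rintro ⟨h1, h2⟩
      simp only [h1, if_true] at hl
      exact hl.2 (neg_eq_zero.1 h2)
  rw [← isClosed_compl_iff, this]
  refine isClosed_iUnion_of_finite fun i => ?_
  refine IsClosed.add_right_of_isCompact ?_ (X.hole i).isCompact_closure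
  split_ifs
  · exact isClosed_lattice_diff_zero hτ
  · exact isClosed_lattice hτ

theorem closure_subset_holeNhd (j : Fin M) : closure (X.hole j).carrier ⊆ X.holeNhd j := by
  intro z hz i l hl h
  have hp : proj τ z = proj τ (z + l) := proj_eq_proj_iff.2 (by simpa using hl)
  have hij : i = j := by
    by_contra hne
    exact (X.disjoint_closure hne).le_bot ⟨⟨_, h, rfl⟩, ⟨z, hz, hp⟩⟩
  subst hij
  exact ⟨rfl, by simpa using (X.injOn_proj i hz h hp).symm⟩

theorem mem_cover_of_mem_holeNhd {j : Fin M} {z : ℂ} (hz : z ∈ X.holeNhd j)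
    (h : z ∉ closure (X.hole j).carrier) : z ∈ X.cover := by
  rw [mem_cover_iff]
  intro i l hl hzl
  obtain ⟨rfl, rfl⟩ := hz i l hl hzl
  exact h (by simpa using hzl)

theorem sub_notMem_lattice_of_mem_cover {z : ℂ} (hz : z ∈ X.cover) {j : Fin M} {w : ℂ}
    (hw : w ∈ closure (X.hole j).carrier) : z - w ∉ lattice τ := fun h =>
  X.mem_cover_iff.1 hz j (w - z) (by rw [← neg_sub]; exact neg_mem h) (by simpa using hw)

theorem eq_of_sub_mem_lattice {i j : Fin M} {z w : ℂ} (hz : z ∈ X.holeNhd j)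
    (hw : w ∈ closure (X.hole i).carrier) (h : z - w ∈ lattice τ) : i = j ∧ z = w := by
  obtain ⟨h1, h2⟩ := hz i (w - z) (by rw [← neg_sub]; exact neg_mem h) (by simpa using hw)
  exact ⟨h1, (sub_eq_zero.1 h2).symm⟩

theorem notMem_cover_of_mem_closure {j : Fin M} {z : ℂ} (hz : z ∈ closure (X.hole j).carrier) :
    z ∉ X.cover := fun h => X.sub_notMem_lattice_of_mem_cover h hz (by simp)

theorem exists_collar (hτ : 0 < τ.im) (j : Fin M) : ∃ h₀ : ℝ, 0 < h₀ ∧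
    (∀ s h, |h| ≤ h₀ → (X.hole j).curve s + h * (X.hole j).normal s ∈ X.holeNhd j) ∧
    ∀ s h, 0 < h → h ≤ h₀ →
      (X.hole j).curve s + h * (X.hole j).normal s ∈ (X.hole j).carrier ∧
      (X.hole j).curve s - h * (X.hole j).normal s ∈ X.cover := by
  obtain ⟨h₁, hh₁, hcol⟩ := (X.hole j).exists_collar
  obtain ⟨δ, hδ, hsub⟩ := (X.hole j).isCompact_closure.exists_cthickening_subset_open
    (X.isOpen_holeNhd hτ j) (X.closure_subset_holeNhd j)
  have hN : ∀ s h : ℝ, |h| ≤ min h₁ δ →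
      (X.hole j).curve s + h * (X.hole j).normal s ∈ X.holeNhd j := fun s h hh => by
    refine hsub (Metric.mem_cthickening_of_dist_le _ _ _ _ ((X.hole j).curve_mem_closure s) ?_)
    rw [dist_eq_norm, add_sub_cancel_left, norm_mul, (X.hole j).norm_normal]
    simpa using hh.trans (min_le_right _ _)
  refine ⟨min h₁ δ, lt_min hh₁ hδ, hN, fun s h h1 h2 => ?_⟩
  obtain ⟨h3, h4⟩ := hcol s h h1 (h2.trans (min_le_left _ _))
  refine ⟨h3, X.mem_cover_of_mem_holeNhd ?_ h4⟩
  have := hN s (-h) (by rwa [abs_neg, abs_of_pos h1])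
  simpa [← sub_eq_add_neg] using this

theorem isCompact_boundary : IsCompact X.boundary :=
  isCompact_iUnion fun j => (X.hole j).isBounded_carrier.isCompact_closure.of_isClosed_subset
    isClosed_frontier frontier_subset_closure

instance : CompactSpace X.boundary := isCompact_iff_compactSpace.1 X.isCompact_boundary

end HoledTorus

/-! ### Cauchy integrals along the boundary curve -/

namespace C2Hole

variable (D : C2Hole)

theorem exists_le_norm_sub' :
    ∃ c h₀ : ℝ, 0 < c ∧ 0 < h₀ ∧ ∀ s t h, |t - s| ≤ 3 / 4 → |h| ≤ h₀ →
      c * (|t - s| + |h|) ≤ ‖D.curve t - (D.curve s + h * D.normal s)‖ ∧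
      c * (|t - s| + |h|) ≤ ‖D.curve t - (D.curve s - h * D.normal s)‖ := by
  obtain ⟨c, h₀, hc, hh₀, hlow⟩ := D.exists_le_norm_sub
  refine ⟨c, h₀, hc, hh₀, fun s t h h1 h2 => ⟨hlow s t h h1 h2, ?_⟩⟩
  have := hlow s t (-h) h1 (by rwa [abs_neg])
  simpa [← sub_eq_add_neg] using this

/-- For a straight boundary the two points are mirror images, and the imaginary parts of their
kernels cancel exactly. This is the model for `exists_abs_im_add_le`. -/
theorem div_add_div_tangent_im (s x h : ℝ) :
    (deriv D.curve s / (x * deriv D.curve s - h * D.normal s) +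
      deriv D.curve s / (x * deriv D.curve s + h * D.normal s)).im = 0 := by
  have hν : D.normal s ≠ 0 := norm_ne_zero_iff.1 (by rw [D.norm_normal]; exact one_ne_zero)
  have ha := D.norm_deriv_curve_pos s
  rw [D.deriv_curve_eq s]
  set a := ‖deriv D.curve s‖
  have e : ∀ k : ℝ, Complex.I * a * D.normal s / (x * (Complex.I * a * D.normal s) +
      k * D.normal s) = Complex.I * a / (k + (x * a : ℝ) * Complex.I) := fun k => by
    rw [show (x : ℂ) * (Complex.I * a * D.normal s) + k * D.normal s =
      (k + (x * a : ℝ) * Complex.I) * D.normal s by push_cast; ring, mul_div_mul_right _ _ hν]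
  have e2 := e (-h)
  rw [Complex.ofReal_neg, neg_mul, ← sub_eq_add_neg] at e2
  rw [e2, e h, Complex.add_im, Complex.div_im, Complex.div_im]
  simp [Complex.normSq_apply]
  ring

theorem _root_.Complex.abs_im_add_le {a b a' b' : ℂ} {c : ℝ} (hz : (a' + b').im = 0)
    (ha : ‖a - a'‖ ≤ c) (hb : ‖b - b'‖ ≤ c) : |(a + b).im| ≤ 2 * c := by
  have : (a + b).im = ((a - a') + (b - b')).im := by
    rw [show (a - a') + (b - b') = (a + b) - (a' + b') by ring, Complex.sub_im, hz, sub_zero]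
  rw [this, two_mul]
  exact (Complex.abs_im_le_norm _).trans ((norm_add_le _ _).trans (add_le_add ha hb))

/-- Put δ = |t - s| + |h|. Passing to the tangent line changes the numerators by O(δ) and the
denominators by O(δ²), while all denominators are at least of order δ; so each quotient changes by
O(1). The imaginary parts of the tangent kernels cancel. The case h = 0 bounds the kernel on the
boundary itself. -/
theorem exists_abs_im_add_le :
    ∃ C h₀ : ℝ, 0 < C ∧ 0 < h₀ ∧ ∀ s t h, |t - s| ≤ 3 / 4 → |h| ≤ h₀ →
      |(deriv D.curve t / (D.curve t - (D.curve s + h * D.normal s)) +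
        deriv D.curve t / (D.curve t - (D.curve s - h * D.normal s))).im| ≤ C := by
  obtain ⟨C, hC, hT⟩ := D.exists_taylor
  obtain ⟨L, hL, hLip⟩ := D.exists_lipschitz_deriv
  obtain ⟨B, hB, hBd⟩ := D.exists_norm_deriv_le
  obtain ⟨m, hm, hmd⟩ := D.exists_le_norm_deriv
  obtain ⟨c, h₀, hc, hh₀, hlow⟩ := D.exists_le_norm_sub'
  set c' := min (m / 2) (1 / 2)
  have hc' : 0 < c' := by positivity
  refine ⟨2 * (L / c + B * (C / (c * c'))), h₀, by positivity, hh₀, fun s t h hst hh => ?_⟩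
  obtain ⟨h1, h2⟩ := hlow s t h hst hh
  have hflat : ∀ k : ℝ, |k| = |h| → c' * (|t - s| + |h|) ≤
      ‖((t - s : ℝ) : ℂ) * deriv D.curve s - k * D.normal s‖ := fun k hk => by
    refine le_trans ?_ (D.le_norm_mul_deriv_sub s (t - s) k)
    have := mul_le_mul_of_nonneg_right (min_le_left (m / 2) (1 / 2)) (abs_nonneg (t - s))
    have := mul_le_mul_of_nonneg_right (min_le_right (m / 2) (1 / 2)) (abs_nonneg h)
    have := mul_le_mul_of_nonneg_right (hmd s) (abs_nonneg (t - s))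
    rw [hk, mul_add]
    linarith
  -- Here both denominators vanish, and division by zero gives 0.
  by_cases h0 : |t - s| + |h| = 0
  · have h3 : t = s := by
      have := abs_nonneg (t - s)
      have := abs_nonneg h
      exact sub_eq_zero.1 (abs_eq_zero.1 (by linarith))
    have h4 : h = 0 := by
      have := abs_nonneg (t - s)
      have := abs_nonneg h
      exact abs_eq_zero.1 (by linarith)
    simp [h3, h4]
    positivity
  have hpos : 0 < |t - s| + |h| := lt_of_le_of_ne (by positivity) (Ne.symm h0)
  set δ := |t - s| + |h|
  have htd : |t - s| ≤ δ := le_add_of_nonneg_right (abs_nonneg h)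
  have key : ∀ k : ℝ, |k| = |h| → c * δ ≤ ‖D.curve t - D.curve s - k * D.normal s‖ →
      ‖deriv D.curve t / (D.curve t - D.curve s - k * D.normal s) -
        deriv D.curve s / (((t - s : ℝ) : ℂ) * deriv D.curve s - k * D.normal s)‖ ≤
      L / c + B * (C / (c * c')) := by
    intro k hk hb
    have hb' := hflat k hk
    set P := D.curve t - D.curve s - k * D.normal s with hP
    set Q := ((t - s : ℝ) : ℂ) * deriv D.curve s - k * D.normal s with hQ
    have hPn : P ≠ 0 := norm_pos_iff.1 (lt_of_lt_of_le (by positivity) hb)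
    have hQn : Q ≠ 0 := norm_pos_iff.1 (lt_of_lt_of_le (by positivity) hb')
    have e : deriv D.curve t / P - deriv D.curve s / Q =
        (deriv D.curve t - deriv D.curve s) / P + deriv D.curve s * (-(P - Q) / (P * Q)) := by
      field_simp
      ring
    have hPQ : ‖P - Q‖ ≤ C * |t - s| ^ 2 := by
      convert! hT s t using 2
      rw [hP, hQ]
      ring
    rw [e]
    refine (norm_add_le _ _).trans (add_le_add ?_ ?_)
    · rw [norm_div]
      calc _ ≤ L * δ / (c * δ) := div_le_div₀ (by positivity)
            ((hLip s t).trans (mul_le_mul_of_nonneg_left htd hL.le)) (by positivity) hb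
        _ = _ := by field_simp
    · rw [norm_mul, norm_div, norm_neg, norm_mul]
      refine mul_le_mul (hBd s) ?_ (by positivity) hB.le
      calc _ ≤ C * δ ^ 2 / ((c * δ) * (c' * δ)) := div_le_div₀ (by positivity)
            (hPQ.trans (mul_le_mul_of_nonneg_left (pow_le_pow_left₀ (abs_nonneg _) htd 2) hC.le))
            (by positivity) (mul_le_mul hb hb' (by positivity) (norm_nonneg _))
        _ = _ := by field_simp
  have k1 := key h rfl (by rwa [sub_sub])
  have k2 := key (-h) (abs_neg h) (by
    rw [Complex.ofReal_neg, neg_mul, sub_neg_eq_add, sub_add]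
    exact h2)
  rw [Complex.ofReal_neg, neg_mul, sub_neg_eq_add, sub_neg_eq_add] at k2
  have := Complex.abs_im_add_le (D.div_add_div_tangent_im s (t - s) h) k1 k2
  rwa [sub_sub (D.curve t), sub_add (D.curve t)] at this

/-- The Cauchy integral `∫ f(ξ) dξ / (ξ - z)` along the curve. -/
def cauchy (f : ℝ → ℝ) (z : ℂ) : ℂ :=
  ∫ t in (0 : ℝ)..1, (f t : ℂ) * (deriv D.curve t / (D.curve t - z))

variable {D} {f : ℝ → ℝ}

theorem continuous_cauchy_integrand (hf : Continuous f) {z : ℂ} (hz : ∀ t, z ≠ D.curve t) :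
    Continuous fun t => (f t : ℂ) * (deriv D.curve t / (D.curve t - z)) := by
  have h1 := D.continuous_curve
  have h2 := D.continuous_deriv_curve
  have h3 : ∀ t, D.curve t - z ≠ 0 := fun t => sub_ne_zero.2 (hz t).symm
  fun_prop (disch := assumption)

theorem measurable_cauchy_integrand (hf : Continuous f) (z : ℂ) :
    Measurable fun t => (f t : ℂ) * (deriv D.curve t / (D.curve t - z)) := by
  have h1 := D.continuous_curve.measurable
  have h2 := D.continuous_deriv_curve.measurable
  have h3 := hf.measurable
  fun_prop

theorem periodic_cauchy_integrand (hp : Function.Periodic f 1) (z : ℂ) :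
    Function.Periodic (fun t => (f t : ℂ) * (deriv D.curve t / (D.curve t - z))) 1 := fun t => by
  simp only [hp t, D.periodic_curve t, D.periodic_deriv_curve t]

theorem integral_eq_of_periodic {E : Type*} [NormedAddCommGroup E] [NormedSpace ℝ E] {F : ℝ → E}
    (h : Function.Periodic F 1) (s : ℝ) :
    ∫ t in (0 : ℝ)..1, F t = ∫ t in (s - 1 / 2)..(s + 1 / 2), F t := by
  have := h.intervalIntegral_add_eq 0 (s - 1 / 2)
  rw [zero_add] at this
  rw [this]
  congr 1
  ring

theorem exists_forall_ne_curve (D : C2Hole) : ∃ h₀ : ℝ, 0 < h₀ ∧ ∀ s h, 0 < h → h ≤ h₀ →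
    (∀ t, D.curve s + h * D.normal s ≠ D.curve t) ∧
    ∀ t, D.curve s - h * D.normal s ≠ D.curve t := by
  obtain ⟨c, h₀, hc, hh₀, hlow⟩ := D.exists_le_norm_sub
  refine ⟨h₀, hh₀, fun s h h1 h2 => ⟨D.curve_add_ne_curve hc hlow
    (by rwa [abs_of_pos h1]) h1.ne' s, fun t => ?_⟩⟩
  have := D.curve_add_ne_curve hc hlow (h := -h) (by rwa [abs_neg, abs_of_pos h1])
    (by linarith) s t
  simpa [← sub_eq_add_neg] using this

/-- The symmetric sum of kernels is bounded, so dominated convergence applies with a constant bound.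
The limit is taken jointly in the base point and the distance, which later gives unrestricted limits
and not only limits along one normal. -/
theorem tendsto_im_cauchy_add (hf : Continuous f) (hp : Function.Periodic f 1) (s₀ : ℝ) :
    Tendsto (fun p : ℝ × ℝ => (D.cauchy f (D.curve p.1 + p.2 * D.normal p.1) +
      D.cauchy f (D.curve p.1 - p.2 * D.normal p.1)).im) (𝓝 s₀ ×ˢ 𝓝[>] 0)
      (𝓝 (2 * ∫ t in (0 : ℝ)..1, f t * (deriv D.curve t / (D.curve t - D.curve s₀)).im)) := by
  obtain ⟨C, h₀, hC, hh₀, hbd⟩ := D.exists_abs_im_add_le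
  obtain ⟨h₁, hh₁, hne⟩ := exists_forall_ne_curve D
  obtain ⟨B, hB, hfB⟩ := Function.Periodic.exists_norm_le (f := fun t => (f t : ℂ))
    (fun t => by simp only [hp t]) (by fun_prop)
  have hB' : ∀ t, |f t| ≤ B := fun t => by simpa using hfB t
  -- A base point within 1/4 of `s₀` and a parameter within 1/2 of `s₀` are at distance at most 3/4.
  have hev : ∀ᶠ p : ℝ × ℝ in 𝓝 s₀ ×ˢ 𝓝[>] 0, |p.1 - s₀| < 1 / 4 ∧ 0 < p.2 ∧ p.2 ≤ min h₀ h₁ :=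
    mem_of_superset (prod_mem_prod (Metric.ball_mem_nhds s₀ (by norm_num : (0 : ℝ) < 1 / 4))
      (Ioc_mem_nhdsGT (lt_min hh₀ hh₁))) fun p hp => ⟨by simpa [Real.dist_eq] using hp.1, hp.2⟩
  have hper : Function.Periodic
      (fun t => f t * (deriv D.curve t / (D.curve t - D.curve s₀)).im) 1 := fun t => by
    simp only [hp t, D.periodic_curve t, D.periodic_deriv_curve t]
  rw [integral_eq_of_periodic hper s₀, ← intervalIntegral.integral_const_mul]
  have heq : ∀ᶠ p : ℝ × ℝ in 𝓝 s₀ ×ˢ 𝓝[>] 0,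
      ∫ t in (s₀ - 1 / 2)..(s₀ + 1 / 2), f t *
        (deriv D.curve t / (D.curve t - (D.curve p.1 + p.2 * D.normal p.1)) +
        deriv D.curve t / (D.curve t - (D.curve p.1 - p.2 * D.normal p.1))).im =
      (D.cauchy f (D.curve p.1 + p.2 * D.normal p.1) +
      D.cauchy f (D.curve p.1 - p.2 * D.normal p.1)).im := by
    filter_upwards [hev] with p ⟨h1, h2, h3⟩
    obtain ⟨n1, n2⟩ := hne p.1 p.2 h2 (h3.trans (min_le_right _ _))
    have c1 := continuous_cauchy_integrand hf n1
    have c2 := continuous_cauchy_integrand hf n2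
    rw [cauchy, cauchy, integral_eq_of_periodic (periodic_cauchy_integrand hp _) s₀,
      integral_eq_of_periodic (periodic_cauchy_integrand hp _) s₀,
      ← intervalIntegral.integral_add (c1.intervalIntegrable _ _) (c2.intervalIntegrable _ _)]
    have := Complex.imCLM.intervalIntegral_comp_comm
      ((c1.add c2).intervalIntegrable (μ := volume) (s₀ - 1 / 2) (s₀ + 1 / 2))
    simp only [Complex.imCLM_apply] at this
    refine Eq.trans ?_ this
    congr 1
    funext t
    simp only [Pi.add_apply]
    rw [← mul_add, Complex.im_ofReal_mul]
  refine Tendsto.congr' heq ?_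
  refine intervalIntegral.tendsto_integral_filter_of_dominated_convergence (fun _ => B * C) ?_ ?_
    intervalIntegrable_const ?_
  · refine Filter.Eventually.of_forall fun p => Measurable.aestronglyMeasurable ?_
    have h1 := D.continuous_curve.measurable
    have h2 := D.continuous_deriv_curve.measurable
    have h3 := hf.measurable
    exact h3.mul (Complex.measurable_im.comp (by fun_prop))
  · filter_upwards [hev] with p ⟨h1, h2, h3⟩
    refine Filter.Eventually.of_forall fun t ht => ?_
    rw [Real.norm_eq_abs, abs_mul]
    refine mul_le_mul (hB' t) (hbd _ _ _ ?_ ?_) (abs_nonneg _) hB.le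
    · rw [uIoc_of_le (by linarith)] at ht
      rw [abs_lt] at h1
      rw [abs_le]
      constructor <;> linarith [ht.1, ht.2, h1.1, h1.2]
    · rw [abs_of_pos h2]
      exact h3.trans (min_le_left _ _)
  · have : ∀ᵐ t : ℝ, t ≠ s₀ := by simp [ae_iff]
    filter_upwards [this] with t hts ht
    have hne' : D.curve t - D.curve s₀ ≠ 0 := by
      rw [sub_ne_zero]
      intro h
      refine hts (D.eq_of_curve_eq h ?_)
      rw [uIoc_of_le (by linarith)] at ht
      rw [abs_lt]
      constructor <;> linarith [ht.1, ht.2]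
    have h1 := D.continuous_curve
    have h2 := D.continuous_normal
    have hcont : ContinuousAt (fun p : ℝ × ℝ => f t *
        (deriv D.curve t / (D.curve t - (D.curve p.1 + p.2 * D.normal p.1)) +
        deriv D.curve t / (D.curve t - (D.curve p.1 - p.2 * D.normal p.1))).im) (s₀, 0) := by
      refine continuousAt_const.mul (Complex.continuous_im.continuousAt.comp (.add ?_ ?_))
      · exact ContinuousAt.div (by fun_prop) (by fun_prop) (by simpa using hne')
      · exact ContinuousAt.div (by fun_prop) (by fun_prop) (by simpa using hne')
    have h3 := hcont.tendsto.mono_left (show 𝓝 s₀ ×ˢ 𝓝[>] 0 ≤ 𝓝 (s₀, (0 : ℝ)) by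
      rw [nhds_prod_eq]; exact Filter.prod_mono le_rfl nhdsWithin_le_nhds)
    convert! h3 using 2
    simp
    ring

/-- This is the Plemelj jump. After the substitution t = s + hx the difference of the kernels is
dominated by a multiple of 1/(1 + x²) and converges to a rescaled Cauchy density with integral π.
The sign is negative because the curve runs clockwise. -/
theorem tendsto_cauchy_sub (hf : Continuous f) (hp : Function.Periodic f 1) (s₀ : ℝ) :
    Tendsto (fun p : ℝ × ℝ => D.cauchy f (D.curve p.1 + p.2 * D.normal p.1) -
      D.cauchy f (D.curve p.1 - p.2 * D.normal p.1)) (𝓝 s₀ ×ˢ 𝓝[>] 0)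
      (𝓝 (-(2 * Real.pi * Complex.I) * f s₀)) := by
  obtain ⟨C, hC, hT⟩ := D.exists_taylor
  obtain ⟨A, hA, hdA⟩ := D.exists_norm_deriv_le
  obtain ⟨c, h₀, hc, hh₀, hlow⟩ := D.exists_le_norm_sub'
  obtain ⟨h₁, hh₁, hne⟩ := exists_forall_ne_curve D
  obtain ⟨B, hB, hfB⟩ := Function.Periodic.exists_norm_le (f := fun t => (f t : ℂ))
    (fun t => by simp only [hp t]) (by fun_prop)
  have hev : ∀ᶠ p : ℝ × ℝ in 𝓝 s₀ ×ˢ 𝓝[>] 0, 0 < p.2 ∧ p.2 ≤ min h₀ h₁ :=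
    mem_of_superset (prod_mem_prod univ_mem (Ioc_mem_nhdsGT (lt_min hh₀ hh₁))) fun p hp => hp.2
  set G : ℝ × ℝ → ℝ → ℂ := fun p t => (f t : ℂ) *
    (deriv D.curve t / (D.curve t - (D.curve p.1 + p.2 * D.normal p.1))) - (f t : ℂ) *
    (deriv D.curve t / (D.curve t - (D.curve p.1 - p.2 * D.normal p.1))) with hG
  -- One period becomes an interval of length 1/h in the variable x; the indicator extends the
  -- integral to the whole line.
  set J : ℝ × ℝ → ℝ → ℂ := fun p => (Ioc (-(1 / (2 * p.2))) (1 / (2 * p.2))).indicator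
    fun x => p.2 * G p (p.1 + p.2 * x) with hJ
  have hJin : ∀ p x, x ∈ Ioc (-(1 / (2 * p.2))) (1 / (2 * p.2)) →
      J p x = p.2 * G p (p.1 + p.2 * x) := fun p x hx => indicator_of_mem hx _
  have hJout : ∀ p x, x ∉ Ioc (-(1 / (2 * p.2))) (1 / (2 * p.2)) → J p x = 0 :=
    fun p x hx => indicator_of_notMem hx _
  set a := ‖deriv D.curve s₀‖ with ha
  have hapos : 0 < a := D.norm_deriv_curve_pos s₀
  have heq : ∀ᶠ p : ℝ × ℝ in 𝓝 s₀ ×ˢ 𝓝[>] 0, ∫ x, J p x =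
      D.cauchy f (D.curve p.1 + p.2 * D.normal p.1) -
      D.cauchy f (D.curve p.1 - p.2 * D.normal p.1) := by
    filter_upwards [hev] with p ⟨h2, h3⟩
    obtain ⟨n1, n2⟩ := hne p.1 p.2 h2 (h3.trans (min_le_right _ _))
    have c1 := continuous_cauchy_integrand hf n1
    have c2 := continuous_cauchy_integrand hf n2
    rw [cauchy, cauchy, integral_eq_of_periodic (periodic_cauchy_integrand hp _) p.1,
      integral_eq_of_periodic (periodic_cauchy_integrand hp _) p.1,
      ← intervalIntegral.integral_sub (c1.intervalIntegrable _ _) (c2.intervalIntegrable _ _)]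
    have hle : -(1 / (2 * p.2)) ≤ 1 / (2 * p.2) := by
      have : 0 < 1 / (2 * p.2) := by positivity
      linarith
    rw [hJ, integral_indicator measurableSet_Ioc, ← intervalIntegral.integral_of_le hle,
      intervalIntegral.integral_const_mul]
    have := intervalIntegral.smul_integral_comp_add_mul (a := -(1 / (2 * p.2)))
      (b := 1 / (2 * p.2)) (G p) p.2 p.1
    rw [Complex.real_smul] at this
    rw [this]
    congr 1 <;> field_simp
    ring
  refine Tendsto.congr' heq ?_
  have hlim : ∫ x : ℝ, (-(2 * Complex.I) * f s₀) * ((a * (1 + (a * x) ^ 2)⁻¹ : ℝ) : ℂ) =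
      -(2 * Real.pi * Complex.I) * f s₀ := by
    rw [integral_const_mul, integral_complex_ofReal, integral_const_mul,
      Measure.integral_comp_mul_left (fun y => (1 + y ^ 2)⁻¹) a, integral_univ_inv_one_add_sq,
      abs_of_pos (inv_pos.2 hapos), smul_eq_mul, mul_inv_cancel_left₀ hapos.ne']
    ring
  rw [← hlim]
  refine tendsto_integral_filter_of_dominated_convergence
    (fun x => B * A * (2 / c ^ 2) * (1 + x ^ 2)⁻¹) ?_ ?_
    (integrable_inv_one_add_sq.const_mul _) ?_
  · refine Filter.Eventually.of_forall fun p => Measurable.aestronglyMeasurable ?_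
    refine Measurable.indicator ?_ measurableSet_Ioc
    refine measurable_const.mul ?_
    exact ((measurable_cauchy_integrand hf _).sub (measurable_cauchy_integrand hf _)).comp
      (by fun_prop)
  · filter_upwards [hev] with p ⟨h2, h3⟩
    refine Filter.Eventually.of_forall fun x => ?_
    by_cases hx : x ∈ Ioc (-(1 / (2 * p.2))) (1 / (2 * p.2))
    swap
    · rw [hJout p x hx, norm_zero]
      positivity
    rw [hJin p x hx]
    have hx' : |p.2 * x| ≤ 1 / 2 := by
      rw [abs_mul, abs_of_pos h2]
      have : |x| ≤ 1 / (2 * p.2) := abs_le.2 ⟨hx.1.le, hx.2⟩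
      calc p.2 * |x| ≤ p.2 * (1 / (2 * p.2)) := mul_le_mul_of_nonneg_left this h2.le
        _ = 1 / 2 := by field_simp
    obtain ⟨l1, l2⟩ := hlow p.1 (p.1 + p.2 * x) p.2
      (by rw [add_sub_cancel_left]; linarith) (by rw [abs_of_pos h2]; exact h3.trans (min_le_left _ _))
    rw [add_sub_cancel_left, abs_mul, abs_of_pos h2] at l1 l2
    set t := p.1 + p.2 * x
    set P := D.curve t - (D.curve p.1 + p.2 * D.normal p.1) with hP
    set Q := D.curve t - (D.curve p.1 - p.2 * D.normal p.1) with hQ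
    have hδ : 0 < c * (p.2 * |x| + p.2) := by positivity
    have hPn : P ≠ 0 := norm_pos_iff.1 (hδ.trans_le l1)
    have hQn : Q ≠ 0 := norm_pos_iff.1 (hδ.trans_le l2)
    -- The difference of the reciprocals has numerator Q - P = 2hν, whence the quadratic decay in x.
    have e : p.2 * G p t = f t * deriv D.curve t * (2 * p.2 ^ 2 * D.normal p.1 / (P * Q)) := by
      simp only [hG, ← hP, ← hQ]
      have hQP : Q - P = 2 * p.2 * D.normal p.1 := by rw [hP, hQ]; ring
      field_simp
      linear_combination p.2 * f t * deriv D.curve t * hQP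
    rw [e, norm_mul, norm_mul, norm_div, norm_mul, norm_mul, D.norm_normal, norm_mul]
    rw [mul_assoc (B * A)]
    refine mul_le_mul (mul_le_mul (hfB t) (hdA t) (norm_nonneg _) hB.le) ?_ (by positivity)
      (by positivity)
    have hn : ‖(2 : ℂ)‖ * ‖(p.2 : ℂ) ^ 2‖ * 1 = 2 * p.2 ^ 2 := by
      simp
    rw [hn]
    calc _ ≤ 2 * p.2 ^ 2 / ((c * (p.2 * |x| + p.2)) * (c * (p.2 * |x| + p.2))) := by
          gcongr
      _ = 2 / c ^ 2 * ((1 + |x|) ^ 2)⁻¹ := by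
          field_simp
          ring
      _ ≤ _ := by
          gcongr
          have := sq_abs x
          nlinarith [abs_nonneg x]
  · refine Filter.Eventually.of_forall fun x => ?_
    have hm : 𝓝 s₀ ×ˢ 𝓝[>] 0 ≤ 𝓝 (s₀, (0 : ℝ)) := by
      rw [nhds_prod_eq]; exact Filter.prod_mono le_rfl nhdsWithin_le_nhds
    have t1 : Tendsto (fun p : ℝ × ℝ => p.1) (𝓝 s₀ ×ˢ 𝓝[>] 0) (𝓝 s₀) := tendsto_fst
    have t2 : Tendsto (fun p : ℝ × ℝ => p.2) (𝓝 s₀ ×ˢ 𝓝[>] 0) (𝓝 0) :=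
      tendsto_snd.mono_right nhdsWithin_le_nhds
    have t3 : Tendsto (fun p : ℝ × ℝ => p.1 + p.2 * x) (𝓝 s₀ ×ˢ 𝓝[>] 0) (𝓝 s₀) := by
      simpa using t1.add (t2.mul_const x)
    have tf := (Complex.continuous_ofReal.tendsto _).comp ((hf.tendsto s₀).comp t3)
    have td := (D.continuous_deriv_curve.tendsto s₀).comp t3
    have td' := (D.continuous_deriv_curve.tendsto s₀).comp t1
    have tn := (D.continuous_normal.tendsto s₀).comp t1
    -- The difference quotient is taken at a moving base point, so the uniform Taylor bound is
    -- needed and not just the derivative at `s₀`.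
    have tq : Tendsto (fun p : ℝ × ℝ => (D.curve (p.1 + p.2 * x) - D.curve p.1) / p.2)
        (𝓝 s₀ ×ˢ 𝓝[>] 0) (𝓝 (x * deriv D.curve s₀)) := by
      have h1 : Tendsto (fun p : ℝ × ℝ => (D.curve (p.1 + p.2 * x) - D.curve p.1) / p.2 -
          x * deriv D.curve p.1) (𝓝 s₀ ×ˢ 𝓝[>] 0) (𝓝 0) := by
        refine squeeze_zero_norm' (a := fun p => C * x ^ 2 * p.2) ?_ (by simpa using t2.const_mul _)
        filter_upwards [hev] with p ⟨h2, _⟩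
        have h2' : (p.2 : ℂ) ≠ 0 := by exact_mod_cast h2.ne'
        have h4 := hT p.1 (p.1 + p.2 * x)
        rw [add_sub_cancel_left, sq_abs] at h4
        rw [show (D.curve (p.1 + p.2 * x) - D.curve p.1) / p.2 - x * deriv D.curve p.1 =
          (D.curve (p.1 + p.2 * x) - D.curve p.1 - (p.2 * x : ℝ) * deriv D.curve p.1) / p.2 by
            push_cast; field_simp, norm_div, Complex.norm_real, Real.norm_eq_abs, abs_of_pos h2,
          div_le_iff₀ h2]
        linarith
      simpa using h1.add (td'.const_mul (x : ℂ))
    have hν : D.normal s₀ ≠ 0 := norm_ne_zero_iff.1 (by rw [D.norm_normal]; exact one_ne_zero)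
    have hI : ∀ k : ℝ, k ≠ 0 → (k + (a * x : ℝ) * Complex.I : ℂ) ≠ 0 := fun k hk h => by
      have := congrArg Complex.re h
      simp at this
      exact hk this
    have hflat : ∀ k : ℝ, (x : ℂ) * deriv D.curve s₀ + k * D.normal s₀ =
        (k + (a * x : ℝ) * Complex.I) * D.normal s₀ := fun k => by
      conv_lhs => rw [D.deriv_curve_eq s₀]
      push_cast
      ring
    have tmain := ((tf.mul td).mul ((tq.add (tn.const_mul ((-1 : ℝ) : ℂ))).inv₀
      (by rw [hflat]; exact mul_ne_zero (hI _ (by norm_num)) hν))).sub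
      ((tf.mul td).mul ((tq.add (tn.const_mul ((1 : ℝ) : ℂ))).inv₀
      (by rw [hflat]; exact mul_ne_zero (hI _ (by norm_num)) hν)))
    have hval : (-(2 * Complex.I) * f s₀) * ((a * (1 + (a * x) ^ 2)⁻¹ : ℝ) : ℂ) =
        (f s₀ : ℂ) * deriv D.curve s₀ * ((x : ℂ) * deriv D.curve s₀ +
          ((-1 : ℝ) : ℂ) * D.normal s₀)⁻¹ - (f s₀ : ℂ) * deriv D.curve s₀ *
          ((x : ℂ) * deriv D.curve s₀ + ((1 : ℝ) : ℂ) * D.normal s₀)⁻¹ := by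
      rw [hflat, hflat]
      conv_rhs => rw [D.deriv_curve_eq s₀]
      rw [← ha]
      have i1 := hI (-1) (by norm_num)
      have i2 := hI 1 (by norm_num)
      have i3 : (1 + (a * x : ℂ) ^ 2) ≠ 0 := by
        have : (0 : ℝ) < 1 + (a * x) ^ 2 := by positivity
        exact_mod_cast this.ne'
      push_cast at i1 i2 ⊢
      have e1 : (-1 + (a * x : ℂ) * Complex.I) * (1 + (a * x : ℂ) * Complex.I) =
          -(1 + (a * x : ℂ) ^ 2) := by
        linear_combination (a * x : ℂ) ^ 2 * Complex.I_sq
      have e2 : (-1 + (a * x : ℂ) * Complex.I)⁻¹ - (1 + (a * x : ℂ) * Complex.I)⁻¹ =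
          -2 * (1 + (a * x : ℂ) ^ 2)⁻¹ := by
        rw [inv_sub_inv i1 i2, e1, div_eq_mul_inv, inv_neg]
        ring
      have e3 : ∀ w : ℂ, (f s₀ : ℂ) * (Complex.I * a * D.normal s₀) * (w * D.normal s₀)⁻¹ =
          f s₀ * Complex.I * a * w⁻¹ := fun w => by
        rw [mul_inv]
        field_simp
      rw [e3, e3]
      linear_combination (-(f s₀ * Complex.I * a)) * e2
    rw [hval]
    refine tmain.congr' ?_
    have hxlarge : ∀ᶠ p : ℝ × ℝ in 𝓝 s₀ ×ˢ 𝓝[>] 0, |p.2| * |x| < 1 / 2 := by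
      have := t2.abs.mul_const |x|
      rw [abs_zero, zero_mul] at this
      exact this.eventually_lt_const (by norm_num)
    filter_upwards [hev, hxlarge] with p ⟨h2, _⟩ h4
    have h2' : (p.2 : ℂ) ≠ 0 := by exact_mod_cast h2.ne'
    have hx : x ∈ Ioc (-(1 / (2 * p.2))) (1 / (2 * p.2)) := by
      rw [abs_of_pos h2] at h4
      have : |x| < 1 / (2 * p.2) := by
        rw [lt_div_iff₀ (by positivity)]
        linarith
      exact ⟨(abs_lt.1 this).1, (abs_lt.1 this).2.le⟩
    rw [hJin p x hx]
    simp only [hG, Function.comp_apply]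
    have r1 : ∀ k : ℝ, (D.curve (p.1 + p.2 * x) - D.curve p.1) / p.2 + k * D.normal p.1 =
        (D.curve (p.1 + p.2 * x) - (D.curve p.1 - p.2 * k * D.normal p.1)) / p.2 := fun k => by
      field_simp
      ring
    rw [r1, r1, inv_div, inv_div]
    push_cast
    rw [mul_neg_one, mul_one, neg_mul, sub_neg_eq_add]
    ring

end C2Hole

/-! ### Logarithmic derivatives along closed curves -/

/-- A continuous function with values in 2πiℤ is constant on a preconnected set. Homotopy invariance
of argument integrals is reduced to this fact. -/
theorem eq_of_exp_eq_one_of_isPreconnected {X : Type*} [TopologicalSpace X] {S : Set X}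
    (hS : IsPreconnected S) {n : X → ℂ} (hn : ContinuousOn n S)
    (h : ∀ x ∈ S, Complex.exp (n x) = 1) {x y : X} (hx : x ∈ S) (hy : y ∈ S) : n x = n y := by
  have hdisc : DiscreteTopology (range ((↑) : ℤ → ℝ)) :=
    Int.isClosedEmbedding_coe_real.isEmbedding.toHomeomorph.symm.isEmbedding.discreteTopology
  have hval : ∀ x ∈ S, ∃ m : ℤ, n x = m * (2 * Real.pi * Complex.I) := fun x hx =>
    Complex.exp_eq_one_iff.1 (h x hx)
  have hre : ∀ m : ℤ, ((m : ℂ) * (2 * Real.pi * Complex.I) / (2 * Real.pi * Complex.I)).re = m :=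
    fun m => by rw [mul_div_cancel_right₀ _ Complex.two_pi_I_ne_zero, Complex.intCast_re]
  have hc := hS.constant_of_mapsTo (isDiscrete_iff_discreteTopology.2 hdisc) (f := fun x => (n x / (2 * Real.pi * Complex.I)).re)
    (T := range ((↑) : ℤ → ℝ))
    (Complex.continuous_re.comp_continuousOn (hn.div_const _))
    (fun x hx => by
      obtain ⟨m, hm⟩ := hval x hx
      exact ⟨m, by simp only [hm, hre]⟩) hx hy
  obtain ⟨m, hm⟩ := hval x hx
  obtain ⟨m', hm'⟩ := hval y hy
  simp only [hm, hm', hre, Int.cast_inj] at hc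
  rw [hm, hm', hc]

/-- The product of φ and exp(-∫ φ'/φ) has derivative zero. -/
theorem exp_integral_deriv_div {φ φ' : ℝ → ℂ} (hφ : ∀ t, HasDerivAt φ (φ' t) t)
    (hc : Continuous φ') (h0 : ∀ t, φ t ≠ 0) (t : ℝ) :
    Complex.exp (∫ s in (0 : ℝ)..t, φ' s / φ s) = φ t / φ 0 := by
  have hcφ : Continuous φ := continuous_iff_continuousAt.2 fun t => (hφ t).continuousAt
  have hcq : Continuous fun s => φ' s / φ s := hc.div hcφ h0
  have hint : ∀ t, HasDerivAt (fun t => ∫ s in (0 : ℝ)..t, φ' s / φ s) (φ' t / φ t) t := fun t =>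
    intervalIntegral.integral_hasDerivAt_right (hcq.intervalIntegrable _ _)
      hcq.stronglyMeasurable.stronglyMeasurableAtFilter hcq.continuousAt
  have hE : ∀ t, HasDerivAt (fun t => φ t * Complex.exp (-∫ s in (0 : ℝ)..t, φ' s / φ s)) 0 t :=
    fun t => by
      convert! (hφ t).mul (hint t).neg.cexp using 1
      have := h0 t
      field_simp
      ring
  have := is_const_of_deriv_eq_zero (fun t => (hE t).differentiableAt) (fun t => (hE t).deriv) t 0
  simp only [intervalIntegral.integral_same, neg_zero, Complex.exp_zero, mul_one] at this
  rw [Complex.exp_neg] at this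
  rw [← this]
  have := h0 t
  field_simp

theorem hasDerivAt_intervalIntegral_of_continuousOn {U : Set ℂ} (hU : IsOpen U)
    {Φ Φ' : ℂ → ℝ → ℂ} (hd : ∀ z ∈ U, ∀ t, HasDerivAt (fun z => Φ z t) (Φ' z t) z)
    (hc : ∀ z ∈ U, Continuous (Φ z)) (hc' : ContinuousOn (fun p : ℂ × ℝ => Φ' p.1 p.2) (U ×ˢ univ))
    {z : ℂ} (hz : z ∈ U) :
    HasDerivAt (fun z => ∫ t in (0 : ℝ)..1, Φ z t) (∫ t in (0 : ℝ)..1, Φ' z t) z := by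
  obtain ⟨r, hr, hball⟩ := Metric.nhds_basis_closedBall.mem_iff.1 (hU.mem_nhds hz)
  obtain ⟨C, hC⟩ := ((isCompact_closedBall z r).prod
    (isCompact_Icc (a := (0 : ℝ)) (b := 1))).exists_bound_of_continuousOn
    (hc'.mono (prod_mono hball (subset_univ _)))
  have hc'z : Continuous (Φ' z) := by
    have := hc'.comp (f := fun t : ℝ => (z, t)) (s := univ) (by fun_prop)
      fun t _ => ⟨hz, mem_univ _⟩
    exact continuousOn_univ.1 this
  refine (intervalIntegral.hasDerivAt_integral_of_dominated_loc_of_deriv_le (bound := fun _ => C)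
    (Metric.closedBall_mem_nhds z hr) ?_ ((hc z hz).intervalIntegrable _ _)
    hc'z.aestronglyMeasurable ?_ intervalIntegrable_const ?_).2
  · filter_upwards [hU.mem_nhds hz] with w hw
    exact (hc w hw).aestronglyMeasurable
  · refine Filter.Eventually.of_forall fun t ht w hw => hC (w, t) ⟨hw, ?_⟩
    rw [uIoc_of_le zero_le_one] at ht
    exact ⟨ht.1.le, ht.2⟩
  · exact Filter.Eventually.of_forall fun t _ w hw => hd w (hball hw) t

/-! ### Argument integrals along curves parallel to the boundary -/

namespace C2Hole

variable (D : C2Hole)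

theorem contDiff_normal : ContDiff ℝ 1 D.normal := by
  have h1 := D.contDiff_deriv_curve
  have h2 : ContDiff ℝ 1 fun t => ‖deriv D.curve t‖⁻¹ :=
    (h1.norm ℝ D.deriv_curve_ne_zero).inv fun t => norm_ne_zero_iff.2 (D.deriv_curve_ne_zero t)
  convert! (contDiff_const (c := -Complex.I)).mul (h2.smul h1) using 1
  funext t
  simp only [normal, rightNormal, Pi.smul_apply', Complex.real_smul, Complex.ofReal_inv]
  ring

theorem hasDerivAt_normal (t : ℝ) : HasDerivAt D.normal (deriv D.normal t) t :=
  (D.contDiff_normal.differentiable (by norm_num) t).hasDerivAt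

theorem continuous_deriv_normal : Continuous (deriv D.normal) :=
  D.contDiff_normal.continuous_deriv le_rfl

theorem hasDerivAt_offset (h t : ℝ) : HasDerivAt (fun t => D.curve t + h * D.normal t)
    (deriv D.curve t + h * deriv D.normal t) t :=
  (D.hasDerivAt_curve t).add ((D.hasDerivAt_normal t).const_mul (h : ℂ))

/-- The integral of the logarithmic derivative of `k` along the curve at distance `h`. -/
def offsetIntegral (k : ℂ → ℂ) (h : ℝ) : ℂ :=
  ∫ t in (0 : ℝ)..1, (deriv D.curve t + h * deriv D.normal t) * deriv k (D.curve t + h * D.normal t) /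
    k (D.curve t + h * D.normal t)

variable {D} {k : ℂ → ℂ} {U : Set ℂ}

theorem exp_offsetIntegral (hU : IsOpen U) (hk : DifferentiableOn ℂ k U) {h : ℝ}
    (hh : ∀ t, D.curve t + h * D.normal t ∈ U) (h0 : ∀ t, k (D.curve t + h * D.normal t) ≠ 0)
    (t : ℝ) :
    Complex.exp (∫ t in (0 : ℝ)..t, (deriv D.curve t + h * deriv D.normal t) *
      deriv k (D.curve t + h * D.normal t) / k (D.curve t + h * D.normal t)) =
      k (D.curve t + h * D.normal t) / k (D.curve 0 + h * D.normal 0) := by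
  refine exp_integral_deriv_div (φ := fun t => k (D.curve t + h * D.normal t)) (fun t => ?_) ?_ h0 t
  · have h1 := (hk.differentiableAt (hU.mem_nhds (hh t))).hasDerivAt
    convert! h1.comp t (D.hasDerivAt_offset h t) using 1
    ring
  · have h1 := D.continuous_deriv_curve
    have h2 := D.continuous_deriv_normal
    have h3 := D.continuous_normal
    have h4 := D.continuous_curve
    have h5 : Continuous fun t => deriv k (D.curve t + h * D.normal t) := by
      rw [← continuousOn_univ]
      exact (hk.deriv hU).continuousOn.comp (t := U) (by fun_prop) fun t _ => hh t
    fun_prop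

theorem offset_one (h : ℝ) : D.curve 1 + h * D.normal 1 = D.curve 0 + h * D.normal 0 := by
  have h1 := D.periodic_curve 0
  have h2 := D.periodic_normal 0
  rw [zero_add] at h1 h2
  rw [h1, h2]

/-- The curves are closed, so the integral lies in 2πiℤ, and it depends continuously on `h`. -/
theorem offsetIntegral_eq (hU : IsOpen U) (hk : DifferentiableOn ℂ k U) {J : Set ℝ}
    (hJ : IsPreconnected J) (hh : ∀ h ∈ J, ∀ t, D.curve t + h * D.normal t ∈ U)
    (h0 : ∀ h ∈ J, ∀ t, k (D.curve t + h * D.normal t) ≠ 0) {h h' : ℝ} (hhJ : h ∈ J)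
    (hhJ' : h' ∈ J) : D.offsetIntegral k h = D.offsetIntegral k h' := by
  refine eq_of_exp_eq_one_of_isPreconnected hJ ?_ (fun h hh' => ?_) hhJ hhJ'
  · rw [continuousOn_iff_continuous_domRestrict]
    refine intervalIntegral.continuous_parametric_intervalIntegral_of_continuous'
      (f := fun (h : J) t => (deriv D.curve t + (h : ℝ) * deriv D.normal t) *
        deriv k (D.curve t + (h : ℝ) * D.normal t) / k (D.curve t + (h : ℝ) * D.normal t)) ?_ 0 1
    have h1 := D.continuous_deriv_curve
    have h2 := D.continuous_deriv_normal
    have h3 := D.continuous_normal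
    have h4 := D.continuous_curve
    have h5 : Continuous fun p : J × ℝ => D.curve p.2 + ((p.1 : ℝ) : ℂ) * D.normal p.2 := by fun_prop
    have h6 : Continuous fun p : J × ℝ => deriv k (D.curve p.2 + ((p.1 : ℝ) : ℂ) * D.normal p.2) := by
      rw [← continuousOn_univ]
      exact (hk.deriv hU).continuousOn.comp (t := U) (by fun_prop) fun p _ => hh p.1 p.1.2 p.2
    have h7 : Continuous fun p : J × ℝ => k (D.curve p.2 + ((p.1 : ℝ) : ℂ) * D.normal p.2) := by
      rw [← continuousOn_univ]
      exact hk.continuousOn.comp (t := U) (by fun_prop) fun p _ => hh p.1 p.1.2 p.2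
    refine Continuous.div ?_ h7 fun p => h0 p.1 p.1.2 p.2
    fun_prop
  · rw [offsetIntegral, exp_offsetIntegral hU hk (hh h hh') (h0 h hh'), offset_one,
      div_self (h0 h hh' 0)]

/-- On a simply connected hole a function without zeros has a continuous logarithm. Its increment
along the curve and the argument integral have the same exponential and agree at the start, so they
agree throughout; the increment over a closed curve is zero. -/
theorem offsetIntegral_eq_zero_of_mem_carrier (hU : IsOpen U) (hk : DifferentiableOn ℂ k U)
    (hDU : D.carrier ⊆ U) (h0 : ∀ z ∈ D.carrier, k z ≠ 0) {h : ℝ}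
    (hh : ∀ t, D.curve t + h * D.normal t ∈ D.carrier) : D.offsetIntegral k h = 0 := by
  obtain ⟨L, hL, hexp⟩ := Complex.exists_continuousOn_eqOn_exp_comp D.isSimplyConnected_carrier
    D.isOpen_carrier (hk.continuousOn.mono hDU) (by rintro ⟨z, hz, h⟩; exact h0 z hz h)
  have hcΓ : Continuous fun t => D.curve t + h * D.normal t := by
    have h3 := D.continuous_normal
    have h4 := D.continuous_curve
    fun_prop
  have hcL : Continuous fun t => L (D.curve t + h * D.normal t) := by
    rw [← continuousOn_univ]
    exact hL.comp hcΓ.continuousOn fun t _ => hh t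
  have hcI : Continuous fun t => ∫ t in (0 : ℝ)..t, (deriv D.curve t + h * deriv D.normal t) *
      deriv k (D.curve t + h * D.normal t) / k (D.curve t + h * D.normal t) := by
    refine intervalIntegral.continuous_primitive (fun a b => Continuous.intervalIntegrable ?_ _ _) 0
    have h1 := D.continuous_deriv_curve
    have h2 := D.continuous_deriv_normal
    have h5 : Continuous fun t => deriv k (D.curve t + h * D.normal t) := by
      rw [← continuousOn_univ]
      exact (hk.deriv hU).continuousOn.comp (t := U) hcΓ.continuousOn fun t _ => hDU (hh t)
    have h6 : Continuous fun t => k (D.curve t + h * D.normal t) := by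
      rw [← continuousOn_univ]
      exact hk.continuousOn.comp (t := U) hcΓ.continuousOn fun t _ => hDU (hh t)
    exact Continuous.div (by fun_prop) h6 fun t => h0 _ (hh t)
  have key := eq_of_exp_eq_one_of_isPreconnected (isPreconnected_univ (α := ℝ))
    (n := fun t => (∫ t in (0 : ℝ)..t, (deriv D.curve t + h * deriv D.normal t) *
      deriv k (D.curve t + h * D.normal t) / k (D.curve t + h * D.normal t)) -
      (L (D.curve t + h * D.normal t) - L (D.curve 0 + h * D.normal 0)))
    (hcI.sub (hcL.sub continuous_const)).continuousOn
    (fun t _ => by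
      have e1 := hexp (hh t)
      have e2 := hexp (hh 0)
      simp only [Function.comp_apply] at e1 e2
      rw [Complex.exp_sub, Complex.exp_sub, e1, e2,
        exp_offsetIntegral hU hk (fun t => hDU (hh t)) (fun t => h0 _ (hh t))]
      exact div_self (div_ne_zero (h0 _ (hh t)) (h0 _ (hh 0)))) (mem_univ 1) (mem_univ 0)
  simp only [offset_one, intervalIntegral.integral_same, sub_self, sub_zero] at key
  exact key

/-! ### The winding number of the boundary curve -/

theorem cauchy_one (z : ℂ) : D.cauchy 1 z = ∫ t in (0 : ℝ)..1, deriv D.curve t / (D.curve t - z) := by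
  simp [cauchy]

theorem isOpen_compl_range_curve : IsOpen (range D.curve)ᶜ := by
  rw [D.range_curve]
  exact isClosed_frontier.isOpen_compl

theorem hasDerivAt_cauchy {f : ℝ → ℝ} (hf : Continuous f) {z : ℂ} (hz : z ∉ range D.curve) :
    HasDerivAt (D.cauchy f)
      (∫ t in (0 : ℝ)..1, (f t : ℂ) * (deriv D.curve t / (D.curve t - z) ^ 2)) z := by
  have h1 := D.continuous_curve
  have h2 := D.continuous_deriv_curve
  have hne : ∀ z ∈ (range D.curve)ᶜ, ∀ t, D.curve t - z ≠ 0 := fun _ hz t => by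
    rw [sub_ne_zero]
    exact fun h => hz ⟨t, h⟩
  refine hasDerivAt_intervalIntegral_of_continuousOn (U := (range D.curve)ᶜ)
    isOpen_compl_range_curve (Φ := fun z t => (f t : ℂ) * (deriv D.curve t / (D.curve t - z)))
    (Φ' := fun z t => (f t : ℂ) * (deriv D.curve t / (D.curve t - z) ^ 2)) (fun z hz t => ?_)
    (fun z hz => continuous_cauchy_integrand hf fun t h => hz ⟨t, h.symm⟩) ?_ hz
  · have := (((hasDerivAt_id z).const_sub (D.curve t)).fun_inv (hne z hz t)).const_mul
      ((f t : ℂ) * deriv D.curve t)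
    convert! this using 1
    · funext w; simp [div_eq_mul_inv, mul_assoc]
    · simp [div_eq_mul_inv, mul_assoc]
  · refine ContinuousOn.mul (by fun_prop) (ContinuousOn.div (by fun_prop) (by fun_prop) ?_)
    exact fun p hp => pow_ne_zero _ (hne p.1 hp.1 p.2)

theorem exp_cauchy_one {z : ℂ} (hz : z ∉ range D.curve) : Complex.exp (D.cauchy 1 z) = 1 := by
  rw [cauchy_one, exp_integral_deriv_div (φ := fun t => D.curve t - z)
    (fun t => (D.hasDerivAt_curve t).sub_const z) D.continuous_deriv_curve
    (fun t => sub_ne_zero.2 fun h => hz ⟨t, h⟩)]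
  have h1 := D.periodic_curve 0
  rw [zero_add] at h1
  rw [h1, div_self (sub_ne_zero.2 fun h => hz ⟨0, h⟩)]

theorem continuousOn_cauchy_one : ContinuousOn (D.cauchy 1) (range D.curve)ᶜ := fun _ hz =>
  (hasDerivAt_cauchy (D := D) (f := 1) continuous_one hz).continuousAt.continuousWithinAt

theorem cauchy_one_eq_of_isPreconnected {S : Set ℂ} (hS : IsPreconnected S)
    (hSD : S ⊆ (range D.curve)ᶜ) {z w : ℂ} (hz : z ∈ S) (hw : w ∈ S) :
    D.cauchy 1 z = D.cauchy 1 w :=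
  eq_of_exp_eq_one_of_isPreconnected hS (continuousOn_cauchy_one.mono hSD)
    (fun _ hz => exp_cauchy_one (hSD hz)) hz hw

theorem tendsto_cauchy_one_atTop : Tendsto (fun n : ℕ => D.cauchy 1 n) atTop (𝓝 0) := by
  obtain ⟨R, hR, hγ⟩ := D.periodic_curve.exists_norm_le D.continuous_curve
  obtain ⟨A, hA, hdA⟩ := D.exists_norm_deriv_le
  have hbig : ∀ᶠ n : ℕ in atTop, ∀ t, (n : ℝ) - R ≤ ‖D.curve t - n‖ := .of_forall fun n t => by
    have := norm_sub_norm_le (n : ℂ) (D.curve t)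
    rw [norm_sub_rev, Complex.norm_natCast] at this
    linarith [hγ t]
  have hlim : Tendsto (fun n : ℕ => A / ((n : ℝ) - R)) atTop (𝓝 0) :=
    tendsto_const_nhds.div_atTop (tendsto_atTop_add_const_right _ _ tendsto_natCast_atTop_atTop)
  refine squeeze_zero_norm' ?_ hlim
  filter_upwards [hbig, (tendsto_natCast_atTop_atTop (R := ℝ)).eventually_gt_atTop R] with n hn hnR
  rw [cauchy_one]
  have := intervalIntegral.norm_integral_le_of_norm_le_const (a := 0) (b := 1)
    (f := fun t => deriv D.curve t / (D.curve t - n)) (C := A / (n - R)) fun t _ => by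
      rw [norm_div]
      have h1 : 0 < (n : ℝ) - R := by linarith
      exact div_le_div₀ hA.le (hdA t) h1 (hn t)
  simpa using this

/-- Connectedness of the exterior is not presupposed. The closed hole together with the exterior
points that share the value on the outer strip is an open and closed set: near a boundary point, all
exterior points lie in the connected strip. So the value is the same on the whole exterior, and it
tends to 0 at infinity. -/
theorem cauchy_one_eq_zero {z : ℂ} (hz : z ∉ closure D.carrier) : D.cauchy 1 z = 0 := by
  obtain ⟨h₀, hh₀, hcol⟩ := D.exists_collar
  have hsub : (closure D.carrier)ᶜ ⊆ (range D.curve)ᶜ := by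
    rw [D.range_curve]
    exact compl_subset_compl.2 frontier_subset_closure
  have hcont : Continuous fun p : ℝ × ℝ => D.curve p.1 - p.2 * D.normal p.1 := by
    have := D.continuous_curve
    have := D.continuous_normal
    fun_prop
  set S := (fun p : ℝ × ℝ => D.curve p.1 - p.2 * D.normal p.1) '' (univ ×ˢ Ioc 0 h₀) with hS
  have hSconn : IsPreconnected S :=
    (isPreconnected_univ.prod isPreconnected_Ioc).image _ hcont.continuousOn
  have hSsub : S ⊆ (closure D.carrier)ᶜ := by
    rintro _ ⟨⟨s, h⟩, ⟨-, h1, h2⟩, rfl⟩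
    exact (hcol s h h1 h2).2
  set w₀ := D.curve 0 - h₀ * D.normal 0
  have hw₀ : w₀ ∈ S := ⟨(0, h₀), ⟨mem_univ _, hh₀, le_rfl⟩, rfl⟩
  have hloc : ∀ w ∉ closure D.carrier, ∀ᶠ w' in 𝓝 w, w' ∉ closure D.carrier ∧
      D.cauchy 1 w' = D.cauchy 1 w := fun w hw => by
    obtain ⟨ε, hε, hball⟩ := Metric.isOpen_iff.1 isClosed_closure.isOpen_compl w hw
    filter_upwards [Metric.ball_mem_nhds w hε] with w' hw'
    exact ⟨hball hw', cauchy_one_eq_of_isPreconnected (convex_ball w ε).isPreconnected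
      (hball.trans hsub) hw' (Metric.mem_ball_self hε)⟩
  set V := {w | w ∈ closure D.carrier ∨ D.cauchy 1 w = D.cauchy 1 w₀} with hV
  have hVo : IsOpen V := by
    rw [isOpen_iff_eventually]
    intro w hw
    by_cases hwc : w ∈ closure D.carrier
    swap
    · have hw' := hw.resolve_left hwc
      filter_upwards [hloc w hwc] with w' h
      exact Or.inr (h.2.trans hw')
    by_cases hwD : w ∈ D.carrier
    · filter_upwards [D.isOpen_carrier.mem_nhds hwD] with w' h
      exact Or.inl (subset_closure h)
    have : w ∈ frontier D.carrier := by
      rw [D.isOpen_carrier.frontier_eq]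
      exact ⟨hwc, hwD⟩
    rw [← D.range_curve] at this
    obtain ⟨t, rfl⟩ := this
    filter_upwards [Metric.ball_mem_nhds (D.curve t) hh₀] with w' hw'
    obtain ⟨s, h, rfl, hle⟩ := D.exists_eq_curve_add_normal w'
    have hlt : |h| < h₀ := (hle t).trans_lt (by simpa [dist_eq_norm] using hw')
    rw [abs_lt] at hlt
    rcases lt_trichotomy h 0 with h1 | rfl | h1
    · refine Or.inr (cauchy_one_eq_of_isPreconnected hSconn (hSsub.trans hsub)
        ⟨(s, -h), ⟨mem_univ _, by linarith, by linarith⟩, by simp⟩ hw₀)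
    · exact Or.inl (by simpa using D.curve_mem_closure s)
    · exact Or.inl (subset_closure (hcol s h h1 hlt.2.le).1)
  have hVc : IsClosed V := by
    rw [← isOpen_compl_iff, isOpen_iff_eventually]
    intro w hw
    simp only [hV, mem_compl_iff, mem_ofPred_eq, not_or] at hw
    filter_upwards [hloc w hw.1] with w' h
    simp only [hV, mem_compl_iff, mem_ofPred_eq, not_or, h.2]
    exact ⟨h.1, hw.2⟩
  have huniv : V = univ := IsClopen.eq_univ ⟨hVc, hVo⟩ ⟨w₀, Or.inr rfl⟩
  have hall : ∀ w ∉ closure D.carrier, D.cauchy 1 w = D.cauchy 1 w₀ := fun w hw =>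
    (huniv ▸ mem_univ w : w ∈ V).resolve_left hw
  obtain ⟨R, hR⟩ := D.isCompact_closure.isBounded.exists_norm_le
  have h0 : D.cauchy 1 w₀ = 0 := by
    refine tendsto_nhds_unique ?_ (tendsto_cauchy_one_atTop (D := D))
    refine tendsto_const_nhds.congr' ?_
    filter_upwards [(tendsto_natCast_atTop_atTop (R := ℝ)).eventually_gt_atTop R] with n hn
    refine (hall n fun h => ?_).symm
    have := hR n h
    rw [Complex.norm_natCast] at this
    linarith
  rw [hall z hz, h0]

/-- The value outside is 0, so the value inside equals the jump for the density 1. -/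
theorem cauchy_one_eq {z : ℂ} (hz : z ∈ D.carrier) :
    D.cauchy 1 z = -(2 * Real.pi * Complex.I) := by
  obtain ⟨h₀, hh₀, hcol⟩ := D.exists_collar
  have hsub : D.carrier ⊆ (range D.curve)ᶜ := by
    rw [D.range_curve, D.isOpen_carrier.frontier_eq]
    exact fun w hw h => h.2 hw
  have hlim := (tendsto_cauchy_sub (D := D) (f := 1) continuous_one (fun _ => rfl) 0).comp
    (Filter.Tendsto.prodMk (f := 𝓝[>] (0 : ℝ)) (tendsto_const_nhds (x := (0 : ℝ))) tendsto_id)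
  simp only [Pi.one_apply, Complex.ofReal_one, mul_one] at hlim
  refine tendsto_nhds_unique (f := fun _ : ℝ => D.cauchy 1 z) (l := 𝓝[>] (0 : ℝ))
    tendsto_const_nhds (hlim.congr' ?_)
  filter_upwards [Ioc_mem_nhdsGT hh₀] with h hh
  obtain ⟨h1, h2⟩ := hcol 0 h hh.1 hh.2
  simp only [Function.comp_apply, id]
  rw [cauchy_one_eq_zero h2, sub_zero]
  exact cauchy_one_eq_of_isPreconnected D.isSimplyConnected_carrier.isPathConnected.isConnected.isPreconnected
    hsub h1 hz

end C2Hole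

/-! ### The area of a hole -/

theorem integrableOn_polarCoord {f : ℂ → ℂ} (hf : Integrable f) (hm : Measurable f) :
    IntegrableOn (fun p : ℝ × ℝ => p.1 • f (Complex.polarCoord.symm p)) polarCoord.target := by
  have hc : Continuous fun p : ℝ × ℝ => Complex.polarCoord.symm p := by
    simp only [Complex.polarCoord_symm_apply]
    fun_prop
  refine ⟨(measurable_fst.smul (hm.comp hc.measurable)).aestronglyMeasurable, ?_⟩
  have h1 := hf.hasFiniteIntegral
  rw [HasFiniteIntegral, ← Complex.lintegral_comp_polarCoord_symm] at h1
  refine (lintegral_congr_ae ?_).trans_lt h1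
  filter_upwards [ae_restrict_mem polarCoord.open_target.measurableSet] with p hp
  have : 0 < p.1 := hp.1
  rw [enorm_smul, Real.enorm_of_nonneg this.le, smul_eq_mul]

theorem integrableOn_inv_sub (R : ℝ) (ξ : ℂ) :
    IntegrableOn (fun w : ℂ => (ξ - w)⁻¹) (Metric.ball 0 R) := by
  have h1 : LocallyIntegrable (fun w : ℂ => w⁻¹) :=
    locallyIntegrable_of_norm_le_rpow (C := 1) (α := 1) (by simp) (by simp)
      (Eventually.of_forall fun w => by simp [Real.rpow_neg_one]) measurable_inv.aestronglyMeasurable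
  have h2 := h1.integrableOn_isCompact (isCompact_closedBall ξ R)
  have h3 : IntegrableOn (fun w : ℂ => (ξ - w)⁻¹) ((fun w => ξ - w) ⁻¹' Metric.closedBall ξ R) :=
    ((Measure.measurePreserving_sub_left (volume : Measure ℂ) ξ).integrableOn_comp_preimage
      (MeasurableEquiv.subLeft ξ).measurableEmbedding).2 h2
  refine h3.mono_set fun w hw => ?_
  simp only [mem_preimage, Metric.mem_closedBall, dist_eq_norm]
  rw [Metric.mem_ball, dist_zero_right] at hw
  simpa using hw.le

theorem integral_inv_sub_circle {ξ : ℂ} (h0 : ξ ≠ 0) {r : ℝ} (hr : 0 < r) (hne : r ≠ ‖ξ‖) :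
    ∫ θ in (-Real.pi)..Real.pi, (ξ - circleMap 0 r θ)⁻¹ =
      if r < ‖ξ‖ then 2 * Real.pi / ξ else 0 := by
  have hper : Function.Periodic (fun θ => (ξ - circleMap 0 r θ)⁻¹) (2 * Real.pi) := fun θ => by
    simp only [periodic_circleMap 0 r θ]
  have e1 := hper.intervalIntegral_add_eq (-Real.pi) 0
  rw [show -Real.pi + 2 * Real.pi = Real.pi by ring, zero_add] at e1
  have hξ : ∀ θ, ξ - circleMap 0 r θ ≠ 0 := fun θ h => hne (by
    rw [sub_eq_zero.1 h]; simp [abs_of_pos hr])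
  -- With dw = iw dθ, the partial fractions 1/w - 1/(w - ξ) become iξ/(ξ - w) dθ.
  have e2 : (∮ w in C(0, r), (w - 0)⁻¹ - (w - ξ)⁻¹) =
      (Complex.I * ξ) * ∫ θ in (0 : ℝ)..2 * Real.pi, (ξ - circleMap 0 r θ)⁻¹ := by
    rw [circleIntegral, ← intervalIntegral.integral_const_mul]
    refine intervalIntegral.integral_congr fun θ _ => ?_
    have h1 := hξ θ
    have h2 : circleMap 0 r θ ≠ 0 := circleMap_ne_center hr.ne'
    have h3 : circleMap 0 r θ - ξ ≠ 0 := fun h => h1 (by linear_combination -h)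
    simp only [deriv_circleMap, smul_eq_mul, sub_zero]
    field_simp
    ring
  have hi1 : CircleIntegrable (fun w : ℂ => (w - 0)⁻¹) 0 r := by
    rw [circleIntegrable_sub_inv_iff]
    right; simp [abs_of_pos hr, hr.ne]
  have hi2 : CircleIntegrable (fun w : ℂ => (w - ξ)⁻¹) 0 r := by
    rw [circleIntegrable_sub_inv_iff]
    right; simpa [abs_of_pos hr] using hne.symm
  rw [circleIntegral.integral_sub hi1 hi2, circleIntegral.integral_sub_inv_of_mem_ball
    (Metric.mem_ball_self hr)] at e2
  rw [e1]
  have hI : Complex.I * ξ ≠ 0 := mul_ne_zero Complex.I_ne_zero h0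
  refine mul_left_cancel₀ hI ?_
  rw [← e2]
  split_ifs with h
  · have : (∮ w in C(0, r), (w - ξ)⁻¹) = 0 := by
      refine Complex.circleIntegral_eq_zero_of_differentiable_on_off_countable hr.le countable_empty
        ?_ ?_
      · refine ContinuousOn.inv₀ (by fun_prop) fun w hw h' => ?_
        rw [sub_eq_zero.1 h', mem_closedBall_zero_iff] at hw
        linarith
      · rintro w ⟨hw, -⟩
        refine DifferentiableAt.inv (by fun_prop) fun h' => ?_
        rw [sub_eq_zero.1 h', mem_ball_zero_iff] at hw
        linarith
    rw [this]
    field_simp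
    ring
  · rw [circleIntegral.integral_sub_inv_of_mem_ball]
    · simp
    · rw [mem_ball_zero_iff]
      exact lt_of_le_of_ne (not_lt.1 h) hne.symm

/-- The integral over the angle is 2π/ξ for radii below |ξ| and 0 beyond, so the total is
(2π/ξ)·|ξ|²/2. The formula expresses the conjugate of ξ by Cauchy kernels, which gives access to the
enclosed area. -/
theorem integral_ball_inv_sub {R : ℝ} {ξ : ℂ} (h0 : ξ ≠ 0) (hR : ‖ξ‖ < R) :
    ∫ w in Metric.ball 0 R, (ξ - w)⁻¹ = Real.pi * (starRingEnd ℂ) ξ := by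
  set f : ℂ → ℂ := (Metric.ball 0 R).indicator fun w => (ξ - w)⁻¹ with hf
  have hfi : Integrable f :=
    (integrable_indicator_iff Metric.isOpen_ball.measurableSet).2 (integrableOn_inv_sub R ξ)
  have hfm : Measurable f :=
    (measurable_const.sub measurable_id).inv.indicator Metric.isOpen_ball.measurableSet
  rw [← integral_indicator Metric.isOpen_ball.measurableSet, ← Complex.integral_comp_polarCoord_symm]
  have hpi := integrableOn_polarCoord hfi hfm
  change ∫ p in Ioi (0 : ℝ) ×ˢ Ioo (-Real.pi) Real.pi, p.1 • f (Complex.polarCoord.symm p) = _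
  rw [Measure.volume_eq_prod, setIntegral_prod _ hpi]
  have hinner : ∀ᵐ r : ℝ, r ∈ Ioi (0 : ℝ) →
      (∫ θ in Ioo (-Real.pi) Real.pi, r • f (Complex.polarCoord.symm (r, θ))) =
      (Ioo 0 ‖ξ‖).indicator (fun r : ℝ => (r : ℂ) * (2 * Real.pi / ξ)) r := by
    have hae : ∀ᵐ r : ℝ, r ≠ ‖ξ‖ := by simp [ae_iff]
    filter_upwards [hae] with r hne hr
    have hr : 0 < r := hr
    have hval : ∀ θ, Complex.polarCoord.symm (r, θ) = circleMap 0 r θ := fun θ => by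
      rw [Complex.polarCoord_symm_apply]
      simp [circleMap, Complex.exp_mul_I]
    have hmem : ∀ θ, (circleMap 0 r θ ∈ Metric.ball (0 : ℂ) R) ↔ r < R := fun θ => by
      simp [abs_of_pos hr]
    rw [integral_smul, ← integral_Ioc_eq_integral_Ioo,
      ← intervalIntegral.integral_of_le (by linarith [Real.pi_pos])]
    by_cases hrR : r < R
    · have : ∀ θ, f (Complex.polarCoord.symm (r, θ)) = (ξ - circleMap 0 r θ)⁻¹ := fun θ => by
        rw [hval, hf, indicator_of_mem ((hmem θ).2 hrR)]
      simp only [this, integral_inv_sub_circle h0 hr hne]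
      by_cases h : r < ‖ξ‖
      · rw [if_pos h, indicator_of_mem (show r ∈ Ioo 0 ‖ξ‖ from ⟨hr, h⟩), Complex.real_smul]
      · rw [if_neg h, indicator_of_notMem (fun h' : r ∈ Ioo 0 ‖ξ‖ => h h'.2), smul_zero]
    · have : ∀ θ, f (Complex.polarCoord.symm (r, θ)) = 0 := fun θ => by
        rw [hval, hf, indicator_of_notMem (fun h => hrR ((hmem θ).1 h))]
      rw [indicator_of_notMem (fun h' : r ∈ Ioo 0 ‖ξ‖ => hrR (h'.2.trans hR))]
      simp only [this, intervalIntegral.integral_zero, smul_zero]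
  rw [setIntegral_congr_ae measurableSet_Ioi hinner, setIntegral_indicator measurableSet_Ioo,
    inter_eq_right.2 Ioo_subset_Ioi_self, ← integral_Ioc_eq_integral_Ioo,
    ← intervalIntegral.integral_of_le (norm_nonneg _), intervalIntegral.integral_mul_const,
    intervalIntegral.integral_ofReal, integral_id]
  have : (‖ξ‖ : ℂ) ^ 2 = ξ * (starRingEnd ℂ) ξ := by rw [Complex.mul_conj, ← Complex.ofReal_pow,
    Complex.normSq_eq_norm_sq]
  push_cast
  field_simp
  linear_combination this

/-! ### The area as an integral of winding numbers -/

namespace C2Hole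

variable {D : C2Hole}

/-- The curve is the image of the plane under a map that depends on the real part alone, and the
derivative of this map is singular everywhere. -/
theorem volume_range_curve : volume (range D.curve) = 0 := by
  have h : range D.curve = (fun z : ℂ => D.curve z.re) '' univ := by
    ext w
    constructor
    · rintro ⟨t, rfl⟩
      exact ⟨t, mem_univ _, by simp⟩
    · rintro ⟨z, -, rfl⟩
      exact ⟨z.re, rfl⟩
  rw [h]
  refine addHaar_image_eq_zero_of_det_fderivWithin_eq_zero volume
    (f' := fun z => (ContinuousLinearMap.toSpanSingleton ℝ (deriv D.curve z.re)).comp Complex.reCLM)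
    (fun z _ => ?_) fun z _ => ?_
  · exact ((D.hasDerivAt_curve z.re).hasFDerivAt.comp z
      Complex.reCLM.hasFDerivAt).hasFDerivWithinAt
  · by_contra hdet
    have hinj := (LinearMap.equivOfDetNeZero _ hdet).injective
    have h1 : Complex.I = 0 := hinj (by simp [LinearMap.equivOfDetNeZero])
    exact Complex.I_ne_zero h1

theorem exists_norm_curve_sub_le (D : C2Hole) (w₀ : ℂ) : ∃ C > 0, ∀ t, ‖D.curve t - w₀‖ ≤ C := by
  have hp : Function.Periodic (fun t => D.curve t - w₀) 1 := fun t => by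
    simp only [D.periodic_curve t]
  exact hp.exists_norm_le (D.continuous_curve.sub continuous_const)

/-- This is the hypothesis of Fubini's theorem: 1/|ξ - w| is integrable over discs in w, uniformly
for ξ on the curve. -/
theorem integrable_cauchy_kernel (w₀ : ℂ) (R : ℝ) :
    Integrable (fun p : ℂ × ℝ => deriv D.curve p.2 / (D.curve p.2 - w₀ - p.1))
      ((volume.restrict (Metric.ball 0 R)).prod (volume.restrict (Ioc 0 1))) := by
  have hm : Measurable fun p : ℂ × ℝ => deriv D.curve p.2 / (D.curve p.2 - w₀ - p.1) := by
    have h1 := D.continuous_curve.measurable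
    have h2 := D.continuous_deriv_curve.measurable
    fun_prop
  obtain ⟨A, hA, hdA⟩ := D.exists_norm_deriv_le
  obtain ⟨B, hB, hγ⟩ := D.exists_norm_curve_sub_le w₀
  rw [integrable_prod_iff' hm.aestronglyMeasurable]
  refine ⟨.of_forall fun t => ?_, ?_⟩
  · simp only [div_eq_mul_inv]
    exact (integrableOn_inv_sub R (D.curve t - w₀)).const_mul _
  · have hms : AEStronglyMeasurable (fun t => ∫ w in Metric.ball (0 : ℂ) R,
        ‖deriv D.curve t / (D.curve t - w₀ - w)‖) (volume.restrict (Ioc (0 : ℝ) 1)) :=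
      (hm.norm.comp measurable_swap).aestronglyMeasurable.integral_prod_right'
    refine Integrable.mono' (g := fun _ => A * ∫ w in Metric.ball (0 : ℂ) (R + B), ‖(0 - w)⁻¹‖)
      (integrable_const _) hms (.of_forall fun t => ?_)
    rw [Real.norm_of_nonneg (integral_nonneg fun w => norm_nonneg _)]
    simp only [div_eq_mul_inv, norm_mul]
    rw [integral_const_mul]
    refine mul_le_mul (hdA t) ?_ (integral_nonneg fun w => norm_nonneg _) hA.le
    have h1 := (measurePreserving_sub_right (volume : Measure ℂ)
      (D.curve t - w₀)).setIntegral_preimage_emb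
      (MeasurableEquiv.subRight (D.curve t - w₀)).measurableEmbedding (fun w => ‖(0 - w)⁻¹‖)
      (Metric.ball 0 (R + B))
    rw [← h1]
    have h2 : IntegrableOn (fun w => ‖(0 - (w - (D.curve t - w₀)))⁻¹‖)
        ((fun w => w - (D.curve t - w₀)) ⁻¹' Metric.ball 0 (R + B)) :=
      ((measurePreserving_sub_right (volume : Measure ℂ)
        (D.curve t - w₀)).integrableOn_comp_preimage
        (MeasurableEquiv.subRight (D.curve t - w₀)).measurableEmbedding).2
        (integrableOn_inv_sub (R + B) 0).norm
    simp only [zero_sub, neg_sub] at h2 ⊢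
    refine setIntegral_mono_set h2 (.of_forall fun w => norm_nonneg _)
      (LE.le.eventuallyLE fun w hw => ?_)
    rw [mem_ball_zero_iff] at hw
    rw [mem_preimage, mem_ball_zero_iff]
    linarith [norm_sub_le w (D.curve t - w₀), hγ t]

/-- After translation by w₀, write the conjugate as a Cauchy transform of a disc and exchange the
integrals. The inner integral becomes the winding integral, which is -2πi on the hole and 0 off its
closure. So the result is -2πi times the area of a nonempty open set, and no form of Green's theorem
is used. -/
theorem integral_conj_mul_deriv_ne_zero {w₀ : ℂ} (hw₀ : w₀ ∈ D.carrier) :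
    ∫ t in (0 : ℝ)..1, (starRingEnd ℂ) (D.curve t - w₀) * deriv D.curve t ≠ 0 := by
  obtain ⟨B, hB, hγ⟩ := D.exists_norm_curve_sub_le w₀
  set R := B + 1
  have hne : ∀ t, D.curve t - w₀ ≠ 0 := fun t h =>
    D.curve_notMem_carrier t (sub_eq_zero.1 h ▸ hw₀)
  have hswap := integral_integral_swap
    (f := fun w t => deriv D.curve t / (D.curve t - w₀ - w)) (D.integrable_cauchy_kernel w₀ R)
  have h1 : ∀ t, ∫ w in Metric.ball (0 : ℂ) R, deriv D.curve t / (D.curve t - w₀ - w) =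
      Real.pi * ((starRingEnd ℂ) (D.curve t - w₀) * deriv D.curve t) := fun t => by
    simp only [div_eq_mul_inv]
    rw [integral_const_mul, integral_ball_inv_sub (hne t) (by linarith [hγ t])]
    ring
  set S : Set ℂ := (fun w => w + w₀) ⁻¹' D.carrier
  have hS : IsOpen S := D.isOpen_carrier.preimage (by fun_prop)
  have h2 : ∀ᵐ w : ℂ, (∫ t in Ioc (0 : ℝ) 1, deriv D.curve t / (D.curve t - w₀ - w)) =
      S.indicator (fun _ => -(2 * Real.pi * Complex.I)) w := by
    have hnull : volume ((fun w : ℂ => w + w₀) ⁻¹' range D.curve) = 0 := by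
      rw [measure_preimage_add_right, volume_range_curve]
    filter_upwards [compl_mem_ae_iff.2 hnull] with w hw
    have e : (∫ t in Ioc (0 : ℝ) 1, deriv D.curve t / (D.curve t - w₀ - w)) =
        D.cauchy 1 (w + w₀) := by
      rw [cauchy_one, intervalIntegral.integral_of_le zero_le_one]
      simp only [sub_sub, add_comm]
    rw [e]
    by_cases hwS : w ∈ S
    · rw [indicator_of_mem hwS, cauchy_one_eq hwS]
    · rw [indicator_of_notMem hwS, cauchy_one_eq_zero]
      intro hcl
      refine hw ?_
      rw [mem_preimage, D.range_curve, D.isOpen_carrier.frontier_eq]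
      exact ⟨hcl, hwS⟩
  simp only [h1] at hswap
  rw [integral_congr_ae (ae_restrict_of_ae h2), setIntegral_indicator hS.measurableSet,
    setIntegral_const, integral_const_mul, ← intervalIntegral.integral_of_le zero_le_one] at hswap
  intro h0
  rw [h0, mul_zero, smul_eq_zero] at hswap
  have hvol : volume.real (Metric.ball (0 : ℂ) R ∩ S) ≠ 0 := by
    rw [Measure.real, ENNReal.toReal_ne_zero]
    refine ⟨((Metric.isOpen_ball.inter hS).measure_pos volume
      ⟨0, Metric.mem_ball_self (by positivity), by simpa [S] using hw₀⟩).ne', ?_⟩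
    exact ((measure_mono inter_subset_left).trans_lt measure_ball_lt_top).ne
  refine hswap.elim hvol fun h => ?_
  exact Complex.two_pi_I_ne_zero (neg_eq_zero.1 h)

/-- The area enclosed by the boundary curve does not vanish. -/
theorem integral_im_mul_re_deriv_ne_zero (hD : D.carrier.Nonempty) :
    ∫ t in (0 : ℝ)..1, (D.curve t).im * (deriv D.curve t).re ≠ 0 := by
  obtain ⟨w₀, hw₀⟩ := hD
  intro h0
  refine integral_conj_mul_deriv_ne_zero hw₀ ?_
  have hc := D.continuous_curve
  have hc' := D.continuous_deriv_curve
  have hre : ∀ t, HasDerivAt (fun t => (D.curve t).re) (deriv D.curve t).re t := fun t =>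
    Complex.reCLM.hasFDerivAt.comp_hasDerivAt t (D.hasDerivAt_curve t)
  have him : ∀ t, HasDerivAt (fun t => (D.curve t).im) (deriv D.curve t).im t := fun t =>
    Complex.imCLM.hasFDerivAt.comp_hasDerivAt t (D.hasDerivAt_curve t)
  -- With γ = x + iy, the form γ̄ dγ + 2iy dx is the differential of (x² + y²)/2 + ixy. So the two
  -- integrals over the closed curve differ by the factor -2i.
  have hP : ∀ t, HasDerivAt (fun t => ((((D.curve t).re ^ 2 + (D.curve t).im ^ 2) / 2 : ℝ) : ℂ) +
      Complex.I * (((D.curve t).re * (D.curve t).im : ℝ) : ℂ) -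
      (starRingEnd ℂ) w₀ * D.curve t)
      ((starRingEnd ℂ) (D.curve t - w₀) * deriv D.curve t +
        (2 * Complex.I) * (((D.curve t).im * (deriv D.curve t).re : ℝ) : ℂ)) t := fun t => by
    have h1 := (((((hre t).fun_pow 2).add ((him t).fun_pow 2)).div_const 2).ofReal_comp).add
      ((((hre t).mul (him t)).ofReal_comp).const_mul Complex.I)
    convert! h1.sub ((D.hasDerivAt_curve t).const_mul ((starRingEnd ℂ) w₀)) using 1
    apply Complex.ext <;> simp <;> ring
  have hint := intervalIntegral.integral_eq_sub_of_hasDerivAt (a := 0) (b := 1) (fun t _ => hP t)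
    (Continuous.intervalIntegrable (by fun_prop) _ _)
  have hper := D.periodic_curve 0
  rw [zero_add] at hper
  rw [hper, sub_self, intervalIntegral.integral_add
    (Continuous.intervalIntegrable (by fun_prop) _ _)
    (Continuous.intervalIntegrable (by fun_prop) _ _), intervalIntegral.integral_const_mul,
    intervalIntegral.integral_ofReal, h0] at hint
  simpa using hint

end C2Hole

/-! ### The maximum principle -/

open InnerProductSpace in
-- Locally W = Re F with F holomorphic, and |exp F| = exp W obeys the maximum modulus principle.
theorem eventually_eq_of_isLocalMax_of_harmonicAt {W : ℂ → ℝ} {z : ℂ} (hW : HarmonicAt W z)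
    (hmax : IsLocalMax W z) : ∀ᶠ w in 𝓝 z, W w = W z := by
  obtain ⟨r, hr, hball⟩ := Metric.eventually_nhds_iff_ball.1 hW.eventually
  obtain ⟨F, hF, hFW⟩ := HarmonicOnNhd.exists_analyticOnNhd_ball_re_eq (f := W) (z := z) (R := r)
    hball
  have hz := Metric.mem_ball_self (x := z) hr
  have hnorm : ∀ w ∈ Metric.ball z r, ‖Complex.exp (F w)‖ = Real.exp (W w) := fun w hw => by
    rw [Complex.norm_exp]
    exact congrArg _ (hFW hw)
  have hd : ∀ᶠ w in 𝓝 z, DifferentiableAt ℂ (fun w => Complex.exp (F w)) w := by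
    filter_upwards [Metric.ball_mem_nhds z hr] with w hw
    exact (hF w hw).differentiableAt.cexp
  have hm : IsLocalMax (norm ∘ fun w => Complex.exp (F w)) z := by
    filter_upwards [Metric.ball_mem_nhds z hr, hmax] with w hw hle
    simp only [Function.comp_apply, hnorm w hw, hnorm z hz]
    exact Real.exp_le_exp.2 hle
  filter_upwards [Metric.ball_mem_nhds z hr, Complex.eventually_eq_of_isLocalMax_norm hd hm]
    with w hw h
  have := congrArg norm h
  rwa [hnorm w hw, hnorm z hz, Real.exp_eq_exp] at this

open InnerProductSpace in
-- This form suits functions extended by zero. The compact set represents all values, so the maximum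
-- is attained. If it were positive, the set where it is attained would be open and closed, hence
-- the whole plane, but W has a zero.
theorem nonpos_of_harmonicAt_of_ne_zero {W : ℂ → ℝ} (hc : Continuous W)
    (hW : ∀ z, W z ≠ 0 → HarmonicAt W z) (h0 : ∃ z, W z = 0) {K : Set ℂ} (hK : IsCompact K)
    (hval : ∀ z, ∃ w ∈ K, W w = W z) (z : ℂ) : W z ≤ 0 := by
  obtain ⟨z₁, hz₁, -⟩ := hval z
  obtain ⟨m, hm, hmax⟩ := hK.exists_isMaxOn ⟨z₁, hz₁⟩ hc.continuousOn
  have hle : ∀ z, W z ≤ W m := fun z => by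
    obtain ⟨w, hw, he⟩ := hval z
    exact he ▸ hmax hw
  refine (hle z).trans (not_lt.1 fun hpos => ?_)
  have hclosed : IsClosed {w | W w = W m} := isClosed_eq hc continuous_const
  have hopen : IsOpen {w | W w = W m} := by
    rw [isOpen_iff_eventually]
    intro w hw
    have hw : W w = W m := hw
    filter_upwards [eventually_eq_of_isLocalMax_of_harmonicAt (hW w (hw ▸ hpos.ne'))
      (Eventually.of_forall fun y => hw ▸ hle y)] with y hy
    exact hy.trans hw
  have huniv := IsClopen.eq_univ ⟨hclosed, hopen⟩ ⟨m, rfl⟩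
  obtain ⟨z₀, hz₀⟩ := h0
  have : W z₀ = W m := (huniv ▸ mem_univ z₀ : z₀ ∈ {w | W w = W m})
  linarith

open InnerProductSpace in
theorem eq_zero_of_harmonicAt_of_ne_zero {W : ℂ → ℝ} (hc : Continuous W)
    (hW : ∀ z, W z ≠ 0 → HarmonicAt W z) (h0 : ∃ z, W z = 0) {K : Set ℂ} (hK : IsCompact K)
    (hval : ∀ z, ∃ w ∈ K, W w = W z) (z : ℂ) : W z = 0 := by
  refine le_antisymm (nonpos_of_harmonicAt_of_ne_zero hc hW h0 hK hval z) ?_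
  have := nonpos_of_harmonicAt_of_ne_zero (W := -W) hc.neg
    (fun z hz => (hW z (by simpa using hz)).neg) (by simpa using h0) hK
    (by simpa using hval) z
  simpa using this

/-! ### The double-layer potential as the real part of a holomorphic function -/

/-- A function of `w`, holomorphic off the lattice, with real part `-Im (greenGrad τ w * v)`. -/
def layerKernel (τ w v : ℂ) : ℂ :=
  -Complex.I * (logDeriv (theta₁ τ) w * (v / (2 * Real.pi)) + w * (v.re / τ.im : ℝ))

/-- The regular part of `layerKernel` at the origin. -/
def layerKernelReg (τ w v : ℂ) : ℂ :=
  -Complex.I * (logDeriv (thetaQuot τ) w * (v / (2 * Real.pi)) + w * (v.re / τ.im : ℝ))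

/-- For fixed v, the non-holomorphic term (Im w)(Re v) is the real part of -iw Re v. So the
quadratic part of G does not prevent the potential from being the real part of a holomorphic
function of w. -/
theorem re_layerKernel (τ w v : ℂ) : (layerKernel τ w v).re = -(greenGrad τ w * v).im := by
  have e : (layerKernel τ w v) = -Complex.I * ((logDeriv (theta₁ τ) w * v) * (1 / (2 * Real.pi) : ℝ)
    + w * (v.re / τ.im : ℝ)) := by
    rw [layerKernel]; push_cast; ring
  have e' : greenGrad τ w * v = -((logDeriv (theta₁ τ) w * v) * (1 / (2 * Real.pi) : ℝ)) -
    Complex.I * (w.im / τ.im : ℝ) * v := by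
    rw [greenGrad]; push_cast; ring
  rw [e, e']
  simp only [Complex.mul_re, Complex.neg_re, Complex.neg_im, Complex.I_re, Complex.I_im,
    Complex.add_re, Complex.add_im, Complex.mul_im, Complex.ofReal_re, Complex.ofReal_im,
    Complex.sub_im]
  ring

theorem layerKernel_eq {τ w : ℂ} (hτ : 0 < τ.im) (hw : w ∉ lattice τ) (v : ℂ) :
    layerKernel τ w v = Complex.I / (2 * Real.pi) * (v / -w) + layerKernelReg τ w v := by
  rw [layerKernel, layerKernelReg, logDeriv_theta₁ hτ hw]
  ring

theorem analyticAt_logDeriv {f : ℂ → ℂ} (hf : Differentiable ℂ f) {z : ℂ} (hz : f z ≠ 0) :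
    AnalyticAt ℂ (logDeriv f) z :=
  ((hf.analyticAt z).deriv).div (hf.analyticAt z) hz

theorem analyticAt_logDeriv_theta₁ {τ w : ℂ} (hτ : 0 < τ.im) (hw : w ∉ lattice τ) :
    AnalyticAt ℂ (logDeriv (theta₁ τ)) w :=
  analyticAt_logDeriv (differentiable_theta₁ hτ) (mt (theta₁_eq_zero_iff hτ).1 hw)

theorem continuousOn_intervalIntegral {U : Set ℂ} {Φ : ℂ → ℝ → ℂ}
    (hc : ContinuousOn (fun p : ℂ × ℝ => Φ p.1 p.2) (U ×ˢ univ)) :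
    ContinuousOn (fun z => ∫ t in (0 : ℝ)..1, Φ z t) U := by
  rw [continuousOn_iff_continuous_domRestrict]
  refine intervalIntegral.continuous_parametric_intervalIntegral_of_continuous'
    (f := fun (z : U) t => Φ z t) ?_ 0 1
  rw [← continuousOn_univ]
  exact hc.comp (f := fun p : U × ℝ => ((p.1 : ℂ), p.2)) (by fun_prop)
    fun p _ => ⟨p.1.2, mem_univ _⟩

namespace HoledTorus

variable {τ : ℂ} {M : ℕ} (X : HoledTorus τ M)

/-- A function on the boundary, as a function of the parameter of `∂D_j`. -/
def density (φ : C(X.boundary, ℝ)) (j : Fin M) (t : ℝ) : ℝ := φ (X.boundaryPoint j t)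

theorem continuous_boundaryPoint (j : Fin M) : Continuous (X.boundaryPoint j) :=
  (X.hole j).continuous_curve.subtype_mk _

@[fun_prop]
theorem continuous_density (φ : C(X.boundary, ℝ)) (j : Fin M) : Continuous (X.density φ j) :=
  φ.continuous.comp (X.continuous_boundaryPoint j)

theorem periodic_density (φ : C(X.boundary, ℝ)) (j : Fin M) :
    Function.Periodic (X.density φ j) 1 := fun t => by
  have : X.boundaryPoint j (t + 1) = X.boundaryPoint j t :=
    Subtype.ext ((X.hole j).periodic_curve t)
  rw [density, density, this]

/-- The cover of `Ω` together with the holes themselves. -/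
def offBoundary : Set ℂ := X.cover ∪ ⋃ j, (X.hole j).carrier

theorem isOpen_offBoundary (hτ : 0 < τ.im) : IsOpen X.offBoundary :=
  (X.isOpen_cover hτ).union (isOpen_iUnion fun j => (X.hole j).isOpen_carrier)

theorem sub_curve_notMem_lattice {z : ℂ} (hz : z ∈ X.offBoundary) (j : Fin M) (t : ℝ) :
    z - (X.hole j).curve t ∉ lattice τ := by
  rcases hz with hz | hz
  · exact X.sub_notMem_lattice_of_mem_cover hz ((X.hole j).curve_mem_closure t)
  · obtain ⟨i, hi⟩ := mem_iUnion.1 hz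
    intro h
    obtain ⟨rfl, rfl⟩ := X.eq_of_sub_mem_lattice
      (X.closure_subset_holeNhd i (subset_closure hi)) ((X.hole j).curve_mem_closure t) h
    exact (X.hole j).curve_notMem_carrier t hi

/-- The holomorphic function with real part `𝓓[φ]`. -/
def complexPotential (φ : C(X.boundary, ℝ)) (z : ℂ) : ℂ :=
  ∑ j, ∫ t in (0 : ℝ)..1, (X.density φ j t : ℂ) *
    layerKernel τ (z - (X.hole j).curve t) (deriv (X.hole j).curve t)

theorem continuous_layerKernel_integrand (hτ : 0 < τ.im) (φ : C(X.boundary, ℝ)) {z : ℂ} {j : Fin M}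
    (h : ∀ t, z - (X.hole j).curve t ∉ lattice τ) :
    Continuous fun t => (X.density φ j t : ℂ) *
        layerKernel τ (z - (X.hole j).curve t) (deriv (X.hole j).curve t) := by
  have h1 := (X.hole j).continuous_curve
  have h2 := (X.hole j).continuous_deriv_curve
  have : Continuous fun t => logDeriv (theta₁ τ) (z - (X.hole j).curve t) :=
    continuous_iff_continuousAt.2 fun t =>
      (analyticAt_logDeriv_theta₁ hτ (h t)).continuousAt.comp'
        (f := fun t => z - (X.hole j).curve t) (by fun_prop : Continuous fun t =>
        z - (X.hole j).curve t).continuousAt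
  unfold layerKernel
  fun_prop

theorem hasDerivAt_complexPotential (hτ : 0 < τ.im) (φ : C(X.boundary, ℝ)) {z : ℂ}
    (hz : z ∈ X.offBoundary) :
    HasDerivAt (X.complexPotential φ) (deriv (X.complexPotential φ) z) z := by
  refine DifferentiableAt.hasDerivAt ?_
  refine DifferentiableAt.fun_sum fun j _ => ?_
  have h1 := (X.hole j).continuous_curve
  have h2 := (X.hole j).continuous_deriv_curve
  have h3 := X.continuous_density φ j
  have hl : ∀ z ∈ X.offBoundary, ∀ t, AnalyticAt ℂ (logDeriv (theta₁ τ)) (z - (X.hole j).curve t) :=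
    fun z hz t => analyticAt_logDeriv_theta₁ hτ (X.sub_curve_notMem_lattice hz j t)
  have hcurve : Continuous fun p : ℂ × ℝ => p.1 - (X.hole j).curve p.2 := by fun_prop
  refine (hasDerivAt_intervalIntegral_of_continuousOn (X.isOpen_offBoundary hτ)
    (Φ' := fun z t => (X.density φ j t : ℂ) * (-Complex.I * (deriv (logDeriv (theta₁ τ))
      (z - (X.hole j).curve t) * (deriv (X.hole j).curve t / (2 * Real.pi)) +
      ((deriv (X.hole j).curve t).re / τ.im : ℝ)))) (fun z hz t => ?_) (fun z hz => ?_) ?_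
      hz).differentiableAt
  · have e1 := ((hasDerivAt_id z).sub_const ((X.hole j).curve t))
    have e2 := (hl z hz t).differentiableAt.hasDerivAt.comp z e1
    have e3 := ((e2.mul_const (deriv (X.hole j).curve t / (2 * Real.pi))).add
      (e1.mul_const (((deriv (X.hole j).curve t).re / τ.im : ℝ) : ℂ))).const_mul (-Complex.I)
    convert! e3.const_mul (X.density φ j t : ℂ) using 1
    simp
  · exact X.continuous_layerKernel_integrand hτ φ fun t => X.sub_curve_notMem_lattice hz j t
  · have : ContinuousOn (fun p : ℂ × ℝ => deriv (logDeriv (theta₁ τ)) (p.1 - (X.hole j).curve p.2))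
        (X.offBoundary ×ˢ univ) := fun p hp =>
      ((hl p.1 hp.1 p.2).deriv.continuousAt.comp' (f := fun p : ℂ × ℝ => p.1 - (X.hole j).curve p.2)
        hcurve.continuousAt).continuousWithinAt
    fun_prop

theorem kernel_mul_density (hτ : 0 < τ.im) (φ : C(X.boundary, ℝ)) {z : ℂ} {j : Fin M} {t : ℝ}
    (h : z - (X.hole j).curve t ∉ lattice τ) :
    X.kernel z j t * φ (X.boundaryPoint j t) * ‖deriv (X.hole j).curve t‖ =
      ((X.density φ j t : ℂ) *
        layerKernel τ (z - (X.hole j).curve t) (deriv (X.hole j).curve t)).re := by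
  rw [Complex.re_ofReal_mul, re_layerKernel, ← X.kernel_mul_norm_deriv hτ h, density]
  ring

theorem intervalIntegral_re {f : ℝ → ℂ} {a b : ℝ} (hf : IntervalIntegrable f volume a b) :
    (∫ t in a..b, f t).re = ∫ t in a..b, (f t).re :=
  (Complex.reCLM.intervalIntegral_comp_comm hf).symm

theorem re_complexPotential (hτ : 0 < τ.im) (φ : C(X.boundary, ℝ)) {z : ℂ}
    (hz : z ∈ X.offBoundary) : (X.complexPotential φ z).re = X.doubleLayer φ z := by
  rw [complexPotential, doubleLayer, Complex.re_sum]
  refine Finset.sum_congr rfl fun j _ => ?_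
  have hl := X.sub_curve_notMem_lattice hz j
  rw [intervalIntegral_re ((X.continuous_layerKernel_integrand hτ φ hl).intervalIntegrable _ _),
    C2Hole.arcIntegral]
  exact intervalIntegral.integral_congr fun t _ => (X.kernel_mul_density hτ φ (hl t)).symm

/-- The kernel of the part of the potential that is regular near the closure of `D_j`. -/
def regKernel (j i : Fin M) (z : ℂ) (t : ℝ) : ℂ :=
  if i = j then layerKernelReg τ (z - (X.hole i).curve t) (deriv (X.hole i).curve t)
  else layerKernel τ (z - (X.hole i).curve t) (deriv (X.hole i).curve t)

/-- The part of the potential that is regular near the closure of `D_j`. -/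
def regPotential (j : Fin M) (φ : C(X.boundary, ℝ)) (z : ℂ) : ℂ :=
  ∑ i, ∫ t in (0 : ℝ)..1, (X.density φ i t : ℂ) * X.regKernel j i z t

theorem continuousOn_regKernel (hτ : 0 < τ.im) (j i : Fin M) :
    ContinuousOn (fun p : ℂ × ℝ => X.regKernel j i p.1 p.2) (X.holeNhd j ×ˢ univ) := by
  have h1 := (X.hole i).continuous_curve
  have h2 := (X.hole i).continuous_deriv_curve
  have hcurve : Continuous fun p : ℂ × ℝ => p.1 - (X.hole i).curve p.2 := by fun_prop
  by_cases hij : i = j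
  · simp only [regKernel, if_pos hij, layerKernelReg]
    have : ContinuousOn (fun p : ℂ × ℝ => logDeriv (thetaQuot τ) (p.1 - (X.hole i).curve p.2))
        (X.holeNhd j ×ˢ univ) := fun p hp =>
      ((continuousAt_logDeriv (differentiable_thetaQuot hτ) (thetaQuot_ne_zero hτ fun h =>
        sub_eq_zero.2 (X.eq_of_sub_mem_lattice hp.1 ((X.hole i).curve_mem_closure p.2) h).2)).comp'
        (f := fun p : ℂ × ℝ => p.1 - (X.hole i).curve p.2)
        hcurve.continuousAt).continuousWithinAt
    fun_prop
  · simp only [regKernel, if_neg hij, layerKernel]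
    have : ContinuousOn (fun p : ℂ × ℝ => logDeriv (theta₁ τ) (p.1 - (X.hole i).curve p.2))
        (X.holeNhd j ×ˢ univ) := fun p hp =>
      ((analyticAt_logDeriv_theta₁ hτ fun h => hij
        (X.eq_of_sub_mem_lattice hp.1 ((X.hole i).curve_mem_closure p.2) h).1).continuousAt.comp'
        (f := fun p : ℂ × ℝ => p.1 - (X.hole i).curve p.2)
        hcurve.continuousAt).continuousWithinAt
    fun_prop

theorem continuous_regKernel (hτ : 0 < τ.im) (j i : Fin M) {z : ℂ} (hz : z ∈ X.holeNhd j) :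
    Continuous (X.regKernel j i z) := by
  rw [← continuousOn_univ]
  exact (X.continuousOn_regKernel hτ j i).comp (f := fun t : ℝ => (z, t)) (by fun_prop)
    fun t _ => ⟨hz, mem_univ _⟩

theorem continuousOn_regPotential (hτ : 0 < τ.im) (j : Fin M) (φ : C(X.boundary, ℝ)) :
    ContinuousOn (X.regPotential j φ) (X.holeNhd j) := by
  refine continuousOn_finsetSum _ fun i _ => continuousOn_intervalIntegral
    (Φ := fun z t => (X.density φ i t : ℂ) * X.regKernel j i z t) ?_
  have := X.continuousOn_regKernel hτ j i
  fun_prop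

theorem layerKernel_eq_regKernel (hτ : 0 < τ.im) {j i : Fin M} {z : ℂ} {t : ℝ}
    (h : z - (X.hole i).curve t ∉ lattice τ) :
    layerKernel τ (z - (X.hole i).curve t) (deriv (X.hole i).curve t) =
      (if i = j then Complex.I / (2 * Real.pi) *
        (deriv (X.hole i).curve t / ((X.hole i).curve t - z)) else 0) + X.regKernel j i z t := by
  by_cases hij : i = j
  · simp only [regKernel, if_pos hij]
    rw [layerKernel_eq hτ h, neg_sub]
  · simp only [regKernel, if_neg hij, zero_add]

/-- Near D_j the only singularity is the pole at the origin in the kernel of ∂D_j itself, so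
boundary limits reduce to those of a Cauchy integral. -/
theorem complexPotential_eq (hτ : 0 < τ.im) (φ : C(X.boundary, ℝ)) {j : Fin M} {z : ℂ}
    (hz : z ∈ X.holeNhd j) (hz' : z ∈ X.offBoundary) :
    X.complexPotential φ z = Complex.I / (2 * Real.pi) * (X.hole j).cauchy (X.density φ j) z +
      X.regPotential j φ z := by
  have hterm : ∀ i, (∫ t in (0 : ℝ)..1, (X.density φ i t : ℂ) *
      layerKernel τ (z - (X.hole i).curve t) (deriv (X.hole i).curve t)) =
      (if i = j then Complex.I / (2 * Real.pi) * (X.hole i).cauchy (X.density φ i) z else 0) +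
      ∫ t in (0 : ℝ)..1, (X.density φ i t : ℂ) * X.regKernel j i z t := fun i => by
    have hl := X.sub_curve_notMem_lattice hz' i
    have hne : ∀ t, z ≠ (X.hole i).curve t := fun t h => hl t (by simp [h])
    have hreg := X.continuous_regKernel hτ j i hz
    have hden := X.continuous_density φ i
    have hcau := C2Hole.continuous_cauchy_integrand (D := X.hole i) hden hne
    by_cases hij : i = j
    · rw [if_pos hij, C2Hole.cauchy, ← intervalIntegral.integral_const_mul,
        ← intervalIntegral.integral_add ((hcau.const_mul _).intervalIntegrable _ _)
          (Continuous.intervalIntegrable (by fun_prop) _ _)]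
      refine intervalIntegral.integral_congr fun t _ => ?_
      simp only [X.layerKernel_eq_regKernel hτ (j := j) (hl t), if_pos hij]
      ring
    · rw [if_neg hij, zero_add]
      refine intervalIntegral.integral_congr fun t _ => ?_
      simp only [X.layerKernel_eq_regKernel hτ (j := j) (hl t), if_neg hij, zero_add]
  rw [complexPotential, Finset.sum_congr rfl fun i _ => hterm i, Finset.sum_add_distrib,
    Finset.sum_ite_eq' Finset.univ j, if_pos (Finset.mem_univ j), regPotential]

end HoledTorus

/-! ### The double-layer potential on the boundary -/

/-- This is the case h = 0 of `exists_abs_im_add_le`, after `t` has been moved within half a period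
of `s`. -/
theorem C2Hole.exists_abs_im_div_le (D : C2Hole) :
    ∃ C > 0, ∀ s t, |(deriv D.curve t / (D.curve t - D.curve s)).im| ≤ C := by
  obtain ⟨C, h₀, hC, hh₀, hbd⟩ := D.exists_abs_im_add_le
  refine ⟨C, hC, fun s t => ?_⟩
  have h1 : |(t - round (t - s) : ℝ) - s| ≤ 3 / 4 := by
    have := abs_sub_round (t - s)
    rw [show (t - round (t - s) : ℝ) - s = t - s - round (t - s) by ring]
    linarith
  have h2 := hbd s _ 0 h1 (by simpa using hh₀.le)
  have h3 : (t - round (t - s) : ℝ) = t + ((-round (t - s) : ℤ) : ℝ) := by push_cast; ring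
  rw [h3, D.periodic_curve.add_intCast, D.periodic_deriv_curve.add_intCast] at h2
  simp only [Complex.ofReal_zero, zero_mul, add_zero, sub_zero, Complex.add_im] at h2
  rw [← two_mul, abs_mul, abs_two] at h2
  linarith [abs_nonneg (deriv D.curve t / (D.curve t - D.curve s)).im]

theorem measurable_greenGrad {τ : ℂ} (hτ : 0 < τ.im) : Measurable (greenGrad τ) := by
  have h1 := differentiable_theta₁ hτ
  have h2 := h1.continuous.measurable
  have h3 := ((h1.contDiff (n := 2)).continuous_deriv (by norm_num)).measurable
  unfold greenGrad
  simp only [logDeriv, Pi.div_apply]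
  fun_prop

namespace HoledTorus

variable {τ : ℂ} {M : ℕ} (X : HoledTorus τ M)

/-- The kernel of the double-layer potential with respect to the parameter of the boundary. -/
def paramKernel (z : ℂ) (i : Fin M) (t : ℝ) : ℝ := X.kernel z i t * ‖deriv (X.hole i).curve t‖

theorem doubleLayer_eq (φ : C(X.boundary, ℝ)) (z : ℂ) :
    X.doubleLayer φ z = ∑ i, ∫ t in (0 : ℝ)..1, X.paramKernel z i t * X.density φ i t := by
  refine Finset.sum_congr rfl fun i _ => intervalIntegral.integral_congr fun t _ => ?_
  simp only [paramKernel, density]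
  ring

theorem exists_eq_curve {z : ℂ} (hz : z ∈ X.boundary) : ∃ j s, z = (X.hole j).curve s := by
  obtain ⟨j, hj⟩ := mem_iUnion.1 hz
  rw [← (X.hole j).range_curve] at hj
  obtain ⟨s, hs⟩ := hj
  exact ⟨j, s, hs.symm⟩

theorem curve_mem_holeNhd (j : Fin M) (t : ℝ) : (X.hole j).curve t ∈ X.holeNhd j :=
  X.closure_subset_holeNhd j ((X.hole j).curve_mem_closure t)

theorem ae_sub_notMem_lattice {z : ℂ} (hz : z ∈ X.boundary) (i : Fin M) :
    ∀ᵐ t : ℝ, z - (X.hole i).curve t ∉ lattice τ := by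
  obtain ⟨j, s, rfl⟩ := X.exists_eq_curve hz
  filter_upwards [(countable_range fun n : ℤ => s + n).ae_notMem volume] with t ht h
  obtain ⟨rfl, he⟩ := X.eq_of_sub_mem_lattice (X.curve_mem_holeNhd j s)
    ((X.hole i).curve_mem_closure t) h
  obtain ⟨n, hn⟩ := (X.hole i).curve_eq_curve_iff.1 he.symm
  exact ht ⟨n, by linarith⟩

/-- The singular part is -(1/2π) Im(γ'/(γ - z)), bounded for a C² curve; the rest is continuous on a
compact set. -/
theorem exists_abs_paramKernel_le (hτ : 0 < τ.im) : ∃ C > 0, ∀ z ∈ X.boundary, ∀ i,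
    ∀ t ∈ Icc (0 : ℝ) 1, z - (X.hole i).curve t ∉ lattice τ → |X.paramKernel z i t| ≤ C := by
  have hloc : ∀ j i, ∃ C > 0, ∀ s, ∀ t ∈ Icc (0 : ℝ) 1,
      (X.hole j).curve s - (X.hole i).curve t ∉ lattice τ →
      |X.paramKernel ((X.hole j).curve s) i t| ≤ C := fun j i => by
    obtain ⟨A, hA, hAb⟩ := (X.hole i).exists_abs_im_div_le
    have hcomp : IsCompact (closure (X.hole j).carrier ×ˢ Icc (0 : ℝ) 1) :=
      (X.hole j).isCompact_closure.prod isCompact_Icc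
    obtain ⟨B, hB⟩ := hcomp.exists_bound_of_continuousOn ((X.continuousOn_regKernel hτ j i).mono
      (prod_mono (X.closure_subset_holeNhd j) (subset_univ _)))
    refine ⟨A + (|B| + 1), by positivity, fun s t ht hl => ?_⟩
    rw [paramKernel, X.kernel_mul_norm_deriv hτ hl, ← re_layerKernel,
      X.layerKernel_eq_regKernel hτ (j := j) hl, Complex.add_re]
    refine (abs_add_le _ _).trans (add_le_add ?_ ?_)
    · by_cases hij : i = j
      · subst hij
        rw [if_pos rfl, show Complex.I / (2 * Real.pi) *
          (deriv (X.hole i).curve t / ((X.hole i).curve t - (X.hole i).curve s)) =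
          ((1 / (2 * Real.pi) : ℝ) : ℂ) * (Complex.I *
          (deriv (X.hole i).curve t / ((X.hole i).curve t - (X.hole i).curve s))) by push_cast; ring,
          Complex.re_ofReal_mul, Complex.I_mul_re, abs_mul, abs_neg]
        refine (mul_le_of_le_one_left (abs_nonneg _) ?_).trans (hAb s t)
        rw [abs_of_pos (by positivity), div_le_one (by positivity)]
        linarith [Real.pi_gt_three]
      · simpa [if_neg hij] using hA.le
    · refine (Complex.abs_re_le_norm _).trans ((hB (_, t) ⟨(X.hole j).curve_mem_closure s, ht⟩).trans ?_)
      linarith [le_abs_self B]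
  choose C hC hCb using hloc
  refine ⟨∑ j, ∑ i, C j i + 1, ?_, fun z hz i t ht hl => ?_⟩
  · have := Finset.sum_nonneg fun j (_ : j ∈ Finset.univ) =>
      Finset.sum_nonneg fun i (_ : i ∈ Finset.univ) => (hC j i).le
    linarith
  · obtain ⟨j, s, rfl⟩ := X.exists_eq_curve hz
    refine (hCb j i s t ht hl).trans ?_
    have h1 := Finset.single_le_sum (f := fun i => C j i) (fun i _ => (hC j i).le)
      (Finset.mem_univ i)
    have h2 := Finset.single_le_sum (f := fun j => ∑ i, C j i)
      (fun j _ => Finset.sum_nonneg fun i _ => (hC j i).le) (Finset.mem_univ j)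
    linarith

theorem aestronglyMeasurable_paramKernel (hτ : 0 < τ.im) {z : ℂ} (hz : z ∈ X.boundary)
    (i : Fin M) (s : Set ℝ) : AEStronglyMeasurable (X.paramKernel z i) (volume.restrict s) := by
  have h1 := (X.hole i).continuous_curve.measurable
  have h2 := (X.hole i).continuous_deriv_curve.measurable
  have h3 := measurable_greenGrad hτ
  have hm : Measurable fun t =>
      -(greenGrad τ (z - (X.hole i).curve t) * deriv (X.hole i).curve t).im :=
    (Complex.measurable_im.comp ((h3.comp (measurable_const.sub h1)).mul h2)).neg
  refine hm.aestronglyMeasurable.congr (ae_restrict_of_ae ?_)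
  filter_upwards [X.ae_sub_notMem_lattice hz i] with t ht
  exact (X.kernel_mul_norm_deriv hτ ht).symm

theorem intervalIntegrable_paramKernel (hτ : 0 < τ.im) {z : ℂ} (hz : z ∈ X.boundary)
    (i : Fin M) : IntervalIntegrable (X.paramKernel z i) volume 0 1 := by
  obtain ⟨C, hC, hCb⟩ := X.exists_abs_paramKernel_le hτ
  refine (intervalIntegrable_const (c := C)).mono_fun
    (X.aestronglyMeasurable_paramKernel hτ hz i _) ?_
  filter_upwards [ae_restrict_of_ae (X.ae_sub_notMem_lattice hz i),
    ae_restrict_mem measurableSet_uIoc] with t ht ht'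
  rw [uIoc_of_le zero_le_one] at ht'
  rw [Real.norm_eq_abs, Real.norm_of_nonneg hC.le]
  exact hCb z hz i t ⟨ht'.1.le, ht'.2⟩ ht

theorem continuousAt_paramKernel (hτ : 0 < τ.im) {z : ℂ} {i : Fin M} {t : ℝ}
    (h : z - (X.hole i).curve t ∉ lattice τ) : ContinuousAt (fun z => X.paramKernel z i t) z := by
  have hc : ContinuousAt (fun z =>
      -(greenGrad τ (z - (X.hole i).curve t) * deriv (X.hole i).curve t).im) z := by
    have := (continuousAt_greenGrad hτ h).comp' (f := fun z => z - (X.hole i).curve t)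
      (by fun_prop)
    exact (Complex.continuous_im.continuousAt.comp (this.mul continuousAt_const)).neg
  refine hc.congr ?_
  have hopen : IsOpen ((fun z => z - (X.hole i).curve t) ⁻¹' (lattice τ : Set ℂ)ᶜ) :=
    (isOpen_compl_lattice hτ).preimage (by fun_prop)
  filter_upwards [hopen.mem_nhds h] with w hw
  exact (X.kernel_mul_norm_deriv hτ hw).symm

/-- The `L¹`-distance of the kernels at two points. -/
def kernelDist (z w : ℂ) : ℝ :=
  ∑ i, ∫ t in (0 : ℝ)..1, |X.paramKernel z i t - X.paramKernel w i t|

theorem continuous_kernelDist (hτ : 0 < τ.im) (w : X.boundary) (j : Fin M) :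
    Continuous fun s => X.kernelDist ((X.hole j).curve s) w := by
  obtain ⟨C, hC, hCb⟩ := X.exists_abs_paramKernel_le hτ
  refine continuous_finsetSum _ fun i _ => continuous_iff_continuousAt.2 fun s₀ => ?_
  have hmem : ∀ s, (X.hole j).curve s ∈ X.boundary := X.curve_mem_boundary j
  refine intervalIntegral.continuousAt_of_dominated_interval (bound := fun _ => 2 * C) ?_ ?_
    intervalIntegrable_const ?_
  · refine .of_forall fun s => ?_
    exact ((X.aestronglyMeasurable_paramKernel hτ (hmem s) i _).sub
      (X.aestronglyMeasurable_paramKernel hτ w.2 i _)).norm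
  · refine .of_forall fun s => ?_
    filter_upwards [X.ae_sub_notMem_lattice (hmem s) i, X.ae_sub_notMem_lattice w.2 i]
      with t h1 h2 ht
    rw [uIoc_of_le zero_le_one] at ht
    rw [Real.norm_eq_abs, abs_abs]
    have e1 := hCb _ (hmem s) i t ⟨ht.1.le, ht.2⟩ h1
    have e2 := hCb _ w.2 i t ⟨ht.1.le, ht.2⟩ h2
    exact (abs_sub _ _).trans (by linarith)
  · filter_upwards [X.ae_sub_notMem_lattice (hmem s₀) i] with t ht _
    have := (X.continuousAt_paramKernel hτ ht).comp' (f := (X.hole j).curve)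
      (X.hole j).continuous_curve.continuousAt
    fun_prop

/-- The boundary is a quotient of finitely many copies of a compact interval. -/
theorem continuous_of_continuous_comp {E : Type*} [TopologicalSpace E] {f : X.boundary → E}
    (hf : ∀ j, Continuous fun t => f (X.boundaryPoint j t)) : Continuous f := by
  let p : Fin M × Icc (0 : ℝ) 1 → X.boundary := fun q => X.boundaryPoint q.1 q.2
  have hp : Continuous p := continuous_prod_of_discrete_left.2 fun j =>
    (X.continuous_boundaryPoint j).comp continuous_subtype_val
  have hsurj : Function.Surjective p := fun ⟨z, hz⟩ => by
    obtain ⟨j, s, rfl⟩ := X.exists_eq_curve hz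
    obtain ⟨n, hn⟩ := C2Hole.exists_shift s
    exact ⟨(j, ⟨s + n, hn⟩), Subtype.ext ((X.hole j).periodic_curve.add_intCast s n)⟩
  rw [(IsQuotientMap.of_surjective_continuous hsurj hp).continuous_iff]
  exact continuous_prod_of_discrete_left.2 fun j => (hf j).comp continuous_subtype_val

/-- Both the continuity of K[φ] and the equicontinuity behind the compactness of K come from this
continuity of the kernel in L¹. -/
theorem tendsto_kernelDist (hτ : 0 < τ.im) (w : X.boundary) :
    Tendsto (fun z : X.boundary => X.kernelDist z w) (𝓝 w) (𝓝 0) := by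
  have h : Continuous fun z : X.boundary => X.kernelDist z w :=
    X.continuous_of_continuous_comp fun j => X.continuous_kernelDist hτ w j
  have := h.tendsto w
  simpa [kernelDist] using this

theorem intervalIntegrable_paramKernel_mul (hτ : 0 < τ.im) (φ : C(X.boundary, ℝ)) {z : ℂ}
    (hz : z ∈ X.boundary) (i : Fin M) :
    IntervalIntegrable (fun t => X.paramKernel z i t * X.density φ i t) volume 0 1 :=
  (X.intervalIntegrable_paramKernel hτ hz i).mul_continuousOn (X.continuous_density φ i).continuousOn

theorem abs_doubleLayer_sub_le (hτ : 0 < τ.im) (φ : C(X.boundary, ℝ)) (z w : X.boundary) :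
    |X.doubleLayer φ z - X.doubleLayer φ w| ≤ ‖φ‖ * X.kernelDist z w := by
  rw [doubleLayer_eq, doubleLayer_eq, ← Finset.sum_sub_distrib, kernelDist, Finset.mul_sum]
  refine (Finset.abs_sum_le_sum_abs _ _).trans (Finset.sum_le_sum fun i _ => ?_)
  rw [← intervalIntegral.integral_sub (X.intervalIntegrable_paramKernel_mul hτ φ z.2 i)
    (X.intervalIntegrable_paramKernel_mul hτ φ w.2 i), ← intervalIntegral.integral_const_mul]
  refine (intervalIntegral.abs_integral_le_integral_abs zero_le_one).trans
    (intervalIntegral.integral_mono_on zero_le_one ?_ ?_ fun t _ => ?_)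
  · exact ((X.intervalIntegrable_paramKernel_mul hτ φ z.2 i).sub
      (X.intervalIntegrable_paramKernel_mul hτ φ w.2 i)).abs
  · exact ((X.intervalIntegrable_paramKernel hτ z.2 i).sub
      (X.intervalIntegrable_paramKernel hτ w.2 i)).abs.const_mul _
  · rw [← sub_mul, abs_mul, mul_comm]
    exact mul_le_mul_of_nonneg_right (φ.norm_coe_le_norm _) (abs_nonneg _)

theorem continuous_doubleLayer (hτ : 0 < τ.im) (φ : C(X.boundary, ℝ)) :
    Continuous fun z : X.boundary => X.doubleLayer φ z := by
  refine continuous_iff_continuousAt.2 fun w => ?_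
  rw [ContinuousAt, tendsto_iff_norm_sub_tendsto_zero]
  have := (X.tendsto_kernelDist hτ w).const_mul ‖φ‖
  rw [mul_zero] at this
  exact squeeze_zero (fun _ => norm_nonneg _) (fun z => X.abs_doubleLayer_sub_le hτ φ z w) this

open Classical in
-- The kernel is bounded on the boundary, so the principal value is an ordinary integral. Hence
-- `doubleLayer` at boundary points is K.
theorem tendsto_truncatedDoubleLayer (hτ : 0 < τ.im) (φ : C(X.boundary, ℝ)) (z₀ : X.boundary) :
    Tendsto (fun ε => X.truncatedDoubleLayer φ ε z₀) (𝓝[>] 0) (𝓝 (X.doubleLayer φ z₀)) := by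
  obtain ⟨C, hC, hCb⟩ := X.exists_abs_paramKernel_le hτ
  rw [doubleLayer_eq]
  refine tendsto_finsetSum _ fun i _ => ?_
  have hm := X.aestronglyMeasurable_paramKernel hτ z₀.2 i (uIoc 0 1)
  have hcurve := (X.hole i).continuous_curve
  have heq : ∀ ε t, (if ε < ‖(z₀ : ℂ) - (X.hole i).curve t‖ then
      X.kernel z₀ i t * φ (X.boundaryPoint i t) else 0) * ‖deriv (X.hole i).curve t‖ =
      {t | ε < ‖(z₀ : ℂ) - (X.hole i).curve t‖}.indicator
        (fun t => X.paramKernel z₀ i t * X.density φ i t) t := fun ε t => by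
    simp only [indicator_apply, mem_ofPred_eq, paramKernel, density]
    split_ifs <;> ring
  refine intervalIntegral.tendsto_integral_filter_of_dominated_convergence (fun _ => C * ‖φ‖)
    ?_ ?_ intervalIntegrable_const ?_
  · refine .of_forall fun ε => ?_
    simp only [heq]
    refine AEStronglyMeasurable.indicator ?_
      (isOpen_lt continuous_const (by fun_prop)).measurableSet
    exact hm.mul (X.continuous_density φ i).aestronglyMeasurable
  · refine .of_forall fun ε => ?_
    filter_upwards [X.ae_sub_notMem_lattice z₀.2 i] with t h1 ht
    rw [uIoc_of_le zero_le_one] at ht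
    rw [heq]
    refine (norm_indicator_le_norm_self _ _).trans ?_
    rw [norm_mul]
    exact mul_le_mul (hCb _ z₀.2 i t ⟨ht.1.le, ht.2⟩ h1) (φ.norm_coe_le_norm _) (norm_nonneg _) hC.le
  · filter_upwards [X.ae_sub_notMem_lattice z₀.2 i] with t h1 _
    have hpos : 0 < ‖(z₀ : ℂ) - (X.hole i).curve t‖ :=
      norm_pos_iff.2 fun h => h1 (h ▸ zero_mem _)
    refine tendsto_const_nhds.congr' ?_
    filter_upwards [Ioo_mem_nhdsGT hpos] with ε hε
    rw [heq, indicator_of_mem (show t ∈ {t | ε < ‖(z₀ : ℂ) - (X.hole i).curve t‖} from hε.2)]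

end HoledTorus

/-! ### Boundary values of the double-layer potential -/

namespace HoledTorus

variable {τ : ℂ} {M : ℕ} (X : HoledTorus τ M)

theorem doubleLayer_curve (hτ : 0 < τ.im) (φ : C(X.boundary, ℝ)) (j : Fin M) (s : ℝ) :
    X.doubleLayer φ ((X.hole j).curve s) =
      -(1 / (2 * Real.pi)) * (∫ t in (0 : ℝ)..1, X.density φ j t *
        (deriv (X.hole j).curve t / ((X.hole j).curve t - (X.hole j).curve s)).im) +
      (X.regPotential j φ ((X.hole j).curve s)).re := by
  set z := (X.hole j).curve s with hz
  have hzb : z ∈ X.boundary := X.curve_mem_boundary j s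
  have hzn : z ∈ X.holeNhd j := X.curve_mem_holeNhd j s
  have hcI : ∀ i, IntervalIntegrable (fun t => (X.density φ i t : ℂ) * X.regKernel j i z t)
      volume 0 1 := fun i => by
    have := X.continuous_regKernel hτ j i hzn
    have := X.continuous_density φ i
    exact Continuous.intervalIntegrable (by fun_prop) _ _
  have hterm : ∀ i, (∫ t in (0 : ℝ)..1, X.paramKernel z i t * X.density φ i t) =
      (if i = j then -(1 / (2 * Real.pi)) * (∫ t in (0 : ℝ)..1, X.density φ i t *
        (deriv (X.hole i).curve t / ((X.hole i).curve t - z)).im) else 0) +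
      ∫ t in (0 : ℝ)..1, ((X.density φ i t : ℂ) * X.regKernel j i z t).re := fun i => by
    have hcI' : IntervalIntegrable (fun t => ((X.density φ i t : ℂ) * X.regKernel j i z t).re)
        volume 0 1 := by
      have := X.continuous_regKernel hτ j i hzn
      have := X.continuous_density φ i
      exact Continuous.intervalIntegrable (by fun_prop) _ _
    by_cases hij : i = j
    · subst hij
      obtain ⟨A, hA, hAb⟩ := (X.hole i).exists_abs_im_div_le
      have hq : IntervalIntegrable (fun t => X.density φ i t *
          (deriv (X.hole i).curve t / ((X.hole i).curve t - z)).im) volume 0 1 := by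
        have h1 := (X.hole i).continuous_curve.measurable
        have h2 := (X.hole i).continuous_deriv_curve.measurable
        have hm : Measurable fun t =>
          (deriv (X.hole i).curve t / ((X.hole i).curve t - z)).im := by fun_prop
        refine IntervalIntegrable.continuousOn_mul ?_ (X.continuous_density φ i).continuousOn
        refine (intervalIntegrable_const (c := A)).mono_fun hm.aestronglyMeasurable
          (.of_forall fun t => ?_)
        exact (hAb s t).trans (le_abs_self A)
      rw [if_pos rfl, ← intervalIntegral.integral_const_mul,
        ← intervalIntegral.integral_add (hq.const_mul _) hcI']
      refine intervalIntegral.integral_congr_ae ?_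
      filter_upwards [X.ae_sub_notMem_lattice hzb i] with t ht _
      rw [paramKernel, X.kernel_mul_norm_deriv hτ ht, ← re_layerKernel,
        X.layerKernel_eq_regKernel hτ (j := i) ht, if_pos rfl, Complex.re_ofReal_mul,
        show Complex.I / (2 * Real.pi) *
          (deriv (X.hole i).curve t / ((X.hole i).curve t - z)) =
          ((1 / (2 * Real.pi) : ℝ) : ℂ) * (Complex.I *
          (deriv (X.hole i).curve t / ((X.hole i).curve t - z))) by push_cast; ring,
          Complex.add_re, Complex.re_ofReal_mul, Complex.I_mul_re]
      ring
    · rw [if_neg hij, zero_add]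
      refine intervalIntegral.integral_congr_ae ?_
      filter_upwards [X.ae_sub_notMem_lattice hzb i] with t ht _
      rw [paramKernel, X.kernel_mul_norm_deriv hτ ht, ← re_layerKernel,
        X.layerKernel_eq_regKernel hτ (j := j) ht, if_neg hij, Complex.re_ofReal_mul, zero_add,
        mul_comm]
  rw [doubleLayer_eq, Finset.sum_congr rfl fun i _ => hterm i, Finset.sum_add_distrib,
    Finset.sum_ite_eq' Finset.univ j, if_pos (Finset.mem_univ j), regPotential, Complex.re_sum]
  congr 1
  exact Finset.sum_congr rfl fun i _ => (intervalIntegral_re (hcI i)).symm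

/-- Both points at the distance `h` from the boundary point with parameter `s`, for `(s, h)` near
`(s₀, 0)`, are in the domains of the potentials. -/
theorem eventually_offset_mem (hτ : 0 < τ.im) (j : Fin M) (s₀ : ℝ) :
    ∀ᶠ p : ℝ × ℝ in 𝓝 s₀ ×ˢ 𝓝[>] 0,
      ((X.hole j).curve p.1 + p.2 * (X.hole j).normal p.1 ∈ X.holeNhd j ∧
        (X.hole j).curve p.1 - p.2 * (X.hole j).normal p.1 ∈ X.holeNhd j) ∧
      (X.hole j).curve p.1 + p.2 * (X.hole j).normal p.1 ∈ (X.hole j).carrier ∧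
        (X.hole j).curve p.1 - p.2 * (X.hole j).normal p.1 ∈ X.cover := by
  obtain ⟨h₀, hh₀, h1, h2⟩ := X.exists_collar hτ j
  filter_upwards [prod_mem_prod univ_mem (Ioc_mem_nhdsGT hh₀)] with p hp
  obtain ⟨hp1, hp2⟩ := hp.2
  refine ⟨⟨h1 _ _ (by rwa [abs_of_pos hp1]), ?_⟩, h2 _ _ hp1 hp2⟩
  have := h1 p.1 (-p.2) (by rwa [abs_neg, abs_of_pos hp1])
  simpa [← sub_eq_add_neg] using this

theorem tendsto_offset (j : Fin M) (s₀ : ℝ) (c : ℝ) :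
    Tendsto (fun p : ℝ × ℝ => (X.hole j).curve p.1 + (c * p.2 : ℝ) * (X.hole j).normal p.1)
      (𝓝 s₀ ×ˢ 𝓝[>] 0) (𝓝 ((X.hole j).curve s₀)) := by
  have h1 := (X.hole j).continuous_curve
  have h2 := (X.hole j).continuous_normal
  have : Continuous fun p : ℝ × ℝ =>
      (X.hole j).curve p.1 + (c * p.2 : ℝ) * (X.hole j).normal p.1 := by fun_prop
  have h3 := this.tendsto (s₀, 0)
  rw [nhds_prod_eq] at h3
  simp only [mul_zero, Complex.ofReal_zero, zero_mul, add_zero] at h3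
  exact h3.mono_left (Filter.prod_mono le_rfl nhdsWithin_le_nhds)

theorem tendsto_regPotential_add (hτ : 0 < τ.im) (φ : C(X.boundary, ℝ)) (j : Fin M) (s₀ : ℝ) :
    Tendsto (fun p : ℝ × ℝ =>
      X.regPotential j φ ((X.hole j).curve p.1 + p.2 * (X.hole j).normal p.1))
      (𝓝 s₀ ×ˢ 𝓝[>] 0) (𝓝 (X.regPotential j φ ((X.hole j).curve s₀))) := by
  have h := X.tendsto_offset j s₀ 1
  simp only [one_mul] at h
  exact (((X.continuousOn_regPotential hτ j φ).continuousAt ((X.isOpen_holeNhd hτ j).mem_nhds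
    (X.curve_mem_holeNhd j s₀))).tendsto).comp h

theorem tendsto_regPotential_sub (hτ : 0 < τ.im) (φ : C(X.boundary, ℝ)) (j : Fin M) (s₀ : ℝ) :
    Tendsto (fun p : ℝ × ℝ =>
      X.regPotential j φ ((X.hole j).curve p.1 - p.2 * (X.hole j).normal p.1))
      (𝓝 s₀ ×ˢ 𝓝[>] 0) (𝓝 (X.regPotential j φ ((X.hole j).curve s₀))) := by
  have h := X.tendsto_offset j s₀ (-1)
  simp only [neg_mul, one_mul, Complex.ofReal_neg, ← sub_eq_add_neg] at h
  exact (((X.continuousOn_regPotential hτ j φ).continuousAt ((X.isOpen_holeNhd hτ j).mem_nhds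
    (X.curve_mem_holeNhd j s₀))).tendsto).comp h

theorem tendsto_complexPotential_sub (hτ : 0 < τ.im) (φ : C(X.boundary, ℝ)) (j : Fin M) (s₀ : ℝ) :
    Tendsto (fun p : ℝ × ℝ =>
      X.complexPotential φ ((X.hole j).curve p.1 + p.2 * (X.hole j).normal p.1) -
        X.complexPotential φ ((X.hole j).curve p.1 - p.2 * (X.hole j).normal p.1))
      (𝓝 s₀ ×ˢ 𝓝[>] 0) (𝓝 (X.density φ j s₀)) := by
  have h1 := ((C2Hole.tendsto_cauchy_sub (D := X.hole j) (X.continuous_density φ j)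
    (X.periodic_density φ j) s₀).const_mul (Complex.I / (2 * Real.pi))).add
    ((X.tendsto_regPotential_add hτ φ j s₀).sub (X.tendsto_regPotential_sub hτ φ j s₀))
  have e : Complex.I / (2 * Real.pi) * (-(2 * Real.pi * Complex.I) * (X.density φ j s₀ : ℂ)) +
      (X.regPotential j φ ((X.hole j).curve s₀) - X.regPotential j φ ((X.hole j).curve s₀)) =
      X.density φ j s₀ := by
    have := Complex.I_mul_I
    have hpi : (Real.pi : ℂ) ≠ 0 := by exact_mod_cast Real.pi_ne_zero
    field_simp
    linear_combination (-(X.density φ j s₀ : ℂ)) * this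
  rw [e] at h1
  refine h1.congr' ?_
  filter_upwards [X.eventually_offset_mem hτ j s₀] with p hp
  rw [X.complexPotential_eq hτ φ hp.1.1 (Or.inr (mem_iUnion.2 ⟨j, hp.2.1⟩)),
    X.complexPotential_eq hτ φ hp.1.2 (Or.inl hp.2.2)]
  ring

/-- The jump relation for the double-layer potential, from the outside of the holes. -/
theorem tendsto_doubleLayer_sub (hτ : 0 < τ.im) (φ : C(X.boundary, ℝ)) (j : Fin M) (s₀ : ℝ) :
    Tendsto (fun p : ℝ × ℝ =>
      X.doubleLayer φ ((X.hole j).curve p.1 - p.2 * (X.hole j).normal p.1))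
      (𝓝 s₀ ×ˢ 𝓝[>] 0)
      (𝓝 (X.doubleLayer φ ((X.hole j).curve s₀) - X.density φ j s₀ / 2)) := by
  have h1 := C2Hole.tendsto_im_cauchy_add (D := X.hole j) (X.continuous_density φ j)
    (X.periodic_density φ j) s₀
  have h2 := (Complex.continuous_im.tendsto _).comp (C2Hole.tendsto_cauchy_sub (D := X.hole j)
    (X.continuous_density φ j) (X.periodic_density φ j) s₀)
  have h3 := (Complex.continuous_re.tendsto _).comp (X.tendsto_regPotential_sub hτ φ j s₀)
  -- The outer value is half of the sum minus the difference of the two one-sided values. As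
  -- Re(ic/2π) = -Im c/2π, the factor is -1/(4π).
  have h4 := ((h1.sub h2).const_mul (-(1 / (4 * Real.pi)))).add h3
  have e : -(1 / (4 * Real.pi)) * ((2 * ∫ t in (0 : ℝ)..1, X.density φ j t *
        (deriv (X.hole j).curve t / ((X.hole j).curve t - (X.hole j).curve s₀)).im) -
      (-(2 * Real.pi * Complex.I) * (X.density φ j s₀ : ℂ)).im) +
      (X.regPotential j φ ((X.hole j).curve s₀)).re =
      X.doubleLayer φ ((X.hole j).curve s₀) - X.density φ j s₀ / 2 := by
    have : (-(2 * Real.pi * Complex.I) * (X.density φ j s₀ : ℂ)).im =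
        -(2 * Real.pi * X.density φ j s₀) := by simp
    rw [X.doubleLayer_curve hτ, this]
    field_simp
    ring
  rw [e] at h4
  refine h4.congr' ?_
  filter_upwards [X.eventually_offset_mem hτ j s₀] with p hp
  rw [← X.re_complexPotential hτ φ (Or.inl hp.2.2),
    X.complexPotential_eq hτ φ hp.1.2 (Or.inl hp.2.2)]
  simp only [Function.comp_apply, Complex.add_re, Complex.sub_im, Complex.add_im]
  rw [show Complex.I / (2 * Real.pi) = ((1 / (2 * Real.pi) : ℝ) : ℂ) * Complex.I by
    push_cast; ring, mul_assoc, Complex.re_ofReal_mul, Complex.I_mul_re]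
  field_simp
  ring

/-- A limit along normals, locally uniform on the boundary, is a limit from one side. -/
theorem _root_.DoublyPeriodic.C2Hole.tendsto_nhdsWithin {E : Type*} {f : ℂ → E} {l : Filter E}
    (D : C2Hole) {S : Set ℂ} {σ : ℝ} (hσ : σ * σ = 1) {h₁ : ℝ} (hh₁ : 0 < h₁)
    (hS : ∀ s k : ℝ, |k| < h₁ → D.curve s + k * D.normal s ∈ S → 0 < σ * k) (s₀ : ℝ)
    (h : Tendsto (fun p : ℝ × ℝ => f (D.curve p.1 + (σ * p.2 : ℝ) * D.normal p.1))
      (𝓝 s₀ ×ˢ 𝓝[>] 0) l) :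
    Tendsto f (𝓝[S] (D.curve s₀)) l := by
  obtain ⟨c, h₀, hc, hh₀, hlow⟩ := D.exists_le_norm_sub
  intro V hV
  obtain ⟨U, hU, W, hW, hsub⟩ := mem_prod_iff.1 (h hV)
  obtain ⟨r, hr, hUr⟩ := Metric.mem_nhds_iff.1 hU
  obtain ⟨δ, hδ, hWδ⟩ := mem_nhdsGT_iff_exists_Ioo_subset.1 hW
  have hδ : 0 < δ := hδ
  have hη : 0 < min (min δ h₁) (c * r / 2) := by positivity
  rw [mem_map, mem_nhdsWithin]
  refine ⟨Metric.ball (D.curve s₀) _, Metric.isOpen_ball, Metric.mem_ball_self hη, ?_⟩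
  rintro z ⟨hz, hzS⟩
  rw [Metric.mem_ball, dist_eq_norm, lt_min_iff, lt_min_iff] at hz
  obtain ⟨⟨hzδ, hzh⟩, hzr⟩ := hz
  obtain ⟨s, k, hzk, hk⟩ := D.exists_eq_curve_add_normal z
  have hk0 := hk s₀
  have hkpos : 0 < σ * k := hS s k (hk0.trans_lt hzh) (hzk ▸ hzS)
  have hkabs : |σ * k| = |k| := by
    rw [abs_mul, (abs_eq_abs (b := (1 : ℝ))).2 (mul_self_eq_one_iff.1 hσ), abs_one, one_mul]
  -- The foot point is determined only up to the period; this shift brings its parameter within 1/2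
  -- of `s₀`, so that closeness on the curve implies closeness of parameters.
  obtain ⟨n, hn⟩ : ∃ n : ℤ, n = -round (s - s₀) := ⟨_, rfl⟩
  have e1 : D.curve (s + n) = D.curve s := D.periodic_curve.add_intCast s n
  have e2 : D.normal (s + n) = D.normal s := D.periodic_normal.add_intCast s n
  have hclose : |s + n - s₀| ≤ 3 / 4 := by
    have := abs_sub_round (s - s₀)
    rw [hn, show s + ((-round (s - s₀) : ℤ) : ℝ) - s₀ = s - s₀ - round (s - s₀) by push_cast; ring]
    linarith
  have hle := hlow s₀ (s + n) 0 hclose (by simpa using hh₀.le)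
  simp only [abs_zero, add_zero, Complex.ofReal_zero, zero_mul, e1] at hle
  have hdist : ‖D.curve s - D.curve s₀‖ ≤ 2 * ‖z - D.curve s₀‖ := by
    have : D.curve s - D.curve s₀ = (z - D.curve s₀) - k * D.normal s := by rw [hzk]; ring
    rw [this]
    refine (norm_sub_le _ _).trans ?_
    rw [norm_mul, D.norm_normal, mul_one, Complex.norm_real, Real.norm_eq_abs]
    linarith
  have hmem : ((s + n, σ * k) : ℝ × ℝ) ∈ U ×ˢ W := by
    refine ⟨hUr ?_, hWδ ⟨hkpos, ?_⟩⟩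
    · rw [Metric.mem_ball, Real.dist_eq]
      exact lt_of_mul_lt_mul_left (by linarith) hc.le
    · rw [← abs_of_pos hkpos, hkabs]
      linarith
  have := hsub hmem
  simp only [mem_preimage, e1, e2, ← mul_assoc, hσ, one_mul, ← hzk] at this
  exact this

theorem tendsto_nhdsWithin_cover {E : Type*} {f : ℂ → E} {l : Filter E}
    (hτ : 0 < τ.im) (j : Fin M) (s₀ : ℝ)
    (h : Tendsto (fun p : ℝ × ℝ => f ((X.hole j).curve p.1 - p.2 * (X.hole j).normal p.1))
      (𝓝 s₀ ×ˢ 𝓝[>] 0) l) :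
    Tendsto f (𝓝[X.cover] ((X.hole j).curve s₀)) l := by
  obtain ⟨h₁, hh₁, -, hcol⟩ := X.exists_collar hτ j
  refine (X.hole j).tendsto_nhdsWithin (σ := -1) (by norm_num) hh₁ (fun s k hk hs => ?_) s₀
    (by simpa [sub_eq_add_neg] using h)
  rcases lt_trichotomy k 0 with hk' | rfl | hk'
  · linarith
  · refine absurd hs (X.notMem_cover_of_mem_closure (j := j) ?_)
    simpa using (X.hole j).curve_mem_closure s
  · exact absurd hs (X.notMem_cover_of_mem_closure (j := j) (subset_closure
      (hcol s k hk' (by linarith [le_abs_self k])).1))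

theorem _root_.DoublyPeriodic.C2Hole.tendsto_nhdsWithin_carrier {E : Type*} {f : ℂ → E}
    {l : Filter E} (D : C2Hole) (s₀ : ℝ)
    (h : Tendsto (fun p : ℝ × ℝ => f (D.curve p.1 + p.2 * D.normal p.1)) (𝓝 s₀ ×ˢ 𝓝[>] 0) l) :
    Tendsto f (𝓝[D.carrier] (D.curve s₀)) l := by
  obtain ⟨h₁, hh₁, hcol⟩ := D.exists_collar
  refine D.tendsto_nhdsWithin (σ := 1) (by norm_num) hh₁ (fun s k hk hs => ?_) s₀
    (by simpa using h)
  rcases lt_trichotomy k 0 with hk' | rfl | hk'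
  · have := (hcol s (-k) (by linarith) (by linarith [neg_abs_le k])).2
    rw [Complex.ofReal_neg, neg_mul, sub_neg_eq_add] at this
    exact absurd (subset_closure hs) this
  · refine absurd hs ?_
    simpa using D.curve_notMem_carrier s
  · linarith

theorem tendsto_doubleLayer (hτ : 0 < τ.im) (φ : C(X.boundary, ℝ)) (z₀ : X.boundary) :
    Tendsto (X.doubleLayer φ) (𝓝[X.cover] (z₀ : ℂ)) (𝓝 (X.doubleLayer φ z₀ - φ z₀ / 2)) := by
  obtain ⟨z, hz⟩ := z₀
  obtain ⟨j, s, rfl⟩ := X.exists_eq_curve hz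
  exact X.tendsto_nhdsWithin_cover hτ j s (X.tendsto_doubleLayer_sub hτ φ j s)

end HoledTorus

/-! ### Solutions of the Dirichlet problem -/

namespace HoledTorus

variable {τ : ℂ} {M : ℕ} (X : HoledTorus τ M)

theorem add_mem_cover {z l : ℂ} (hz : z ∈ X.cover) (hl : l ∈ lattice τ) : z + l ∈ X.cover := by
  rw [mem_cover_iff] at hz ⊢
  intro j l' hl'
  rw [add_assoc]
  exact hz j _ (add_mem hl hl')

theorem add_mem_cover_iff {z l : ℂ} (hl : l ∈ lattice τ) : z + l ∈ X.cover ↔ z ∈ X.cover :=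
  ⟨fun h => by simpa using X.add_mem_cover h (neg_mem hl), fun h => X.add_mem_cover h hl⟩

open InnerProductSpace in
-- The difference, extended by zero over the holes and their translates, is continuous and periodic
-- in the plane and harmonic wherever it is not zero. The maximum principle for such functions makes
-- connectedness of Ω unnecessary.
theorem IsDirichletSolution.eqOn {X : HoledTorus τ M} (hτ : 0 < τ.im) (hM : 1 ≤ M)
    {g : C(X.boundary, ℝ)} {u v : ℂ → ℝ} (hu : X.IsDirichletSolution g u)
    (hv : X.IsDirichletSolution g v) : EqOn u v X.cover := by
  set W : ℂ → ℝ := X.cover.indicator (u - v) with hW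
  have hper : ∀ z, ∀ l ∈ lattice τ, W (z + l) = W z := fun z l hl => by
    by_cases hz : z ∈ X.cover
    · rw [hW, indicator_of_mem hz, indicator_of_mem (X.add_mem_cover hz hl), Pi.sub_apply,
        Pi.sub_apply, hu.periodic z hz l hl, hv.periodic z hz l hl]
    · rw [hW, indicator_of_notMem hz, indicator_of_notMem (mt (X.add_mem_cover_iff hl).1 hz)]
  have hloc : ∀ z ∈ X.cover, W =ᶠ[𝓝 z] u - v := fun z hz => by
    filter_upwards [(X.isOpen_cover hτ).mem_nhds hz] with w hw
    rw [hW, indicator_of_mem hw]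
  have hharm : ∀ z ∈ X.cover, HarmonicAt W z := fun z hz =>
    (harmonicAt_congr_nhds (hloc z hz)).2 ((hu.harmonic z hz).sub (hv.harmonic z hz))
  have hcl : ∀ j, ∀ z ∈ closure (X.hole j).carrier, ContinuousAt W z := fun j z hz => by
    have hzc := X.notMem_cover_of_mem_closure hz
    have hW0 : W z = 0 := by rw [hW, indicator_of_notMem hzc]
    by_cases hzD : z ∈ (X.hole j).carrier
    · have : W =ᶠ[𝓝 z] fun _ => 0 := by
        filter_upwards [(X.hole j).isOpen_carrier.mem_nhds hzD] with w hw
        rw [hW, indicator_of_notMem (X.notMem_cover_of_mem_closure (subset_closure hw))]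
      exact continuousAt_const.congr this.symm
    · have hzb : z ∈ X.boundary := mem_iUnion.2 ⟨j, by
        rw [(X.hole j).isOpen_carrier.frontier_eq]; exact ⟨hz, hzD⟩⟩
      have h1 := (hu.boundary_value ⟨z, hzb⟩).sub (hv.boundary_value ⟨z, hzb⟩)
      rw [sub_self] at h1
      rw [ContinuousAt, hW0, ← nhdsWithin_univ, ← union_compl_self X.cover, nhdsWithin_union]
      refine Tendsto.sup (h1.congr' ?_) (tendsto_const_nhds.congr' ?_)
      · filter_upwards [self_mem_nhdsWithin] with w hw
        rw [hW, indicator_of_mem hw, Pi.sub_apply]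
      · filter_upwards [self_mem_nhdsWithin] with w hw
        rw [hW, indicator_of_notMem hw]
  have hcont : Continuous W := continuous_iff_continuousAt.2 fun z => by
    by_cases hz : z ∈ X.cover
    · exact (hharm z hz).1.continuousAt
    · simp only [mem_cover_iff, not_forall, not_not] at hz
      obtain ⟨j, l, hl, h⟩ := hz
      have h1 := (hcl j _ h).comp' (f := fun z => z + l) (by fun_prop)
      exact h1.congr (.of_forall fun w => hper w l hl)
  have hzero : ∃ z, W z = 0 := ⟨(X.hole ⟨0, hM⟩).curve 0, by
    rw [hW, indicator_of_notMem
      (X.notMem_cover_of_mem_closure ((X.hole ⟨0, hM⟩).curve_mem_closure 0))]⟩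
  intro z hz
  have h0 := eq_zero_of_harmonicAt_of_ne_zero hcont
    (fun z hz => hharm z (mem_of_indicator_ne_zero hz)) hzero (isCompact_cell τ) (fun z => by
      obtain ⟨l, hl, x, hx, y, hy, he⟩ := exists_add_lattice_eq hτ z
      exact ⟨z + l, ⟨(x, y), ⟨hx, hy⟩, he.symm⟩, hper z l hl⟩) z
  rw [hW, indicator_of_mem hz] at h0
  exact sub_eq_zero.1 h0

theorem sub_notMem_lattice_of_mem_boundary {z w : ℂ} (hz : z ∈ X.boundary) {i : Fin M}
    (hw : w ∈ (X.hole i).carrier) : z - w ∉ lattice τ := by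
  obtain ⟨j, s, rfl⟩ := X.exists_eq_curve hz
  intro h
  obtain ⟨rfl, rfl⟩ := X.eq_of_sub_mem_lattice (X.curve_mem_holeNhd j s) (subset_closure hw) h
  exact (X.hole i).curve_notMem_carrier s hw

theorem kernel_add_lattice (hτ : 0 < τ.im) {z l : ℂ} {j : Fin M} {t : ℝ}
    (hz : z - (X.hole j).curve t ∉ lattice τ) (hl : l ∈ lattice τ) :
    X.kernel (z + l) j t = X.kernel z j t := by
  have hopen : IsOpen ((fun ξ => z - ξ) ⁻¹' (lattice τ : Set ℂ)ᶜ) :=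
    (isOpen_compl_lattice hτ).preimage (by fun_prop)
  have : (fun ξ => green τ (z + l - ξ)) =ᶠ[𝓝 ((X.hole j).curve t)] fun ξ => green τ (z - ξ) := by
    filter_upwards [hopen.mem_nhds hz] with ξ hξ
    rw [show z + l - ξ = z - ξ + l by ring, green_add_lattice hτ hξ hl]
  rw [kernel, kernel, this.fderiv_eq]

variable {β : Fin M → ℂ}

theorem representation_add_lattice (hβ : ∀ j, β j ∈ (X.hole j).carrier) (hτ : 0 < τ.im) (φ : C(X.boundary, ℝ)) (A : Fin M → ℝ)
    {z l : ℂ} (hz : z ∈ X.cover) (hl : l ∈ lattice τ) :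
    X.representation β φ A (z + l) = X.representation β φ A z := by
  rw [representation, representation, doubleLayer, doubleLayer]
  congr 1
  · refine Finset.sum_congr rfl fun j _ => ?_
    simp only [X.kernel_add_lattice hτ (X.sub_curve_notMem_lattice (Or.inl hz) j _) hl]
  · refine Finset.sum_congr rfl fun j _ => ?_
    rw [show z + l - β j = z - β j + l by ring, green_add_lattice hτ
      (X.sub_notMem_lattice_of_mem_cover hz (subset_closure (hβ j))) hl]

open InnerProductSpace in
theorem harmonicAt_doubleLayer (hτ : 0 < τ.im) (φ : C(X.boundary, ℝ)) {z : ℂ}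
    (hz : z ∈ X.offBoundary) : HarmonicAt (X.doubleLayer φ) z := by
  have hd : DifferentiableOn ℂ (X.complexPotential φ) X.offBoundary := fun w hw =>
    (X.hasDerivAt_complexPotential hτ φ hw).differentiableAt.differentiableWithinAt
  have ha : AnalyticAt ℂ (X.complexPotential φ) z :=
    hd.analyticAt ((X.isOpen_offBoundary hτ).mem_nhds hz)
  refine (harmonicAt_congr_nhds ?_).1 ha.harmonicAt_re
  filter_upwards [(X.isOpen_offBoundary hτ).mem_nhds hz] with w hw
  exact X.re_complexPotential hτ φ hw

open InnerProductSpace in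
-- Expanding (Im z - Im β_j)² gives a term (Im z)², which ∑ A_j = 0 removes, and terms affine in z,
-- which are real parts of holomorphic functions.
theorem harmonicAt_sum_green (hτ : 0 < τ.im) {A : Fin M → ℝ} (hA : ∑ j, A j = 0)
    {z : ℂ} (hz : ∀ j, z - β j ∉ lattice τ) :
    HarmonicAt (fun z => ∑ j, A j * green τ (z - β j)) z := by
  have hlog : ∀ j, HarmonicAt (fun z => Real.log ‖theta₁ τ (z - β j)‖) z := fun j => by
    have : AnalyticAt ℂ (fun z => theta₁ τ (z - β j)) z :=
      ((differentiable_theta₁ hτ).comp (by fun_prop : Differentiable ℂ fun z => z - β j)).analyticAt z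
    exact this.harmonicAt_log_norm (mt (theta₁_eq_zero_iff hτ).1 (hz j))
  have hlin : HarmonicAt (fun z => (∑ j, (A j : ℂ) *
      (((β j).im ^ 2 / (2 * τ.im) : ℝ) + Complex.I * z * ((β j).im / τ.im : ℝ))).re) z := by
    refine AnalyticAt.harmonicAt_re ?_
    refine Differentiable.analyticAt (by fun_prop) z
  have hsum : ∀ s : Finset (Fin M), HarmonicAt (fun z => ∑ j ∈ s,
      (-(1 / (2 * Real.pi)) * A j) * Real.log ‖theta₁ τ (z - β j)‖) z := fun s => by
    classical
    induction s using Finset.induction_on with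
    | empty => simp
    | insert a s ha ih =>
      simp only [Finset.sum_insert ha]
      exact ((hlog a).const_smul (c := -(1 / (2 * Real.pi)) * A a)).add ih
  have hall := (hsum Finset.univ).add hlin
  have e : (fun z => ∑ j, A j * green τ (z - β j)) = (fun z => ∑ j,
      (-(1 / (2 * Real.pi)) * A j) * Real.log ‖theta₁ τ (z - β j)‖) + fun z => (∑ j, (A j : ℂ) *
      (((β j).im ^ 2 / (2 * τ.im) : ℝ) + Complex.I * z * ((β j).im / τ.im : ℝ))).re := by
    funext z
    have h1 : ∀ j, A j * green τ (z - β j) = (-(1 / (2 * Real.pi)) * A j) *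
        Real.log ‖theta₁ τ (z - β j)‖ + (((A j : ℂ) *
        (((β j).im ^ 2 / (2 * τ.im) : ℝ) + Complex.I * z * ((β j).im / τ.im : ℝ))).re +
        A j * (z.im ^ 2 / (2 * τ.im))) := fun j => by
      rw [green]
      simp only [Complex.re_ofReal_mul, Complex.add_re, Complex.ofReal_re, Complex.re_mul_ofReal,
        Complex.I_mul_re, Complex.sub_im]
      field_simp
      ring
    rw [Finset.sum_congr rfl fun j _ => h1 j, Finset.sum_add_distrib, Finset.sum_add_distrib,
      ← Finset.sum_mul, hA, zero_mul, add_zero, Pi.add_apply, Complex.re_sum]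
  rw [e]
  exact hall

theorem BoundaryDoubleLayerEq.eq {X : HoledTorus τ M} (hτ : 0 < τ.im) {φ ψ : C(X.boundary, ℝ)}
    (h : X.BoundaryDoubleLayerEq φ ψ) (z₀ : X.boundary) : ψ z₀ = X.doubleLayer φ z₀ :=
  tendsto_nhds_unique (h z₀) (X.tendsto_truncatedDoubleLayer hτ φ z₀)

variable {X}

open InnerProductSpace in
theorem SolvesSystem.isDirichletSolution (hβ : ∀ j, β j ∈ (X.hole j).carrier) (hτ : 0 < τ.im)
    {g φ : C(X.boundary, ℝ)} {A : Fin M → ℝ}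
    (h : X.SolvesSystem β g φ A) : X.IsDirichletSolution g (X.representation β φ A) where
  periodic z hz l hl := X.representation_add_lattice hβ hτ φ A hz hl
  harmonic z hz := (X.harmonicAt_doubleLayer hτ φ (Or.inl hz)).add (harmonicAt_sum_green hτ h.sum_zero
    fun j => X.sub_notMem_lattice_of_mem_cover hz (subset_closure (hβ j)))
  boundary_value z₀ := by
    obtain ⟨ψ, hψ, heq⟩ := h.integral_eq
    have h1 := X.tendsto_doubleLayer hτ φ z₀
    have h2 : ContinuousAt (fun z => ∑ j, A j * green τ (z - β j)) z₀ :=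
      (harmonicAt_sum_green hτ h.sum_zero
        fun j => X.sub_notMem_lattice_of_mem_boundary z₀.2 (hβ j)).1.continuousAt
    have h3 := h1.add (h2.tendsto.mono_left nhdsWithin_le_nhds)
    rw [show X.doubleLayer φ z₀ - φ z₀ / 2 + ∑ j, A j * green τ ((z₀ : ℂ) - β j) = g z₀ by
      rw [← heq z₀, hψ.eq hτ z₀]; ring] at h3
    exact h3

end HoledTorus

/-! ### The flux across curves parallel to the boundary -/

namespace C2Hole

variable (D : C2Hole)

theorem parallelCurve_eq (h t : ℝ) :
    D.parallelCurve h t = D.curve t + ((-h : ℝ) : ℂ) * D.normal t := by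
  rw [parallelCurve]; push_cast; ring

theorem hasDerivAt_parallelCurve (h t : ℝ) : HasDerivAt (D.parallelCurve h)
    (deriv D.curve t + ((-h : ℝ) : ℂ) * deriv D.normal t) t := by
  rw [funext (D.parallelCurve_eq h)]
  exact D.hasDerivAt_offset (-h) t

theorem deriv_parallelCurve (h : ℝ) : deriv (D.parallelCurve h) =
    fun t => deriv D.curve t + ((-h : ℝ) : ℂ) * deriv D.normal t :=
  funext fun t => (D.hasDerivAt_parallelCurve h t).deriv

theorem continuous_parallelCurve (h : ℝ) : Continuous (D.parallelCurve h) :=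
  continuous_iff_continuousAt.2 fun t => (D.hasDerivAt_parallelCurve h t).continuousAt

theorem continuous_deriv_parallelCurve (h : ℝ) : Continuous (deriv (D.parallelCurve h)) := by
  rw [deriv_parallelCurve]
  have := D.continuous_deriv_curve
  have := D.continuous_deriv_normal
  fun_prop

theorem periodic_deriv_normal : Function.Periodic (deriv D.normal) 1 := fun t => by
  have : (fun s => D.normal (s + 1)) = D.normal := funext D.periodic_normal
  rw [← deriv_comp_add_const, this]

theorem exists_norm_deriv_normal_le : ∃ C > 0, ∀ t, ‖deriv D.normal t‖ ≤ C :=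
  D.periodic_deriv_normal.exists_norm_le D.continuous_deriv_normal

/-- The derivative of the unit normal is tangential. -/
theorem deriv_normal_eq (t : ℝ) :
    deriv D.normal t = Complex.I * ((starRingEnd ℂ (D.normal t) * deriv D.normal t).im : ℂ) *
      D.normal t := by
  have h1 : ∀ t, D.normal t * starRingEnd ℂ (D.normal t) = 1 := fun t => by
    rw [Complex.mul_conj, Complex.normSq_eq_norm_sq, D.norm_normal]
    simp
  have hconj : HasDerivAt (fun t => starRingEnd ℂ (D.normal t)) (starRingEnd ℂ (deriv D.normal t)) t :=
    Complex.conjCLE.toContinuousLinearMap.hasFDerivAt.comp_hasDerivAt t (D.hasDerivAt_normal t)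
  have h2 := (D.hasDerivAt_normal t).mul hconj
  have h3 : (D.normal * fun t => starRingEnd ℂ (D.normal t)) = fun _ => (1 : ℂ) := funext h1
  rw [h3] at h2
  have h4 := h2.unique (hasDerivAt_const t 1)
  have h5 : (starRingEnd ℂ (D.normal t) * deriv D.normal t).re = 0 := by
    have := congrArg Complex.re h4
    simp only [Complex.add_re, Complex.mul_re, Complex.conj_re, Complex.conj_im, Complex.zero_re]
      at this ⊢
    linarith
  have h6 : starRingEnd ℂ (D.normal t) * deriv D.normal t =
      Complex.I * ((starRingEnd ℂ (D.normal t) * deriv D.normal t).im : ℂ) := by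
    conv_lhs => rw [← Complex.re_add_im (starRingEnd ℂ (D.normal t) * deriv D.normal t), h5]
    simp [mul_comm]
  rw [← h6]
  linear_combination (-deriv D.normal t) * h1 t

/-- The derivative of the normal is a real multiple μ of iν, so the parallel curve has derivative
(|γ'| - hμ)iν. The factor is nonnegative for |h| ≤ m/C, and the direction of the normal is kept. -/
theorem exists_normal_mul_norm_deriv_parallelCurve : ∃ h₀ > 0, ∀ h, |h| ≤ h₀ → ∀ t,
    D.normal t * ‖deriv (D.parallelCurve h) t‖ = -Complex.I * deriv (D.parallelCurve h) t := by
  obtain ⟨C, hC, hνC⟩ := D.exists_norm_deriv_normal_le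
  obtain ⟨m, hm, hmd⟩ := D.exists_le_norm_deriv
  refine ⟨m / C, by positivity, fun h hh t => ?_⟩
  set μ := (starRingEnd ℂ (D.normal t) * deriv D.normal t).im with hμ
  have hμC : |μ| ≤ C := by
    refine (Complex.abs_im_le_norm _).trans ?_
    rw [norm_mul, RCLike.norm_conj, D.norm_normal, one_mul]
    exact hνC t
  have e : deriv (D.parallelCurve h) t =
      ((‖deriv D.curve t‖ - h * μ : ℝ) : ℂ) * (Complex.I * D.normal t) := by
    rw [deriv_parallelCurve]
    simp only
    rw [D.deriv_normal_eq t, ← hμ]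
    conv_lhs => rw [D.deriv_curve_eq t]
    push_cast
    ring
  have hpos : 0 ≤ ‖deriv D.curve t‖ - h * μ := by
    have h1 : |h * μ| ≤ m := by
      rw [abs_mul]
      calc |h| * |μ| ≤ m / C * C := mul_le_mul hh hμC (abs_nonneg _) (by positivity)
        _ = m := by field_simp
    linarith [hmd t, le_abs_self (h * μ)]
  rw [e, norm_mul, norm_mul, Complex.norm_I, D.norm_normal, Complex.norm_real,
    Real.norm_of_nonneg hpos, one_mul, mul_one]
  linear_combination (((‖deriv D.curve t‖ - h * μ : ℝ) : ℂ) * D.normal t) * Complex.I_mul_I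

theorem parallelCurve_one (h : ℝ) : D.parallelCurve h 1 = D.parallelCurve h 0 := by
  rw [parallelCurve_eq, parallelCurve_eq]
  exact offset_one (-h)

end C2Hole

/-! ### The gradient of the representation and the winding of ϑ₁ -/

namespace HoledTorus

variable {τ : ℂ} {M : ℕ} (X : HoledTorus τ M) {β : Fin M → ℂ}

/-- The complex derivative of the representation, whose real part is its directional derivative. -/
def representationDeriv (β : Fin M → ℂ) (φ : C(X.boundary, ℝ)) (A : Fin M → ℝ) (z : ℂ) : ℂ :=
  deriv (X.complexPotential φ) z + ∑ i, (A i : ℂ) * greenGrad τ (z - β i)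

theorem hasFDerivAt_representation (hβ : ∀ j, β j ∈ (X.hole j).carrier) (hτ : 0 < τ.im)
    (φ : C(X.boundary, ℝ)) (A : Fin M → ℝ) {z : ℂ} (hz : z ∈ X.cover) :
    HasFDerivAt (X.representation β φ A) (reMul (X.representationDeriv β φ A z)) z := by
  have h1 : HasFDerivAt (X.doubleLayer φ) (reMul (deriv (X.complexPotential φ) z)) z := by
    refine (X.hasDerivAt_complexPotential hτ φ (Or.inl hz)).hasFDerivAt_re.congr_of_eventuallyEq ?_
    filter_upwards [(X.isOpen_offBoundary hτ).mem_nhds (Or.inl hz)] with w hw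
    exact (X.re_complexPotential hτ φ hw).symm
  have h2 : ∀ i, HasFDerivAt (fun z => green τ (z - β i)) (reMul (greenGrad τ (z - β i))) z :=
    fun i => (hasFDerivAt_comp_sub (f := green τ) (β i)).2 (hasFDerivAt_green hτ
      (X.sub_notMem_lattice_of_mem_cover hz (subset_closure (hβ i))))
  have h3 := h1.add (HasFDerivAt.fun_sum (u := Finset.univ) fun i _ => (h2 i).const_mul (A i))
  convert! h3 using 1
  ext v
  simp only [reMul_apply, representationDeriv, add_apply,
    sum_apply, smul_apply, smul_eq_mul, add_mul,
    Finset.sum_mul, Complex.add_re, Complex.re_sum, mul_assoc, Complex.re_ofReal_mul]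

theorem continuousOn_representationDeriv (hβ : ∀ j, β j ∈ (X.hole j).carrier) (hτ : 0 < τ.im)
    (φ : C(X.boundary, ℝ)) (A : Fin M → ℝ) :
    ContinuousOn (X.representationDeriv β φ A) X.cover := by
  have hd : DifferentiableOn ℂ (X.complexPotential φ) X.offBoundary := fun w hw =>
    (X.hasDerivAt_complexPotential hτ φ hw).differentiableAt.differentiableWithinAt
  refine ((hd.deriv (X.isOpen_offBoundary hτ)).continuousOn.mono subset_union_left).add
    (continuousOn_finsetSum _ fun i _ => continuousOn_const.mul fun z hz => ?_)
  exact ((continuousAt_greenGrad hτ (X.sub_notMem_lattice_of_mem_cover hz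
    (subset_closure (hβ i)))).comp' (f := fun z => z - β i) (by fun_prop)).continuousWithinAt

/-- For i ≠ j there is no zero near the closed hole, so the curve can be pushed into the hole, where
the integral is 0. For i = j the factor ϑ₁(w)/w is treated in the same way, and the factor z - β_i
gives the clockwise winding number. -/
theorem offsetIntegral_theta₁ (hβ : ∀ j, β j ∈ (X.hole j).carrier) (hτ : 0 < τ.im) (j : Fin M) :
    ∃ h₀ > 0, ∀ h, 0 < h → h ≤ h₀ → ∀ i,
      (X.hole j).offsetIntegral (fun z => theta₁ τ (z - β i)) (-h) =
        if i = j then -(2 * Real.pi * Complex.I) else 0 := by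
  obtain ⟨h₀, hh₀, hnhd, hcol⟩ := X.exists_collar hτ j
  refine ⟨h₀, hh₀, fun h h1 h2 i => ?_⟩
  have hzero : ∀ k : ℂ → ℂ, Differentiable ℂ k → (∀ z ∈ X.holeNhd j, k z ≠ 0) →
      (X.hole j).offsetIntegral k (-h) = 0 := fun k hk hk0 => by
    rw [C2Hole.offsetIntegral_eq (D := X.hole j) (X.isOpen_holeNhd hτ j) hk.differentiableOn
      (isPreconnected_Icc (a := -h₀) (b := h₀)) (h := -h) (h' := h₀)
      (fun h hh t => hnhd t h (abs_le.2 hh)) (fun h hh t => hk0 _ (hnhd t h (abs_le.2 hh)))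
      ⟨by linarith, by linarith⟩ ⟨by linarith, le_rfl⟩]
    exact C2Hole.offsetIntegral_eq_zero_of_mem_carrier (X.isOpen_holeNhd hτ j) hk.differentiableOn
      (subset_closure.trans (X.closure_subset_holeNhd j))
      (fun z hz => hk0 z (X.closure_subset_holeNhd j (subset_closure hz)))
      fun t => (hcol t h₀ hh₀ le_rfl).1
  by_cases hij : i = j
  swap
  · rw [if_neg hij]
    refine hzero _ ((differentiable_theta₁ hτ).comp (by fun_prop)) fun z hz h0 => hij ?_
    exact (X.eq_of_sub_mem_lattice hz (subset_closure (hβ i)) ((theta₁_eq_zero_iff hτ).1 h0)).1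
  subst hij
  rw [if_pos rfl]
  have hdQ : Differentiable ℂ fun z => thetaQuot τ (z - β i) :=
    (differentiable_thetaQuot hτ).comp (by fun_prop)
  have hQ0 : ∀ z ∈ X.holeNhd i, thetaQuot τ (z - β i) ≠ 0 := fun z hz =>
    thetaQuot_ne_zero hτ fun h => sub_eq_zero.2
      (X.eq_of_sub_mem_lattice hz (subset_closure (hβ i)) h).2
  have hQ := hzero _ hdQ hQ0
  have hne : ∀ k ∈ Icc (-h₀) 0, ∀ t, (X.hole i).curve t + k * (X.hole i).normal t - β i ≠ 0 :=
    fun k hk t he => by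
      rcases hk.2.eq_or_lt with rfl | hk0
      · refine (X.hole i).curve_notMem_carrier t ?_
        rw [Complex.ofReal_zero, zero_mul, add_zero] at he
        rw [sub_eq_zero.1 he]
        exact hβ i
      · have := (hcol t (-k) (by linarith) (by linarith [hk.1])).2
        rw [Complex.ofReal_neg, neg_mul, sub_neg_eq_add, sub_eq_zero.1 he] at this
        exact X.notMem_cover_of_mem_closure (subset_closure (hβ i)) this
  have hwind : (X.hole i).offsetIntegral (fun z => z - β i) (-h) = -(2 * Real.pi * Complex.I) := by
    rw [C2Hole.offsetIntegral_eq (D := X.hole i) isOpen_univ (k := fun z => z - β i)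
      (by fun_prop) (isPreconnected_Icc (a := -h₀) (b := 0)) (h := -h) (h' := 0)
      (fun _ _ _ => mem_univ _) hne ⟨by linarith, by linarith⟩ ⟨by linarith, le_rfl⟩,
      ← C2Hole.cauchy_one_eq (hβ i), C2Hole.cauchy_one, C2Hole.offsetIntegral]
    simp
  have hh : -h ∈ Icc (-h₀) 0 := ⟨by linarith, by linarith⟩
  have hc1 := (X.hole i).continuous_curve
  have hc2 := (X.hole i).continuous_deriv_curve
  have hc3 := (X.hole i).continuous_normal
  have hc4 := (X.hole i).continuous_deriv_normal
  have hne' := hne _ hh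
  have hQne : ∀ t, thetaQuot τ ((X.hole i).curve t + ((-h : ℝ) : ℂ) * (X.hole i).normal t - β i) ≠ 0 :=
    fun t => hQ0 _ (hnhd t _ (abs_le.2 ⟨hh.1, by linarith⟩))
  have hcQ : Continuous (thetaQuot τ) := (differentiable_thetaQuot hτ).continuous
  have hcQ' : Continuous (deriv (thetaQuot τ)) :=
    ((differentiable_thetaQuot hτ).contDiff (n := 2)).continuous_deriv (by norm_num)
  rw [C2Hole.offsetIntegral] at hQ hwind ⊢
  simp only [deriv_comp_sub_const, deriv_sub_const, deriv_id''] at hQ hwind ⊢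
  have hI1 : Continuous fun t => (deriv (X.hole i).curve t + ((-h : ℝ) : ℂ) *
      deriv (X.hole i).normal t) * 1 /
      ((X.hole i).curve t + ((-h : ℝ) : ℂ) * (X.hole i).normal t - β i) := by
    fun_prop (disch := assumption)
  have hI2 : Continuous fun t => (deriv (X.hole i).curve t + ((-h : ℝ) : ℂ) *
      deriv (X.hole i).normal t) *
      deriv (thetaQuot τ) ((X.hole i).curve t + ((-h : ℝ) : ℂ) * (X.hole i).normal t - β i) /
      thetaQuot τ ((X.hole i).curve t + ((-h : ℝ) : ℂ) * (X.hole i).normal t - β i) := by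
    fun_prop (disch := assumption)
  have key := intervalIntegral.integral_add (μ := volume) (hI1.intervalIntegrable 0 1)
    (hI2.intervalIntegrable 0 1)
  rw [hwind, hQ, add_zero] at key
  rw [← key]
  refine intervalIntegral.integral_congr fun t _ => ?_
  have hd : deriv (theta₁ τ) = fun z => thetaQuot τ z + z * deriv (thetaQuot τ) z := by
    rw [funext (theta₁_eq_mul_thetaQuot τ)]
    funext z
    simpa using! ((hasDerivAt_id z).mul (differentiable_thetaQuot hτ z).hasDerivAt).deriv
  have e1 := hne' t
  have e2 := hQne t
  simp only [hd, theta₁_eq_mul_thetaQuot τ (_ - β i)]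
  field_simp

end HoledTorus

/-! ### The flux of the representation -/

namespace HoledTorus

variable {τ : ℂ} {M : ℕ} (X : HoledTorus τ M) {β : Fin M → ℂ}

theorem parallelCurve_mem_cover (hτ : 0 < τ.im) (j : Fin M) :
    ∃ h₀ > 0, ∀ h, 0 < h → h ≤ h₀ → ∀ t, (X.hole j).parallelCurve h t ∈ X.cover := by
  obtain ⟨h₀, hh₀, -, hcol⟩ := X.exists_collar hτ j
  exact ⟨h₀, hh₀, fun h h1 h2 t => (hcol t h h1 h2).2⟩

theorem fderiv_representation_normal (hβ : ∀ j, β j ∈ (X.hole j).carrier) (hτ : 0 < τ.im)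
    (φ : C(X.boundary, ℝ)) (A : Fin M → ℝ) {j : Fin M} {h t : ℝ}
    (hp : (X.hole j).parallelCurve h t ∈ X.cover)
    (hν : (X.hole j).normal t * ‖deriv ((X.hole j).parallelCurve h) t‖ =
      -Complex.I * deriv ((X.hole j).parallelCurve h) t) :
    fderiv ℝ (X.representation β φ A) ((X.hole j).parallelCurve h t) ((X.hole j).normal t) *
      ‖deriv ((X.hole j).parallelCurve h) t‖ =
      (X.representationDeriv β φ A ((X.hole j).parallelCurve h t) *
        deriv ((X.hole j).parallelCurve h) t).im := by
  rw [(X.hasFDerivAt_representation hβ hτ φ A hp).fderiv, reMul_apply, ← Complex.re_mul_ofReal,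
    mul_assoc, hν]
  simp only [Complex.mul_re, Complex.mul_im, Complex.neg_re, Complex.neg_im, Complex.I_re,
    Complex.I_im]
  ring

theorem intervalIntegral_im {f : ℝ → ℂ} {a b : ℝ} (hf : IntervalIntegrable f volume a b) :
    (∫ t in a..b, f t).im = ∫ t in a..b, (f t).im :=
  (Complex.imCLM.intervalIntegral_comp_comm hf).symm

/-- The constant Im β_i drops out because the curve is closed. The non-holomorphic remainder is
therefore independent of i, and ∑ A_i = 0 will cancel it. -/
theorem integral_greenGrad_parallelCurve (hτ : 0 < τ.im) (j i : Fin M) {h : ℝ}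
    (hp : ∀ t, (X.hole j).parallelCurve h t ∈ X.cover) (hβ : ∀ j, β j ∈ (X.hole j).carrier) :
    ∫ t in (0 : ℝ)..1, greenGrad τ ((X.hole j).parallelCurve h t - β i) *
      deriv ((X.hole j).parallelCurve h) t =
    -(1 / (2 * Real.pi)) * (X.hole j).offsetIntegral (fun z => theta₁ τ (z - β i)) (-h) -
      Complex.I / τ.im * ∫ t in (0 : ℝ)..1, (((X.hole j).parallelCurve h t).im : ℂ) *
        deriv ((X.hole j).parallelCurve h) t := by
  have hc := (X.hole j).continuous_parallelCurve h
  have hc' := (X.hole j).continuous_deriv_parallelCurve h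
  have hd : ∀ t, HasDerivAt ((X.hole j).parallelCurve h)
      (deriv ((X.hole j).parallelCurve h) t) t := fun t =>
    ((X.hole j).hasDerivAt_parallelCurve h t).differentiableAt.hasDerivAt
  have hzero : ∫ t in (0 : ℝ)..1, deriv ((X.hole j).parallelCurve h) t = 0 := by
    rw [intervalIntegral.integral_eq_sub_of_hasDerivAt (fun t _ => hd t)
      (hc'.intervalIntegrable _ _), (X.hole j).parallelCurve_one, sub_self]
  have hθ := differentiable_theta₁ hτ
  have hcθ := hθ.continuous
  have hcθ' : Continuous (deriv (theta₁ τ)) := (hθ.contDiff (n := 2)).continuous_deriv (by norm_num)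
  have hne : ∀ t, theta₁ τ ((X.hole j).parallelCurve h t - β i) ≠ 0 := fun t =>
    mt (theta₁_eq_zero_iff hτ).1 (X.sub_notMem_lattice_of_mem_cover (hp t) (subset_closure (hβ i)))
  have e1 : (X.hole j).offsetIntegral (fun z => theta₁ τ (z - β i)) (-h) =
      ∫ t in (0 : ℝ)..1, deriv ((X.hole j).parallelCurve h) t *
        deriv (theta₁ τ) ((X.hole j).parallelCurve h t - β i) /
        theta₁ τ ((X.hole j).parallelCurve h t - β i) := by
    simp only [C2Hole.offsetIntegral, deriv_comp_sub_const, C2Hole.deriv_parallelCurve,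
      C2Hole.parallelCurve_eq]
  have hI1 : Continuous fun t => deriv ((X.hole j).parallelCurve h) t *
        deriv (theta₁ τ) ((X.hole j).parallelCurve h t - β i) /
        theta₁ τ ((X.hole j).parallelCurve h t - β i) := by
    fun_prop (disch := assumption)
  have hI2 : Continuous fun t => (((X.hole j).parallelCurve h t).im : ℂ) *
      deriv ((X.hole j).parallelCurve h) t :=
    (Complex.continuous_ofReal.comp (Complex.continuous_im.comp hc)).mul hc'
  have hI3 : Continuous fun t => Complex.I / τ.im * ((((X.hole j).parallelCurve h t).im : ℂ) *
      deriv ((X.hole j).parallelCurve h) t +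
      -((β i).im : ℂ) * deriv ((X.hole j).parallelCurve h) t) :=
    (hI2.add (hc'.const_mul _)).const_mul _
  rw [e1, ← add_zero (∫ t in (0 : ℝ)..1, (((X.hole j).parallelCurve h t).im : ℂ) *
      deriv ((X.hole j).parallelCurve h) t), ← mul_zero (-((β i).im : ℂ)), ← hzero,
    ← intervalIntegral.integral_const_mul, ← intervalIntegral.integral_const_mul,
    ← intervalIntegral.integral_add (hI2.intervalIntegrable _ _)
      ((hc'.const_mul _).intervalIntegrable _ _), ← intervalIntegral.integral_const_mul,
    ← intervalIntegral.integral_sub ((hI1.const_mul _).intervalIntegrable _ _)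
      (hI3.intervalIntegrable _ _)]
  refine intervalIntegral.integral_congr fun t _ => ?_
  simp only [greenGrad, logDeriv_apply, Complex.sub_im]
  push_cast
  ring

/-- The holomorphic potential is single-valued along the curve and contributes nothing. What remains
is A_j times -(1/2π)(-2πi). The flux is the imaginary part of this integral. -/
theorem integral_representationDeriv_parallelCurve (hβ : ∀ j, β j ∈ (X.hole j).carrier)
    (hτ : 0 < τ.im) (φ : C(X.boundary, ℝ)) {A : Fin M → ℝ} (hA : ∑ j, A j = 0) (j : Fin M) :
    ∃ h₀ > 0, ∀ h, 0 < h → h ≤ h₀ →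
      ∫ t in (0 : ℝ)..1, X.representationDeriv β φ A ((X.hole j).parallelCurve h t) *
        deriv ((X.hole j).parallelCurve h) t = Complex.I * A j := by
  obtain ⟨h₁, hh₁, hmem⟩ := X.parallelCurve_mem_cover hτ j
  obtain ⟨h₂, hh₂, hoff⟩ := X.offsetIntegral_theta₁ hβ hτ j
  refine ⟨min h₁ h₂, lt_min hh₁ hh₂, fun h h0 hh => ?_⟩
  have hp := hmem h h0 (hh.trans (min_le_left _ _))
  have hc := (X.hole j).continuous_parallelCurve h
  have hc' := (X.hole j).continuous_deriv_parallelCurve h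
  have hF : ∀ t, HasDerivAt (fun t => X.complexPotential φ ((X.hole j).parallelCurve h t))
      (deriv (X.complexPotential φ) ((X.hole j).parallelCurve h t) *
        deriv ((X.hole j).parallelCurve h) t) t := fun t =>
    (X.hasDerivAt_complexPotential hτ φ (Or.inl (hp t))).comp t
      ((X.hole j).hasDerivAt_parallelCurve h t).differentiableAt.hasDerivAt
  have hdF : DifferentiableOn ℂ (X.complexPotential φ) X.offBoundary := fun w hw =>
    (X.hasDerivAt_complexPotential hτ φ hw).differentiableAt.differentiableWithinAt
  have hcF : Continuous fun t => deriv (X.complexPotential φ) ((X.hole j).parallelCurve h t) := by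
    rw [← continuousOn_univ]
    exact (hdF.deriv (X.isOpen_offBoundary hτ)).continuousOn.comp hc.continuousOn
      fun t _ => Or.inl (hp t)
  have hcg : ∀ i, Continuous fun t => greenGrad τ ((X.hole j).parallelCurve h t - β i) := fun i =>
    continuous_iff_continuousAt.2 fun t => (continuousAt_greenGrad hτ
      (X.sub_notMem_lattice_of_mem_cover (hp t) (subset_closure (hβ i)))).comp'
      (f := fun t => (X.hole j).parallelCurve h t - β i) (by fun_prop)
  have hcFm : Continuous fun t => deriv (X.complexPotential φ) ((X.hole j).parallelCurve h t) *
      deriv ((X.hole j).parallelCurve h) t := hcF.mul hc'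
  have hFint := intervalIntegral.integral_eq_sub_of_hasDerivAt (a := 0) (b := 1) (fun t _ => hF t)
    (hcFm.intervalIntegrable _ _)
  rw [(X.hole j).parallelCurve_one, sub_self] at hFint
  have e : (fun t => X.representationDeriv β φ A ((X.hole j).parallelCurve h t) *
      deriv ((X.hole j).parallelCurve h) t) = fun t =>
      deriv (X.complexPotential φ) ((X.hole j).parallelCurve h t) *
        deriv ((X.hole j).parallelCurve h) t + ∑ i, (A i : ℂ) *
        (greenGrad τ ((X.hole j).parallelCurve h t - β i) *
          deriv ((X.hole j).parallelCurve h) t) := funext fun t => by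
    rw [representationDeriv, add_mul, Finset.sum_mul]
    simp only [mul_assoc]
  have hcs : ∀ i, Continuous fun t => (A i : ℂ) *
      (greenGrad τ ((X.hole j).parallelCurve h t - β i) *
        deriv ((X.hole j).parallelCurve h) t) := fun i => ((hcg i).mul hc').const_mul _
  have hA' : ∑ i, (A i : ℂ) = 0 := by exact_mod_cast hA
  rw [e, intervalIntegral.integral_add (hcFm.intervalIntegrable _ _)
    ((continuous_finsetSum _ fun i _ => hcs i).intervalIntegrable _ _), hFint, zero_add,
    intervalIntegral.integral_finsetSum fun i _ => (hcs i).intervalIntegrable _ _]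
  simp only [intervalIntegral.integral_const_mul, X.integral_greenGrad_parallelCurve hτ j _ hp hβ,
    hoff h h0 (hh.trans (min_le_right _ _)), mul_sub, Finset.sum_sub_distrib]
  rw [← Finset.sum_mul, hA', zero_mul, sub_zero]
  simp only [mul_ite, mul_zero, Finset.sum_ite_eq', Finset.mem_univ, if_true]
  have hpi : (Real.pi : ℂ) ≠ 0 := by exact_mod_cast Real.pi_ne_zero
  field_simp

theorem eventually_parallelFlux (hβ : ∀ j, β j ∈ (X.hole j).carrier)
    (hτ : 0 < τ.im) (φ : C(X.boundary, ℝ)) {A : Fin M → ℝ} (hA : ∑ j, A j = 0) (j : Fin M) :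
    ∃ h₀ > 0, ∀ h, 0 < h → h ≤ h₀ → (∀ t, (X.hole j).parallelCurve h t ∈ X.cover) ∧
      (Continuous fun t => fderiv ℝ (X.representation β φ A) ((X.hole j).parallelCurve h t)
        ((X.hole j).normal t) * ‖deriv ((X.hole j).parallelCurve h) t‖) ∧
      (X.hole j).parallelFlux (X.representation β φ A) h = A j := by
  obtain ⟨h₁, hh₁, hmem⟩ := X.parallelCurve_mem_cover hτ j
  obtain ⟨h₂, hh₂, hint⟩ := X.integral_representationDeriv_parallelCurve hβ hτ φ hA j
  obtain ⟨h₃, hh₃, hnor⟩ := (X.hole j).exists_normal_mul_norm_deriv_parallelCurve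
  refine ⟨min h₁ (min h₂ h₃), by positivity, fun h h0 hh => ?_⟩
  have hp := hmem h h0 (hh.trans (min_le_left _ _))
  have hν := hnor h (by
    rw [abs_of_pos h0]
    exact hh.trans ((min_le_right _ _).trans (min_le_right _ _)))
  have hcf : Continuous fun t => X.representationDeriv β φ A ((X.hole j).parallelCurve h t) *
      deriv ((X.hole j).parallelCurve h) t := by
    refine Continuous.mul ?_ ((X.hole j).continuous_deriv_parallelCurve h)
    rw [← continuousOn_univ]
    exact (X.continuousOn_representationDeriv hβ hτ φ A).comp
      ((X.hole j).continuous_parallelCurve h).continuousOn fun t _ => hp t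
  have e := funext fun t => X.fderiv_representation_normal hβ hτ φ A (hp t) (hν t)
  refine ⟨hp, ?_, ?_⟩
  · rw [e]
    exact Complex.continuous_im.comp hcf
  · rw [C2Hole.parallelFlux, e, ← intervalIntegral_im (hcf.intervalIntegrable _ _),
      hint h h0 (hh.trans ((min_le_right _ _).trans (min_le_left _ _)))]
    simp

/-- Limits give local bounds, which compactness makes uniform. The bound serves as a dominating
constant when parallel curves tend to the boundary. -/
theorem exists_bound_of_tendsto_curve {E : Type*} [NormedAddCommGroup E] {f : ℂ → E} {S : Set ℂ}
    (D : C2Hole) {L : ℝ → E} (h : ∀ t, Tendsto f (𝓝[S] (D.curve t)) (𝓝 (L t))) :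
    ∃ C, ∃ δ > 0, ∀ z ∈ S, ∀ t, dist z (D.curve t) < δ → ‖f z‖ ≤ C := by
  have hcomp : IsCompact (range D.curve) := by
    rw [D.range_curve]
    exact D.isCompact_closure.of_isClosed_subset isClosed_frontier frontier_subset_closure
  obtain ⟨C, V, hV, hsub, hC⟩ := hcomp.induction_on
    (p := fun K => ∃ C, ∃ V, IsOpen V ∧ K ⊆ V ∧ ∀ z ∈ V ∩ S, ‖f z‖ ≤ C)
    ⟨0, ∅, isOpen_empty, subset_rfl, by simp⟩
    (fun K K' hK ⟨C, V, h1, h2, h3⟩ => ⟨C, V, h1, hK.trans h2, h3⟩)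
    (fun K K' ⟨C, V, h1, h2, h3⟩ ⟨C', V', h1', h2', h3'⟩ => ⟨max C C', V ∪ V', h1.union h1',
      union_subset_union h2 h2', by
        rintro z ⟨hz | hz, hzS⟩
        · exact (h3 z ⟨hz, hzS⟩).trans (le_max_left _ _)
        · exact (h3' z ⟨hz, hzS⟩).trans (le_max_right _ _)⟩)
    (by
      rintro _ ⟨t, rfl⟩
      have h1 : ∀ᶠ z in 𝓝[S] (D.curve t), ‖f z‖ ≤ ‖L t‖ + 1 :=
        ((h t).norm.eventually_lt_const (lt_add_one _)).mono fun _ h => h.le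
      obtain ⟨V, hV, htV, hb⟩ := mem_nhdsWithin.1 h1
      exact ⟨V, mem_nhdsWithin_of_mem_nhds (hV.mem_nhds htV), _, V, hV, subset_rfl, hb⟩)
  obtain ⟨δ, hδ, hth⟩ := hcomp.exists_thickening_subset_open hV hsub
  exact ⟨C, δ, hδ, fun z hz t hd => hC z ⟨hth (Metric.mem_thickening_iff.2 ⟨_, ⟨t, rfl⟩, hd⟩), hz⟩⟩

/-- The flux across parallel curves does not depend on h for small h. If the gradient extends
continuously, dominated convergence identifies its limit as the boundary integral. -/
theorem hasFlux_representation (hβ : ∀ j, β j ∈ (X.hole j).carrier)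
    (hτ : 0 < τ.im) (φ : C(X.boundary, ℝ)) {A : Fin M → ℝ} (hA : ∑ j, A j = 0) (j : Fin M) :
    X.HasFlux (X.representation β φ A) j (A j) := by
  obtain ⟨h₀, hh₀, hflux⟩ := X.eventually_parallelFlux hβ hτ φ hA j
  refine ⟨?_, fun L hL => ?_⟩
  · filter_upwards [Ioc_mem_nhdsGT hh₀] with h hh
    exact ⟨(hflux h hh.1 hh.2).1, (hflux h hh.1 hh.2).2.2⟩
  · obtain ⟨C, δ, hδ, hC⟩ := exists_bound_of_tendsto_curve (X.hole j) hL
    obtain ⟨B, hB, hνB⟩ := (X.hole j).exists_norm_deriv_normal_le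
    obtain ⟨G, hG, hγG⟩ := (X.hole j).exists_norm_deriv_le
    set u := X.representation β φ A
    have hdist : ∀ h, 0 < h → ∀ t, dist ((X.hole j).parallelCurve h t) ((X.hole j).curve t) = h :=
      fun h h0 t => by
        rw [dist_eq_norm, C2Hole.parallelCurve, sub_sub_cancel_left, norm_neg, norm_mul,
          (X.hole j).norm_normal, mul_one, Complex.norm_real, Real.norm_of_nonneg h0.le]
    have hlim : Tendsto (fun h => (X.hole j).parallelFlux u h) (𝓝[>] 0)
        (𝓝 ((X.hole j).arcIntegral fun t => L t ((X.hole j).normal t))) := by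
      refine intervalIntegral.tendsto_integral_filter_of_dominated_convergence
        (fun _ => C * (G + h₀ * B)) ?_ ?_ intervalIntegrable_const ?_
      · filter_upwards [Ioc_mem_nhdsGT hh₀] with h hh
        exact (hflux h hh.1 hh.2).2.1.aestronglyMeasurable
      · filter_upwards [Ioc_mem_nhdsGT hh₀, Ioo_mem_nhdsGT hδ] with h hh hhδ
        refine .of_forall fun t _ => ?_
        have h1 := hC _ ((hflux h hh.1 hh.2).1 t) t ((hdist h hh.1 t).trans_lt hhδ.2)
        rw [norm_mul]
        refine mul_le_mul ?_ ?_ (norm_nonneg _) ((norm_nonneg _).trans h1)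
        · refine ((fderiv ℝ u _).le_opNorm _).trans ?_
          rwa [(X.hole j).norm_normal, mul_one]
        · rw [norm_norm, C2Hole.deriv_parallelCurve]
          refine (norm_add_le _ _).trans (add_le_add (hγG t) ?_)
          rw [norm_mul, Complex.norm_real, norm_neg, Real.norm_of_nonneg hh.1.le]
          exact mul_le_mul hh.2 (hνB t) (norm_nonneg _) hh₀.le
      · refine .of_forall fun t _ => ?_
        have hp : Tendsto (fun h => (X.hole j).parallelCurve h t) (𝓝[>] 0)
            (𝓝[X.cover] ((X.hole j).curve t)) := by
          refine tendsto_nhdsWithin_iff.2 ⟨?_, ?_⟩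
          · have : Continuous fun h : ℝ => (X.hole j).parallelCurve h t := by
              unfold C2Hole.parallelCurve
              fun_prop
            have h1 := this.tendsto 0
            rw [C2Hole.parallelCurve, Complex.ofReal_zero, zero_mul, sub_zero] at h1
            exact h1.mono_left nhdsWithin_le_nhds
          · filter_upwards [Ioc_mem_nhdsGT hh₀] with h hh
            exact (hflux h hh.1 hh.2).1 t
        have hd : Tendsto (fun h => ‖deriv ((X.hole j).parallelCurve h) t‖) (𝓝[>] 0)
            (𝓝 ‖deriv (X.hole j).curve t‖) := by
          simp only [C2Hole.deriv_parallelCurve]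
          have : Continuous fun h : ℝ => ‖deriv (X.hole j).curve t + ((-h : ℝ) : ℂ) *
            deriv (X.hole j).normal t‖ := by fun_prop
          have h1 := this.tendsto 0
          rw [neg_zero, Complex.ofReal_zero, zero_mul, add_zero] at h1
          exact h1.mono_left nhdsWithin_le_nhds
        exact ((((ContinuousLinearMap.apply ℝ ℝ ((X.hole j).normal t)).continuous.tendsto _).comp
          ((hL t).comp hp))).mul hd
    refine tendsto_nhds_unique hlim (tendsto_const_nhds.congr' ?_)
    filter_upwards [Ioc_mem_nhdsGT hh₀] with h hh
    exact (hflux h hh.1 hh.2).2.2.symm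

end HoledTorus

/-! ### Uniqueness of the density -/

/-- The set `S` need not be open and `U` need not be connected, so images of strips are admitted. -/
theorem eq_of_deriv_eq_zero_of_isPreconnected {f : ℂ → ℂ} {U S : Set ℂ} (hU : IsOpen U)
    (hf : ∀ z ∈ U, HasDerivAt f 0 z) (hS : IsPreconnected S) (hSU : S ⊆ U) {x y : ℂ} (hx : x ∈ S)
    (hy : y ∈ S) : f x = f y := by
  have hloc : ∀ z ∈ U, ∀ᶠ w in 𝓝 z, w ∈ U ∧ f w = f z := fun z hz => by
    obtain ⟨r, hr, hball⟩ := Metric.isOpen_iff.1 hU z hz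
    filter_upwards [Metric.ball_mem_nhds z hr] with w hw
    refine ⟨hball hw, Metric.isOpen_ball.is_const_of_deriv_eq_zero
      (convex_ball z r).isPreconnected
      (fun v hv => (hf v (hball hv)).differentiableAt.differentiableWithinAt)
      (fun v hv => (hf v (hball hv)).deriv) hw (Metric.mem_ball_self hr)⟩
  have h1 : IsOpen {w | w ∈ U ∧ f w = f x} := isOpen_iff_eventually.2 fun z hz => by
    filter_upwards [hloc z hz.1] with w hw
    exact ⟨hw.1, hw.2.trans hz.2⟩
  have h2 : IsOpen {w | w ∈ U ∧ f w ≠ f x} := isOpen_iff_eventually.2 fun z hz => by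
    filter_upwards [hloc z hz.1] with w hw
    exact ⟨hw.1, hw.2 ▸ hz.2⟩
  have h3 := hS.subset_left_of_subset_union h1 h2
    (disjoint_left.2 fun w hw hw' => hw'.2 hw.2)
    (fun w hw => (em (f w = f x)).imp (fun h => ⟨hSU hw, h⟩) fun h => ⟨hSU hw, h⟩)
    ⟨x, hx, hSU hx, rfl⟩
  exact (h3 hy).2.symm

theorem HasDerivAt.eq_zero_of_re_eventually_const {f : ℂ → ℂ} {f' z : ℂ} {c : ℝ}
    (h : HasDerivAt f f' z) (hc : ∀ᶠ w in 𝓝 z, (f w).re = c) : f' = 0 := by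
  have h1 := (h.hasFDerivAt_re).unique
    ((hasFDerivAt_const c z).congr_of_eventuallyEq hc)
  have h2 : ∀ v, (f' * v).re = 0 := fun v => by rw [← reMul_apply, h1]; rfl
  have h3 := h2 (starRingEnd ℂ f')
  rw [Complex.mul_conj, Complex.ofReal_re] at h3
  exact Complex.normSq_eq_zero.1 h3

namespace HoledTorus

variable {τ : ℂ} {M : ℕ} (X : HoledTorus τ M)

theorem hasDerivAt_complexPotential_zero (hτ : 0 < τ.im) {φ : C(X.boundary, ℝ)}
    (h0 : ∀ z ∈ X.cover, X.doubleLayer φ z = 0) {z : ℂ} (hz : z ∈ X.cover) :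
    HasDerivAt (X.complexPotential φ) 0 z := by
  have h := X.hasDerivAt_complexPotential hτ φ (Or.inl hz)
  rwa [HasDerivAt.eq_zero_of_re_eventually_const (c := 0) h] at h
  filter_upwards [(X.isOpen_cover hτ).mem_nhds hz] with w hw
  rw [X.re_complexPotential hτ φ (Or.inl hw), h0 w hw]

/-- If the double-layer potential vanishes in `Ω`, then the holomorphic potential is constant near
`∂D_j` in `Ω`. -/
theorem exists_complexPotential_eq_const (hτ : 0 < τ.im) {φ : C(X.boundary, ℝ)}
    (h0 : ∀ z ∈ X.cover, X.doubleLayer φ z = 0) (j : Fin M) :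
    ∃ κ : ℂ, ∃ h₀ : ℝ, 0 < h₀ ∧ ∀ s h : ℝ, 0 < h → h ≤ h₀ →
      X.complexPotential φ ((X.hole j).curve s - h * (X.hole j).normal s) = κ := by
  obtain ⟨h₀, hh₀, -, hcol⟩ := X.exists_collar hτ j
  have hcont : Continuous fun p : ℝ × ℝ => (X.hole j).curve p.1 - p.2 * (X.hole j).normal p.1 := by
    have := (X.hole j).continuous_curve
    have := (X.hole j).continuous_normal
    fun_prop
  have hconn : IsPreconnected ((fun p : ℝ × ℝ => (X.hole j).curve p.1 - p.2 * (X.hole j).normal p.1)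
      '' (univ ×ˢ Ioc 0 h₀)) :=
    (isPreconnected_univ.prod isPreconnected_Ioc).image _ hcont.continuousOn
  refine ⟨_, h₀, hh₀, fun s h h1 h2 => eq_of_deriv_eq_zero_of_isPreconnected (X.isOpen_cover hτ)
    (fun z hz => X.hasDerivAt_complexPotential_zero hτ h0 hz) hconn ?_
    ⟨(s, h), ⟨mem_univ _, h1, h2⟩, rfl⟩ ⟨(0, h₀), ⟨mem_univ _, hh₀, le_rfl⟩, rfl⟩⟩
  rintro _ ⟨⟨s, h⟩, ⟨-, h1, h2⟩, rfl⟩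
  exact (hcol s h h1 h2).2

open InnerProductSpace in
-- Outside near ∂D_j the potential F is a constant κ, and its jump φ is real. So Im F tends to Im κ
-- from inside the hole, and the maximum principle makes Im F constant there. Then F is constant in
-- the hole, and so is the jump.
theorem exists_density_eq_const (hτ : 0 < τ.im) {φ : C(X.boundary, ℝ)}
    (h0 : ∀ z ∈ X.cover, X.doubleLayer φ z = 0) (j : Fin M) :
    ∃ c : ℝ, ∀ s, X.density φ j s = c := by
  obtain ⟨κ, h₀, hh₀, hκ⟩ := X.exists_complexPotential_eq_const hτ h0 j
  set D := X.hole j with hD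
  set F := X.complexPotential φ
  have hDU : D.carrier ⊆ X.offBoundary := fun z hz => Or.inr (mem_iUnion.2 ⟨j, hz⟩)
  have hjump : ∀ s₀, Tendsto (fun p : ℝ × ℝ => F (D.curve p.1 + p.2 * D.normal p.1))
      (𝓝 s₀ ×ˢ 𝓝[>] 0) (𝓝 (X.density φ j s₀ + κ)) := fun s₀ => by
    refine ((X.tendsto_complexPotential_sub hτ φ j s₀).add_const κ).congr' ?_
    filter_upwards [prod_mem_prod univ_mem (Ioc_mem_nhdsGT hh₀)] with p hp
    change F (D.curve p.1 + p.2 * D.normal p.1) - F (D.curve p.1 - p.2 * D.normal p.1) + κ = _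
    rw [hκ p.1 p.2 hp.2.1 hp.2.2, sub_add_cancel]
  have hlim : ∀ s₀, Tendsto F (𝓝[D.carrier] (D.curve s₀)) (𝓝 (X.density φ j s₀ + κ)) := fun s₀ =>
    D.tendsto_nhdsWithin_carrier s₀ (hjump s₀)
  set W : ℂ → ℝ := D.carrier.indicator fun z => (F z).im - κ.im with hW
  have hanal : ∀ z ∈ D.carrier, AnalyticAt ℂ F z := fun z hz =>
    DifferentiableOn.analyticAt (s := X.offBoundary) (fun w hw =>
      (X.hasDerivAt_complexPotential hτ φ hw).differentiableAt.differentiableWithinAt)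
      ((X.isOpen_offBoundary hτ).mem_nhds (hDU hz))
  have hharm : ∀ z ∈ D.carrier, HarmonicAt W z := fun z hz => by
    refine (harmonicAt_congr_nhds ?_).2 ((hanal z hz).harmonicAt_im.sub (harmonicAt_const κ.im))
    filter_upwards [D.isOpen_carrier.mem_nhds hz] with w hw
    rw [hW, indicator_of_mem hw]
    rfl
  have hcont : Continuous W := continuous_iff_continuousAt.2 fun z => by
    by_cases hz : z ∈ D.carrier
    · exact (hharm z hz).1.continuousAt
    have hW0 : W z = 0 := by rw [hW, indicator_of_notMem hz]
    by_cases hzc : z ∈ closure D.carrier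
    · have : z ∈ frontier D.carrier := by
        rw [D.isOpen_carrier.frontier_eq]
        exact ⟨hzc, hz⟩
      rw [← D.range_curve] at this
      obtain ⟨s₀, rfl⟩ := this
      have h1 := ((Complex.continuous_im.tendsto _).comp (hlim s₀)).sub_const κ.im
      simp only [Complex.add_im, Complex.ofReal_im, zero_add, sub_self] at h1
      rw [ContinuousAt, hW0, ← nhdsWithin_univ, ← union_compl_self D.carrier, nhdsWithin_union]
      refine Tendsto.sup (h1.congr' ?_) (tendsto_const_nhds.congr' ?_)
      · filter_upwards [self_mem_nhdsWithin] with w hw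
        rw [hW, indicator_of_mem hw]
        rfl
      · filter_upwards [self_mem_nhdsWithin] with w hw
        rw [hW, indicator_of_notMem hw]
    · have : W =ᶠ[𝓝 z] fun _ => 0 := by
        filter_upwards [isClosed_closure.isOpen_compl.mem_nhds hzc] with w hw
        rw [hW, indicator_of_notMem fun h => hw (subset_closure h)]
      exact continuousAt_const.congr this.symm
  have hcurve : W (D.curve 0) = 0 := by rw [hW, indicator_of_notMem (D.curve_notMem_carrier 0)]
  have hzero := eq_zero_of_harmonicAt_of_ne_zero hcont
    (fun z hz => hharm z (mem_of_indicator_ne_zero hz)) ⟨_, hcurve⟩ D.isCompact_closure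
    (fun z => by
      by_cases hz : z ∈ D.carrier
      · exact ⟨z, subset_closure hz, rfl⟩
      · refine ⟨D.curve 0, D.curve_mem_closure 0, ?_⟩
        rw [hcurve, hW, indicator_of_notMem hz])
  have hF0 : ∀ z ∈ D.carrier, HasDerivAt F 0 z := fun z hz => by
    have h1 := X.hasDerivAt_complexPotential hτ φ (hDU hz)
    have h2 := HasDerivAt.eq_zero_of_re_eventually_const (c := κ.im) (h1.const_mul (-Complex.I)) (by
      filter_upwards [D.isOpen_carrier.mem_nhds hz] with w hw
      have := hzero w
      rw [hW, indicator_of_mem hw] at this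
      simp only [Complex.mul_re, Complex.neg_re, Complex.neg_im, Complex.I_re, Complex.I_im]
      linarith)
    rw [mul_eq_zero, neg_eq_zero] at h2
    rwa [h2.resolve_left Complex.I_ne_zero] at h1
  obtain ⟨h₁, hh₁, hcol⟩ := D.exists_collar
  have hz₀ := (hcol 0 h₁ hh₁ le_rfl).1
  set z₀ := D.curve 0 + h₁ * D.normal 0
  refine ⟨(F z₀ - κ).re, fun s => ?_⟩
  have h1 : Tendsto (fun p : ℝ × ℝ => F (D.curve p.1 + p.2 * D.normal p.1))
      (𝓝 s ×ˢ 𝓝[>] 0) (𝓝 (F z₀)) := by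
    refine tendsto_const_nhds.congr' ?_
    filter_upwards [prod_mem_prod univ_mem (Ioc_mem_nhdsGT hh₁)] with p hp
    exact eq_of_deriv_eq_zero_of_isPreconnected D.isOpen_carrier hF0
      D.isSimplyConnected_carrier.isPathConnected.isConnected.isPreconnected subset_rfl hz₀
      (hcol p.1 p.2 hp.2.1 hp.2.2).1
  rw [tendsto_nhds_unique h1 (hjump s), add_sub_cancel_right, Complex.ofReal_re]

/-- As a function of ξ, ϑ₁(z - ξ) has no zero in the closed hole, so the curve can be pushed into
the hole. -/
theorem integral_logDeriv_theta₁_sub_curve (hτ : 0 < τ.im) (j : Fin M) {z : ℂ} (hz : z ∈ X.cover) :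
    ∫ t in (0 : ℝ)..1, logDeriv (theta₁ τ) (z - (X.hole j).curve t) * deriv (X.hole j).curve t =
      0 := by
  obtain ⟨h₀, hh₀, hcol⟩ := (X.hole j).exists_collar
  have hU : IsOpen ((fun ξ => z - ξ) ⁻¹' (lattice τ : Set ℂ)ᶜ) :=
    (isOpen_compl_lattice hτ).preimage (by fun_prop)
  have hsub : closure (X.hole j).carrier ⊆ (fun ξ => z - ξ) ⁻¹' (lattice τ : Set ℂ)ᶜ := fun ξ hξ =>
    X.sub_notMem_lattice_of_mem_cover hz hξ
  have hk : DifferentiableOn ℂ (fun ξ => theta₁ τ (z - ξ))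
      ((fun ξ => z - ξ) ⁻¹' (lattice τ : Set ℂ)ᶜ) :=
    ((differentiable_theta₁ hτ).comp (by fun_prop : Differentiable ℂ fun ξ => z - ξ)).differentiableOn
  have hk0 : ∀ ξ ∈ closure (X.hole j).carrier, theta₁ τ (z - ξ) ≠ 0 := fun ξ hξ =>
    mt (theta₁_eq_zero_iff hτ).1 (hsub hξ)
  have hmem : ∀ h ∈ Icc 0 h₀, ∀ t, (X.hole j).curve t + h * (X.hole j).normal t ∈
      closure (X.hole j).carrier := fun h hh t => by
    rcases hh.1.eq_or_lt with rfl | h1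
    · simpa using (X.hole j).curve_mem_closure t
    · exact subset_closure (hcol t h h1 hh.2).1
  have h1 := C2Hole.offsetIntegral_eq (D := X.hole j) hU hk (isPreconnected_Icc (a := 0) (b := h₀))
    (fun h hh t => hsub (hmem h hh t)) (fun h hh t => hk0 _ (hmem h hh t))
    (h := 0) (h' := h₀) ⟨le_rfl, hh₀.le⟩ ⟨hh₀.le, le_rfl⟩
  rw [C2Hole.offsetIntegral_eq_zero_of_mem_carrier hU hk (subset_closure.trans hsub)
    (fun ξ hξ => hk0 ξ (subset_closure hξ)) fun t => (hcol t h₀ hh₀ le_rfl).1,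
    C2Hole.offsetIntegral] at h1
  rw [← neg_eq_zero, ← h1, ← intervalIntegral.integral_neg]
  refine intervalIntegral.integral_congr fun t _ => ?_
  simp only [deriv_comp_const_sub, Complex.ofReal_zero, zero_mul, add_zero, logDeriv_apply]
  ring

/-- This is the potential of the density 1 on ∂D_j, seen from Ω. The logarithmic part gives nothing
there; the quadratic part of G leaves an area integral that does not depend on z. It is the reason
why one mean condition can be omitted. -/
theorem re_integral_layerKernel (hτ : 0 < τ.im) (j : Fin M) {z : ℂ} (hz : z ∈ X.cover) :
    (∫ t in (0 : ℝ)..1, layerKernel τ (z - (X.hole j).curve t) (deriv (X.hole j).curve t)).re =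
      -(1 / τ.im) * ∫ t in (0 : ℝ)..1, ((X.hole j).curve t).im * (deriv (X.hole j).curve t).re := by
  have h1 := (X.hole j).continuous_curve
  have h2 := (X.hole j).continuous_deriv_curve
  have h3 : Continuous fun t => logDeriv (theta₁ τ) (z - (X.hole j).curve t) :=
    continuous_iff_continuousAt.2 fun t =>
      (analyticAt_logDeriv_theta₁ hτ (X.sub_notMem_lattice_of_mem_cover hz
        ((X.hole j).curve_mem_closure t))).continuousAt.comp'
        (f := fun t => z - (X.hole j).curve t) (by fun_prop : Continuous fun t =>
        z - (X.hole j).curve t).continuousAt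
  have hc1 : Continuous fun t => logDeriv (theta₁ τ) (z - (X.hole j).curve t) *
      deriv (X.hole j).curve t := h3.mul h2
  have hc2 : Continuous fun t => (z - (X.hole j).curve t) *
      ((deriv (X.hole j).curve t).re : ℂ) := by fun_prop
  have e : (∫ t in (0 : ℝ)..1, layerKernel τ (z - (X.hole j).curve t) (deriv (X.hole j).curve t)) =
      -Complex.I * ((1 / (2 * Real.pi)) * (∫ t in (0 : ℝ)..1,
        logDeriv (theta₁ τ) (z - (X.hole j).curve t) * deriv (X.hole j).curve t) +
        ((1 / τ.im : ℝ) : ℂ) * ∫ t in (0 : ℝ)..1, (z - (X.hole j).curve t) *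
      ((deriv (X.hole j).curve t).re : ℂ)) := by
    rw [← intervalIntegral.integral_const_mul, ← intervalIntegral.integral_const_mul,
      ← intervalIntegral.integral_add ((hc1.const_mul _).intervalIntegrable _ _)
      ((hc2.const_mul _).intervalIntegrable _ _), ← intervalIntegral.integral_const_mul]
    refine intervalIntegral.integral_congr fun t _ => ?_
    simp only [layerKernel]
    push_cast
    ring
  have hre : ∀ t, HasDerivAt (fun t => ((X.hole j).curve t).re) (deriv (X.hole j).curve t).re t :=
    fun t => Complex.reCLM.hasFDerivAt.comp_hasDerivAt t ((X.hole j).hasDerivAt_curve t)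
  have hzero : ∫ t in (0 : ℝ)..1, (deriv (X.hole j).curve t).re = 0 := by
    have hper := (X.hole j).periodic_curve 0
    rw [zero_add] at hper
    rw [intervalIntegral.integral_eq_sub_of_hasDerivAt (fun t _ => hre t)
      ((Complex.continuous_re.comp h2).intervalIntegrable _ _), hper, sub_self]
  rw [e, X.integral_logDeriv_theta₁_sub_curve hτ j hz, mul_zero, zero_add, neg_mul, Complex.neg_re,
    Complex.I_mul_re, neg_neg, Complex.im_ofReal_mul, intervalIntegral_im (hc2.intervalIntegrable _ _)]
  simp only [Complex.im_mul_ofReal, Complex.sub_im, sub_mul]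
  rw [intervalIntegral.integral_sub (Continuous.intervalIntegrable (by fun_prop) _ _)
    (Continuous.intervalIntegrable (by fun_prop) _ _), intervalIntegral.integral_const_mul, hzero]
  ring

theorem eq_zero_of_doubleLayer_eq_zero (hτ : 0 < τ.im) (hM : 1 ≤ M) {φ : C(X.boundary, ℝ)}
    (h0 : ∀ z ∈ X.cover, X.doubleLayer φ z = 0) (hD : ∀ j, (X.hole j).carrier.Nonempty)
    (hmean : ∀ j : Fin M, (j : ℕ) + 1 < M →
      (X.hole j).arcIntegral (fun t => φ (X.boundaryPoint j t)) = 0) : φ = 0 := by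
  choose c hc using X.exists_density_eq_const hτ h0
  have hc0 : ∀ j : Fin M, (j : ℕ) + 1 < M → c j = 0 := fun j hj => by
    have h1 : ∫ t in (0 : ℝ)..1, X.density φ j t * ‖deriv (X.hole j).curve t‖ = 0 := hmean j hj
    simp only [hc j, intervalIntegral.integral_const_mul] at h1
    refine (mul_eq_zero.1 h1).resolve_right (ne_of_gt ?_)
    exact intervalIntegral.intervalIntegral_pos_of_pos
      ((X.hole j).continuous_deriv_curve.norm.intervalIntegrable _ _)
      (X.hole j).norm_deriv_curve_pos zero_lt_one
  -- The last hole carries no mean condition. With the other constants zero, the vanishing potential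
  -- is `c m` times a nonzero area term.
  set m : Fin M := ⟨M - 1, by omega⟩ with hm
  have hcm : c m = 0 := by
    obtain ⟨h₀, hh₀, -, hcol⟩ := X.exists_collar hτ m
    have hz := (hcol 0 h₀ hh₀ le_rfl).2
    set z := (X.hole m).curve 0 - h₀ * (X.hole m).normal 0
    have h1 := X.re_complexPotential hτ φ (Or.inl hz)
    rw [h0 z hz, complexPotential, Finset.sum_eq_single m] at h1
    · simp only [hc m, intervalIntegral.integral_const_mul] at h1
      rw [Complex.re_ofReal_mul, X.re_integral_layerKernel hτ m hz] at h1
      refine (mul_eq_zero.1 h1).resolve_right (mul_ne_zero ?_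
        (C2Hole.integral_im_mul_re_deriv_ne_zero (hD m)))
      exact neg_ne_zero.2 (one_div_ne_zero hτ.ne')
    · intro j _ hj
      have hj' : c j = 0 := hc0 j (by
        have := j.2
        have h2 : (j : ℕ) ≠ M - 1 := fun h => hj (Fin.ext h)
        omega)
      simp [hc j, hj']
    · exact fun h => absurd (Finset.mem_univ m) h
  ext ⟨z, hz⟩
  obtain ⟨j, s, rfl⟩ := X.exists_eq_curve hz
  have h1 : φ (X.boundaryPoint j s) = c j := hc j s
  rw [ContinuousMap.zero_apply]
  refine h1.trans ?_
  by_cases hj : (j : ℕ) + 1 < M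
  · exact hc0 j hj
  · have : j = m := Fin.ext (by have := j.2; simp only [hm]; omega)
    rw [this, hcm]

end HoledTorus

/-! ### The Fredholm alternative -/

/-- By the Fredholm alternative, 1 is either an eigenvalue or in the resolvent set. -/
theorem IsCompactOperator.bijective_sub_one {E : Type*} [NormedAddCommGroup E] [NormedSpace ℝ E]
    [CompleteSpace E] {T : E →L[ℝ] E} (hT : IsCompactOperator T)
    (hinj : ∀ x, (T - 1) x = 0 → x = 0) : Function.Bijective ⇑(T - 1 : E →L[ℝ] E) := by
  rcases hT.hasEigenvalue_or_mem_resolventSet one_ne_zero with h | h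
  · obtain ⟨x, hx⟩ := h.exists_hasEigenvector
    refine absurd (hinj x ?_) hx.2
    have := hx.apply_eq_smul
    rw [one_smul] at this
    exact sub_eq_zero.2 this
  · rw [spectrum.mem_resolventSet_iff, map_one, ← IsUnit.neg_iff, neg_sub,
      ContinuousLinearMap.isUnit_iff_bijective] at h
    exact h

namespace HoledTorus

variable {τ : ℂ} {M : ℕ} (X : HoledTorus τ M)

theorem exists_abs_doubleLayer_le (hτ : 0 < τ.im) : ∃ C, ∀ φ : C(X.boundary, ℝ), ∀ z ∈ X.boundary,
    |X.doubleLayer φ z| ≤ C * ‖φ‖ := by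
  obtain ⟨C, hC, hCb⟩ := X.exists_abs_paramKernel_le hτ
  refine ⟨∑ _i : Fin M, C, fun φ z hz => ?_⟩
  rw [doubleLayer_eq, Finset.sum_mul]
  refine (Finset.abs_sum_le_sum_abs _ _).trans (Finset.sum_le_sum fun i _ => ?_)
  have h1 : ∀ᵐ t : ℝ, t ∈ uIoc (0 : ℝ) 1 → ‖X.paramKernel z i t * X.density φ i t‖ ≤ C * ‖φ‖ := by
    filter_upwards [X.ae_sub_notMem_lattice hz i] with t ht ht'
    rw [uIoc_of_le zero_le_one] at ht'
    rw [norm_mul]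
    exact mul_le_mul (hCb z hz i t ⟨ht'.1.le, ht'.2⟩ ht) (φ.norm_coe_le_norm _) (norm_nonneg _) hC.le
  have h2 := intervalIntegral.norm_integral_le_of_norm_le_const_ae h1
  simpa using h2

/-- The boundary operator `K`. -/
def boundaryOperator (hτ : 0 < τ.im) : C(X.boundary, ℝ) →L[ℝ] C(X.boundary, ℝ) :=
  LinearMap.mkContinuousOfExistsBound
    { toFun := fun φ => ⟨fun z => X.doubleLayer φ z, X.continuous_doubleLayer hτ φ⟩
      map_add' := fun φ ψ => by
        ext z
        simp only [ContinuousMap.coe_mk, ContinuousMap.add_apply, doubleLayer_eq]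
        rw [← Finset.sum_add_distrib]
        refine Finset.sum_congr rfl fun i _ => ?_
        rw [← intervalIntegral.integral_add (X.intervalIntegrable_paramKernel_mul hτ φ z.2 i)
          (X.intervalIntegrable_paramKernel_mul hτ ψ z.2 i)]
        refine intervalIntegral.integral_congr fun t _ => ?_
        simp only [density, ContinuousMap.add_apply, mul_add]
      map_smul' := fun c φ => by
        ext z
        simp only [ContinuousMap.coe_mk, ContinuousMap.smul_apply, doubleLayer_eq, smul_eq_mul,
          RingHom.id_apply]
        rw [Finset.mul_sum]
        refine Finset.sum_congr rfl fun i _ => ?_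
        rw [← intervalIntegral.integral_const_mul]
        refine intervalIntegral.integral_congr fun t _ => ?_
        simp only [density, ContinuousMap.smul_apply, smul_eq_mul]
        ring }
    (by
      obtain ⟨C, hC⟩ := X.exists_abs_doubleLayer_le hτ
      refine ⟨|C|, fun φ => (ContinuousMap.norm_le _ (by positivity)).2 fun z => ?_⟩
      exact (hC φ z z.2).trans (mul_le_mul_of_nonneg_right (le_abs_self C) (norm_nonneg _)))

@[simp]
theorem boundaryOperator_apply (hτ : 0 < τ.im) (φ : C(X.boundary, ℝ)) (z : X.boundary) :
    X.boundaryOperator hτ φ z = X.doubleLayer φ z := rfl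

theorem boundaryDoubleLayerEq (hτ : 0 < τ.im) (φ : C(X.boundary, ℝ)) :
    X.BoundaryDoubleLayerEq φ (X.boundaryOperator hτ φ) := fun z₀ =>
  X.tendsto_truncatedDoubleLayer hτ φ z₀

/-- The image of the unit ball is uniformly bounded, and it is equicontinuous because values at two
points differ by at most `kernelDist`. Arzelà–Ascoli is applied to bounded continuous functions, so
the operator is transported through the isometry `e` and back. -/
theorem isCompactOperator_boundaryOperator (hτ : 0 < τ.im) :
    IsCompactOperator (X.boundaryOperator hτ) := by
  let e := ContinuousMap.linearIsometryBoundedOfCompact X.boundary ℝ ℝ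
  have hcomp : IsCompactOperator (e.toContinuousLinearEquiv.toContinuousLinearMap.comp
      (X.boundaryOperator hτ)) := by
    refine (isCompactOperator_iff_isCompact_closure_image_closedBall (r := 1)
      (e.toContinuousLinearEquiv.toContinuousLinearMap.comp (X.boundaryOperator hτ)).toLinearMap
      one_pos).2 ?_
    obtain ⟨C, hC⟩ := X.exists_abs_doubleLayer_le hτ
    refine BoundedContinuousFunction.arzela_ascoli (Icc (-|C|) |C|) isCompact_Icc _ ?_ ?_
    · rintro _ z ⟨φ, hφ, rfl⟩
      rw [mem_closedBall_zero_iff] at hφ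
      refine abs_le.1 ((hC φ z z.2).trans ((mul_le_mul_of_nonneg_right (le_abs_self C)
        (norm_nonneg _)).trans ?_))
      exact mul_le_of_le_one_right (abs_nonneg _) hφ
    · intro w
      rw [Metric.equicontinuousAt_iff_right]
      intro ε hε
      filter_upwards [(X.tendsto_kernelDist hτ w).eventually_lt_const hε] with z hz
      rintro ⟨_, φ, hφ, rfl⟩
      rw [mem_closedBall_zero_iff] at hφ
      rw [dist_comm, Real.dist_eq]
      refine (X.abs_doubleLayer_sub_le hτ φ z w).trans_lt (lt_of_le_of_lt ?_ hz)
      refine mul_le_of_le_one_left (Finset.sum_nonneg fun i _ => ?_) hφ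
      exact intervalIntegral.integral_nonneg zero_le_one fun t _ => abs_nonneg _
  have h := hcomp.clm_comp e.symm.toContinuousLinearEquiv.toContinuousLinearMap
  have h2 : (e.symm.toContinuousLinearEquiv.toContinuousLinearMap ∘
      (e.toContinuousLinearEquiv.toContinuousLinearMap.comp (X.boundaryOperator hτ))) =
      X.boundaryOperator hτ := funext fun φ => e.symm_apply_apply _
  rwa [h2] at h

/-- The integral over `∂D_j` as a functional. -/
def meanFunctional (j : Fin M) : C(X.boundary, ℝ) →L[ℝ] ℝ :=
  LinearMap.mkContinuousOfExistsBound
    { toFun := fun φ => (X.hole j).arcIntegral fun t => φ (X.boundaryPoint j t)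
      map_add' := fun φ ψ => by
        have h1 := fun φ => ((X.continuous_density φ j).mul
          (X.hole j).continuous_deriv_curve.norm).intervalIntegrable (μ := volume) 0 1
        simp only [C2Hole.arcIntegral, ContinuousMap.add_apply, add_mul]
        exact intervalIntegral.integral_add (h1 φ) (h1 ψ)
      map_smul' := fun c φ => by
        simp only [C2Hole.arcIntegral, ContinuousMap.smul_apply, smul_eq_mul, RingHom.id_apply,
          mul_assoc]
        exact intervalIntegral.integral_const_mul _ _ }
    (by
      obtain ⟨G, hG, hγG⟩ := (X.hole j).exists_norm_deriv_le
      refine ⟨G, fun φ => ?_⟩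
      have h2 := intervalIntegral.norm_integral_le_of_norm_le_const (a := 0) (b := 1)
        (C := G * ‖φ‖) (f := fun t => φ (X.boundaryPoint j t) * ‖deriv (X.hole j).curve t‖)
        fun t _ => by
          rw [norm_mul, norm_norm, mul_comm]
          exact mul_le_mul (hγG t) (φ.norm_coe_le_norm _) (norm_nonneg _) hG.le
      simpa using! h2)

theorem meanFunctional_apply (j : Fin M) (φ : C(X.boundary, ℝ)) :
    X.meanFunctional j φ = (X.hole j).arcIntegral fun t => φ (X.boundaryPoint j t) := rfl

/-! ### The system as an equation for a compact perturbation of the identity -/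

variable {β : Fin M → ℂ}

theorem continuous_green_sub (hβ : ∀ j, β j ∈ (X.hole j).carrier) (hτ : 0 < τ.im) (j : Fin M) :
    Continuous fun z : X.boundary => green τ ((z : ℂ) - β j) :=
  continuous_iff_continuousAt.2 fun z =>
    (hasFDerivAt_green hτ (X.sub_notMem_lattice_of_mem_boundary z.2 (hβ j))).continuousAt.comp'
      (f := fun z : X.boundary => (z : ℂ) - β j) (by fun_prop)

/-- The map `A ↦ ∑ j, A_j G(· - β_j)` into `C(∂Ω)`. -/
def greenOperator (hβ : ∀ j, β j ∈ (X.hole j).carrier) (hτ : 0 < τ.im) :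
    (Fin M → ℝ) →L[ℝ] C(X.boundary, ℝ) :=
  ∑ j, (ContinuousLinearMap.proj (R := ℝ) (φ := fun _ => ℝ) j).smulRight
    (⟨_, X.continuous_green_sub hβ hτ j⟩ : C(X.boundary, ℝ))

theorem greenOperator_apply (hβ : ∀ j, β j ∈ (X.hole j).carrier) (hτ : 0 < τ.im) (A : Fin M → ℝ)
    (z : X.boundary) : X.greenOperator hβ hτ A z = ∑ j, A j * green τ ((z : ℂ) - β j) := by
  simp only [greenOperator, _root_.sum_apply, ContinuousLinearMap.smulRight_apply,
    ContinuousLinearMap.proj_apply, ContinuousMap.sum_apply, ContinuousMap.smul_apply,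
    ContinuousMap.coe_mk, smul_eq_mul]

/-- The `M` scalar side conditions of the system. -/
def sideConditions : C(X.boundary, ℝ) × (Fin M → ℝ) →L[ℝ] (Fin M → ℝ) :=
  ContinuousLinearMap.pi fun j : Fin M => if (j : ℕ) + 1 < M then
    (X.meanFunctional j).comp (ContinuousLinearMap.fst ℝ _ _) else
    (∑ i, ContinuousLinearMap.proj i).comp (ContinuousLinearMap.snd ℝ _ _)

theorem sideConditions_apply (φ : C(X.boundary, ℝ)) (A : Fin M → ℝ) (j : Fin M) :
    X.sideConditions (φ, A) j = if (j : ℕ) + 1 < M then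
      (X.hole j).arcIntegral (fun t => φ (X.boundaryPoint j t)) else ∑ i, A i := by
  by_cases hj : (j : ℕ) + 1 < M
  · simp [sideConditions, hj, meanFunctional_apply]
  · simp [sideConditions, hj]

/-- The operator `T` such that the system for `(φ, A)` is `(T - 1) (φ, A) = (2 g, 0)`. -/
def systemOperator (hβ : ∀ j, β j ∈ (X.hole j).carrier) (hτ : 0 < τ.im) :
    C(X.boundary, ℝ) × (Fin M → ℝ) →L[ℝ] C(X.boundary, ℝ) × (Fin M → ℝ) :=
  (ContinuousLinearMap.inl ℝ _ _).comp (((2 : ℝ) • X.boundaryOperator hτ).comp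
    (ContinuousLinearMap.fst ℝ _ _)) +
  ((ContinuousLinearMap.inl ℝ _ _).comp ((2 : ℝ) • X.greenOperator hβ hτ)).comp
    (ContinuousLinearMap.snd ℝ _ _) +
  (ContinuousLinearMap.inr ℝ _ _).comp (ContinuousLinearMap.snd ℝ _ _ + X.sideConditions)

/-- Apart from K, every block has a finite-dimensional source or target. -/
theorem isCompactOperator_systemOperator (hβ : ∀ j, β j ∈ (X.hole j).carrier) (hτ : 0 < τ.im) :
    IsCompactOperator (X.systemOperator hβ hτ) := by
  refine IsCompactOperator.add (IsCompactOperator.add ?_ ?_) ?_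
  · have h1 : IsCompactOperator
        ⇑((2 : ℝ) • X.boundaryOperator hτ : C(X.boundary, ℝ) →L[ℝ] C(X.boundary, ℝ)) :=
      (X.isCompactOperator_boundaryOperator hτ).smul (2 : ℝ)
    exact (h1.comp_clm (ContinuousLinearMap.fst ℝ _ _)).clm_comp (ContinuousLinearMap.inl ℝ _ _)
  · have h1 : IsCompactOperator ⇑((ContinuousLinearMap.inl ℝ C(X.boundary, ℝ) (Fin M → ℝ)).comp
        ((2 : ℝ) • X.greenOperator hβ hτ)) := isCompactOperator_of_locallyCompactSpace_rng _
    exact h1.comp_clm (ContinuousLinearMap.snd ℝ _ _)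
  · have h1 : IsCompactOperator ⇑(ContinuousLinearMap.snd ℝ C(X.boundary, ℝ) (Fin M → ℝ) +
        X.sideConditions) := isCompactOperator_of_locallyCompactSpace_dom _
    exact h1.clm_comp (ContinuousLinearMap.inr ℝ _ _)

/-- The factor 2 turns -φ/2 into -φ, the contribution of -1. -/
theorem systemOperator_fst (hβ : ∀ j, β j ∈ (X.hole j).carrier) (hτ : 0 < τ.im)
    (φ : C(X.boundary, ℝ)) (A : Fin M → ℝ) (z : X.boundary) :
    ((X.systemOperator hβ hτ - 1) (φ, A)).1 z =
      2 * (-(1 / 2) * φ z + X.doubleLayer φ z + ∑ j, A j * green τ ((z : ℂ) - β j)) := by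
  have h : ((X.systemOperator hβ hτ - 1) (φ, A)).1 z = 2 * X.doubleLayer φ z +
      2 * X.greenOperator hβ hτ A z - φ z := by
    simp [systemOperator]
  rw [h, greenOperator_apply]
  ring

theorem systemOperator_snd (hβ : ∀ j, β j ∈ (X.hole j).carrier) (hτ : 0 < τ.im)
    (φ : C(X.boundary, ℝ)) (A : Fin M → ℝ) (j : Fin M) :
    ((X.systemOperator hβ hτ - 1) (φ, A)).2 j = if (j : ℕ) + 1 < M then
      (X.hole j).arcIntegral (fun t => φ (X.boundaryPoint j t)) else ∑ i, A i := by
  rw [← sideConditions_apply]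
  simp [systemOperator]

theorem solvesSystem_iff (hβ : ∀ j, β j ∈ (X.hole j).carrier) (hτ : 0 < τ.im) (hM : 1 ≤ M)
    (g φ : C(X.boundary, ℝ)) (A : Fin M → ℝ) :
    X.SolvesSystem β g φ A ↔ (X.systemOperator hβ hτ - 1) (φ, A) = ((2 : ℝ) • g, 0) := by
  constructor
  · intro h
    refine Prod.ext (ContinuousMap.ext fun z => ?_) (funext fun j => ?_)
    · obtain ⟨ψ, hψ, heq⟩ := h.integral_eq
      rw [systemOperator_fst, ← hψ.eq hτ z, heq z]
      rfl
    · rw [systemOperator_snd]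
      split_ifs with hj
      · exact h.mean_zero j hj
      · exact h.sum_zero
  · intro h
    refine ⟨⟨X.boundaryOperator hτ φ, X.boundaryDoubleLayerEq hτ φ, fun z => ?_⟩, fun j hj => ?_, ?_⟩
    · have h1 := congrArg (fun p : C(X.boundary, ℝ) × (Fin M → ℝ) => p.1 z) h
      simp only [systemOperator_fst, ContinuousMap.smul_apply, smul_eq_mul] at h1
      rw [boundaryOperator_apply]
      linarith
    · have h1 := congrArg (fun p : C(X.boundary, ℝ) × (Fin M → ℝ) => p.2 j) h
      simpa only [systemOperator_snd, if_pos hj, Pi.zero_apply] using h1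
    -- The index M - 1, free because only M - 1 means are prescribed, holds the condition ∑ A_j = 0;
    -- here M ≥ 1 is needed.
    · have h1 := congrArg (fun p : C(X.boundary, ℝ) × (Fin M → ℝ) => p.2 ⟨M - 1, by omega⟩) h
      simp only [systemOperator_snd] at h1
      rwa [if_neg (by omega)] at h1

variable {X}

/-- The represented function has boundary values 0, so it vanishes in Ω by the maximum principle.
Its fluxes are the coefficients, which therefore vanish, and only the double layer is left. -/
theorem SolvesSystem.eq_zero (hβ : ∀ j, β j ∈ (X.hole j).carrier) (hτ : 0 < τ.im) (hM : 1 ≤ M)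
    {φ : C(X.boundary, ℝ)} {A : Fin M → ℝ} (h : X.SolvesSystem β 0 φ A) : φ = 0 ∧ A = 0 := by
  have hsol := h.isDirichletSolution hβ hτ
  have hzero : X.IsDirichletSolution 0 fun _ => 0 :=
    ⟨fun _ _ _ _ => rfl, fun z _ => InnerProductSpace.harmonicAt_const 0,
      fun z₀ => tendsto_const_nhds⟩
  have hu := hsol.eqOn hτ hM hzero
  have hA : A = 0 := funext fun j => by
    obtain ⟨h₀, ⟨hmem, hflux⟩⟩ := (X.hasFlux_representation hβ hτ φ h.sum_zero j).parallel.exists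
    rw [← hflux, C2Hole.parallelFlux]
    have : ∀ t, fderiv ℝ (X.representation β φ A) ((X.hole j).parallelCurve h₀ t) = 0 := fun t => by
      have h1 : X.representation β φ A =ᶠ[𝓝 ((X.hole j).parallelCurve h₀ t)] fun _ => 0 := by
        filter_upwards [(X.isOpen_cover hτ).mem_nhds (hmem t)] with w hw
        exact hu hw
      rw [h1.fderiv_eq]
      simp
    simp [this]
  refine ⟨X.eq_zero_of_doubleLayer_eq_zero hτ hM (fun z hz => ?_) (fun j => ⟨_, hβ j⟩) h.mean_zero, hA⟩
  have := hu hz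
  simpa [representation, hA] using this

theorem existsUnique_solvesSystem (hβ : ∀ j, β j ∈ (X.hole j).carrier) (hτ : 0 < τ.im) (hM : 1 ≤ M)
    (g : C(X.boundary, ℝ)) :
    ∃! p : C(X.boundary, ℝ) × (Fin M → ℝ), X.SolvesSystem β g p.1 p.2 := by
  have hbij := IsCompactOperator.bijective_sub_one (X.isCompactOperator_systemOperator hβ hτ)
    (fun p hp => by
      have h := (X.solvesSystem_iff hβ hτ hM 0 p.1 p.2).2 (by rw [smul_zero]; exact hp)
      exact Prod.ext (h.eq_zero hβ hτ hM).1 (h.eq_zero hβ hτ hM).2)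
  simp only [X.solvesSystem_iff hβ hτ hM]
  exact hbij.existsUnique _

end HoledTorus

end DoublyPeriodic

end
open DoublyPeriodic in
theorem mainTheorem1 (τ : ℂ) (hτ : 0 < τ.im) (M : ℕ) (hM : 1 ≤ M) (X : HoledTorus τ M)
    (g : C(X.boundary, ℝ)) (β : Fin M → ℂ) (hβ : ∀ j, β j ∈ (X.hole j).carrier) :
    -- the operator `K` is defined on all of `C(∂Ω)`
    (∀ φ : C(X.boundary, ℝ), ∃ ψ : C(X.boundary, ℝ), X.BoundaryDoubleLayerEq φ ψ) ∧
    (∃! p : C(X.boundary, ℝ) × (Fin M → ℝ), X.SolvesSystem β g p.1 p.2) ∧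
    ∀ (φ : C(X.boundary, ℝ)) (A : Fin M → ℝ), X.SolvesSystem β g φ A →
      X.IsDirichletSolution g (X.representation β φ A) ∧
      (∀ v : ℂ → ℝ, X.IsDirichletSolution g v →
        Set.EqOn v (X.representation β φ A) X.cover) ∧
      ∀ j, X.HasFlux (X.representation β φ A) j (A j) := by
  exact ⟨fun φ => ⟨X.boundaryOperator hτ φ, X.boundaryDoubleLayerEq hτ φ⟩,
    HoledTorus.existsUnique_solvesSystem hβ hτ hM g, fun φ A h =>
      ⟨h.isDirichletSolution hβ hτ, fun v hv => hv.eqOn hτ hM (h.isDirichletSolution hβ hτ),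
        fun j => X.hasFlux_representation hβ hτ φ h.sum_zero j⟩⟩
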